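/- Let $\Sigma$ be a monoid and let $W$ be a finite-dimensional real representation of $\Sigma$. Let $\operatorname{End}(W)$ be the finite-dimensional real algebra of $\Sigma$-equivariant linear maps $W\to W$. Suppose $W=U\oplus U'$ with $U,U'\subseteq W$ invariant subspaces, and that $$U\;\cong\;\bigoplus_{i=1}^{u}(W_i^{R})^{r_i}\;\oplus\;\bigoplus_{i=1}^{v}(W_i^{C})^{c_i}\;\oplus\;\bigoplus_{i=1}^{w}(W_i^{H})^{h_i}$$ as representations, where $r_i,c_i,h_i\ge 0$ are integers and the $W_i^{R},W_i^{C},W_i^{H}$ are pairwise non-isomorphic finite-dimensional real indecomposable representations of real, complex and quaternionic type respectively. (A representation is indecomposable if it is nonzero and is not the direct sum of two nonzero invariant subspaces. An indecomposable representation $V$ is of real, complex or quaternionic type if the quotient of $\operatorname{End}(V)$ by the ideal of its nilpotent elements is isomorphic, as a real algebra, to $\mathbb R$, $\mathbb C$ or $\mathbb H$ respectively.) Put $$K_U:=\sum_i r_i+2\sum_i c_i+4\sum_i h_i,\qquad C_U:=\sum_i\lceil r_i/2\rceil+\sum_i c_i+\sum_i h_i .$$ Let $\operatorname{nil}(U)\subseteq\operatorname{End}(W)$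 be the set of all $A\in\operatorname{End}(W)$ whose generalized kernel (the span of the generalized eigenvectors for the eigenvalue $0$) is isomorphic to $U$ as a representation, and let $\operatorname{cen}(U)\subseteq\operatorname{End}(W)$ be the set of all $A\in\operatorname{End}(W)$ whose center subspace is isomorphic to $U$ as a representation. Here the center subspace consists of the vectors of $W$ that lie, in $\mathbb C\otimes_{\mathbb R} W$, in the span of the generalized eigenvectors of $A$ for the eigenvalues with vanishing real part. Then: 1. $\operatorname{nil}(U)$ is the disjoint union of finitely many nonempty embedded smooth submanifolds of $\operatorname{End}(W)$, each invariant under conjugation by invertible elements of $\operatorname{End}(W)$ and each of codimension at least $K_U$; exactly one of them has codimension equal to $K_U$. 2. $\operatorname{cen}(U)$ is the disjoint union of finitely many nonempty embedded smooth submanifolds of $\operatorname{End}(W)$, each invariant under conjugation by invertible elements of $\operatorname{End}(W)$ and each of codimension at least $C_U$; exactly one of them has codimension equal to $C_U$. -/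

import Mathlib

open scoped ContDiff TensorProduct

namespace MonoidBifurcation

open Representation

section Submanifolds

/-- `M` is an embedded smooth (`C^∞`) submanifold of codimension `d` of the normed space `F`:
around each of its points it is the zero set of a smooth submersion to `ℝ^d`. -/
def IsSubmanifoldNormed {F : Type*} [NormedAddCommGroup F] [NormedSpace ℝ F]
    (M : Set F) (d : ℕ) : Prop :=
  ∀ p ∈ M, ∃ (S : Set F) (f : F → (Fin d → ℝ)), IsOpen S ∧ p ∈ S ∧
    ContDiffOn ℝ ∞ f S ∧ (∀ x ∈ S, Function.Surjective (fderiv ℝ f x)) ∧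
    M ∩ S = {x ∈ S | f x = 0}

/-- `M` is an embedded smooth submanifold of codimension `d` of the finite-dimensional real vector
space `E`, with its standard smooth structure (the one for which every linear isomorphism with
`ℝ^n`, where `n = dim E`, is a diffeomorphism). -/
def IsEmbeddedSubmanifold {E : Type*} [AddCommGroup E] [Module ℝ E] [FiniteDimensional ℝ E]
    (M : Set E) (d : ℕ) : Prop :=
  ∀ e : E ≃ₗ[ℝ] (Fin (Module.finrank ℝ E) → ℝ), IsSubmanifoldNormed (e '' M) d

end Submanifolds

section Representations

variable {G : Type*} [Monoid G] {V : Type*} [AddCommGroup V] [Module ℝ V]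

/-- A nonzero representation which is not the direct sum of two nonzero invariant subspaces. -/
def IsIndecomposable (τ : Representation ℝ G V) : Prop :=
  Nontrivial V ∧ ∀ P Q : Subrepresentation τ, IsCompl P.toSubmodule Q.toSubmodule →
    P.toSubmodule = ⊥ ∨ Q.toSubmodule = ⊥

/-- The three types of indecomposable representations. -/
inductive EndType
  | real
  | complex
  | quaternionic

/-- `End(V) / nil(V) ≅ D` as real algebras, where `nil(V)` is the set of nilpotent
endomorphisms: there is a surjective algebra morphism `End(V) → D` with kernel `nil(V)`. -/
def EndModNilIso (τ : Representation ℝ G V) (D : Type*) [Ring D] [Algebra ℝ D] : Prop :=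
  ∃ f : IntertwiningMap τ τ →ₐ[ℝ] D, Function.Surjective f ∧ ∀ A, f A = 0 ↔ IsNilpotent A

/-- The representation is of real, complex or quaternionic type. -/
def IsOfType (τ : Representation ℝ G V) : EndType → Prop
  | .real => EndModNilIso τ ℝ
  | .complex => EndModNilIso τ ℂ
  | .quaternionic => EndModNilIso τ (Quaternion ℝ)

/-- Contribution to `K_U` of an indecomposable of a given type with multiplicity `m`. -/
def EndType.nilWeight : EndType → ℕ → ℕ
  | .real, m => m
  | .complex, m => 2 * m
  | .quaternionic, m => 4 * m

/-- Contribution to `C_U` of an indecomposable of a given type with multiplicity `m`. -/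
noncomputable def EndType.cenWeight : EndType → ℕ → ℕ
  | .real, m => ⌈(m : ℚ) / 2⌉₊
  | .complex, m => m
  | .quaternionic, m => m

variable {ρ : Representation ℝ G V}

/-- The generalized kernel of an endomorphism, as a subrepresentation. -/
noncomputable def genKer (A : IntertwiningMap ρ ρ) : Subrepresentation ρ where
  toSubmodule := Module.End.maxGenEigenspace A.toLinearMap 0
  apply_mem_toSubmodule g :=
    Module.End.mapsTo_maxGenEigenspace_of_comm (f := A.toLinearMap) (g := ρ g)
      (A.isIntertwining' g) 0

/-- The span, in the complexification of `V`, of the generalized eigenvectors of (the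
complexification of) `A` belonging to eigenvalues with vanishing real part. -/
noncomputable def complexCenter (A : Module.End ℝ V) : Submodule ℂ (ℂ ⊗[ℝ] V) :=
  ⨆ μ : {z : ℂ // z.re = 0}, Module.End.maxGenEigenspace (LinearMap.baseChange ℂ A) (μ : ℂ)

theorem complexCenter_invariant (A B : Module.End ℝ V) (h : A * B = B * A)
    {x : ℂ ⊗[ℝ] V} (hx : x ∈ complexCenter A) : LinearMap.baseChange ℂ B x ∈ complexCenter A := by
  have hc : Commute (LinearMap.baseChange ℂ A : Module.End ℂ (ℂ ⊗[ℝ] V))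
      (LinearMap.baseChange ℂ B) := by
    have h' := congrArg (LinearMap.baseChange ℂ) h
    rwa [LinearMap.baseChange_mul, LinearMap.baseChange_mul] at h'
  have hle : complexCenter A ≤ (complexCenter A).comap (LinearMap.baseChange ℂ B) := by
    refine iSup_le fun μ y hy => ?_
    exact (le_iSup (fun μ : {z : ℂ // z.re = 0} =>
      Module.End.maxGenEigenspace (LinearMap.baseChange ℂ A) (μ : ℂ)) μ)
      (Module.End.mapsTo_maxGenEigenspace_of_comm hc (μ : ℂ) hy)
  exact hle hx

/-- The center subspace of an endomorphism, as a subrepresentation: the real vectors in the span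
of the generalized eigenvectors belonging to eigenvalues with vanishing real part. -/
noncomputable def centerSubspace (A : IntertwiningMap ρ ρ) : Subrepresentation ρ where
  toSubmodule := ((complexCenter A.toLinearMap).restrictScalars ℝ).comap (TensorProduct.mk ℝ ℂ V 1)
  apply_mem_toSubmodule g v hv := by
    have h := complexCenter_invariant A.toLinearMap (ρ g) (A.isIntertwining' g) hv
    simpa using h

/-- The endomorphisms whose generalized kernel is isomorphic to `U`. -/
def nilSet (U : Subrepresentation ρ) : Set (IntertwiningMap ρ ρ) :=
  {A | Nonempty ((genKer A).toRepresentation.Equiv U.toRepresentation)}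

/-- The endomorphisms whose center subspace is isomorphic to `U`. -/
def cenSet (U : Subrepresentation ρ) : Set (IntertwiningMap ρ ρ) :=
  {A | Nonempty ((centerSubspace A).toRepresentation.Equiv U.toRepresentation)}

/-- `M` is invariant under conjugation by invertible equivariant maps. -/
def ConjugacyInvariant (M : Set (IntertwiningMap ρ ρ)) : Prop :=
  ∀ A ∈ M, ∀ C : (IntertwiningMap ρ ρ)ˣ,
    (C : IntertwiningMap ρ ρ) * A * ((C⁻¹ : (IntertwiningMap ρ ρ)ˣ) : IntertwiningMap ρ ρ) ∈ M

/-- `N ⊆ End(V)` is the disjoint union of finitely many (nonempty) conjugacy invariant embedded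
submanifolds of codimension at least `c`, exactly one of which has codimension `c`. -/
def IsUnionOfSubmanifolds [FiniteDimensional ℝ V] (N : Set (IntertwiningMap ρ ρ)) (c : ℕ) : Prop :=
  ∃ (k : ℕ) (M : Fin k → Set (IntertwiningMap ρ ρ)) (d : Fin k → ℕ),
    (∀ i, (M i).Nonempty) ∧ (Pairwise fun i j => Disjoint (M i) (M j)) ∧ N = ⋃ i, M i ∧
    (∀ i, ConjugacyInvariant (M i)) ∧ (∀ i, IsEmbeddedSubmanifold (M i) (d i)) ∧
    (∀ i, c ≤ d i) ∧ ∃! i, d i = c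

end Representations

end MonoidBifurcation

/-! Both halves are one statement about a conjugation-invariant closed set `Z` of eigenvalues, `{0}`
or the imaginary axis, with `1 ∉ Z`. The spectral subspace of `A` for `Z` is the range of an
idempotent `e` that is a polynomial in `A`. `IsSpectralIdem` characterizes `e` by polynomial
identities, so it is carried along by every morphism of real algebras.

Reduction to matrices. The type hypothesis makes `End(τ i)` local with residue algebra `D i`, one of
`ℝ`, `ℂ`, `ℍ`. Splitting copies of the `τ i` off `W` as long as possible gives a surjective morphism
from `End(W)` to a product of matrix algebras over the `D i` (`systemHom`, `exists_systemHom_eq`).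
It sends the projection onto a sum of `m i` copies of the `τ i` to idempotents of rank `m i`.
Conversely, the spectral subspace is isomorphic to `U` exactly when the images of `e` have ranks `m
i` and the range of `e` is not larger than `U` (`exists_systemIdem_eq_iff`). The last condition is
open (`isOpen_spectralRank_le`). The set in question is therefore an open piece of the preimage,
under a surjective linear map, of a product of sets "the spectral idempotent has rank `m i`" in
matrix algebras. Codimensions are preserved by the preimage and add up in the product, and
`exists_systemHom_eq_and_finrank_le` shows that the open condition empties no stratum.

Eigenvalue zero. Matrices over `D` are sorted by their rank. Near a matrix of corank `k`, having
that corank means the vanishing of a `k × k` Schur complement, and the restriction to the range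
varies submersively (`exists_local_isRangeRestriction`). Iterating, a sequence of coranks `k₁, k₂,
…` with sum `r` costs `dim D · ∑ kⱼ²`. The minimum `dim D · r` is attained only if all `kⱼ` are one,
that is by a single Jordan block.

Imaginary axis. The largest frequency `θ` is peeled off. On the corresponding generalized eigenspace
`A` is a complex `s × s` matrix, `iθ` plus a nilpotent. Nilpotents have codimension at least `2s`,
and letting `θ` move gains one (`SubmanifoldAt.add_line`). By `exists_local_conj`, codimensions in
the full matrix algebra agree with those in the algebra of blocks. A block uses up rank `2s` over
`ℝ` and rank `s` over `ℂ` and `ℍ`, so the minimum `⌈r/2⌉`, respectively `r`, requires `s = 1` at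
every step, with at most a simple eigenvalue zero left over in the real case. `FrequencyModel`
treats the three algebras together.

`HasStrat` carries the count of minimal strata through all these constructions. It also records test
sets met by each minimal stratum, so that open conditions imposed later do not empty it. -/

namespace MonoidBifurcation

open scoped ContDiff TensorProduct Topology Polynomial ComplexConjugate
open Filter Function Polynomial

set_option linter.unusedSectionVars false

/-! ### Submanifolds as local zero sets of submersions -/

section LocalSubmanifolds

variable {F F' Y : Type*} [NormedAddCommGroup F] [NormedSpace ℝ F]
  [NormedAddCommGroup F'] [NormedSpace ℝ F'] [NormedAddCommGroup Y] [NormedSpace ℝ Y]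

/-- Near `p`, the set `M` is the zero set of an analytic map to `ℝ^d` which is a submersion
at `p`. -/
def SubmanifoldAt (M : Set F) (d : ℕ) (p : F) : Prop :=
  ∃ f : F → (Fin d → ℝ), ContDiffAt ℝ ω f p ∧ Surjective (fderiv ℝ f p) ∧
    ∀ᶠ x in 𝓝 p, x ∈ M ↔ f x = 0

theorem SubmanifoldAt.of_map [FiniteDimensional ℝ Y] {M : Set F} {d : ℕ} {p : F}
    (hd : Module.finrank ℝ Y = d) (f : F → Y) (hf : ContDiffAt ℝ ω f p)
    (hs : Surjective (fderiv ℝ f p)) (h : ∀ᶠ x in 𝓝 p, x ∈ M ↔ f x = 0) :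
    SubmanifoldAt M d p := by
  let e : Y ≃L[ℝ] (Fin d → ℝ) := ContinuousLinearEquiv.ofFinrankEq (by simp [hd])
  refine ⟨fun x => e (f x), e.contDiff.contDiffAt.comp p hf, ?_, ?_⟩
  · have : fderiv ℝ (fun x => e (f x)) p = (e : Y →L[ℝ] (Fin d → ℝ)).comp (fderiv ℝ f p) :=
      e.comp_fderiv
    rw [this]
    exact e.surjective.comp hs
  · filter_upwards [h] with x hx
    rw [hx, map_eq_zero_iff e e.injective]

theorem SubmanifoldAt.congr {M M' : Set F} {d : ℕ} {p : F} (h : SubmanifoldAt M d p)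
    (hM : ∀ᶠ x in 𝓝 p, x ∈ M' ↔ x ∈ M) : SubmanifoldAt M' d p := by
  obtain ⟨f, hf, hs, hz⟩ := h
  refine ⟨f, hf, hs, ?_⟩
  filter_upwards [hM, hz] with x h1 h2
  rw [h1, h2]

/-- With `R` a right inverse of `g p`, the composite `g x ∘ R` is close to the identity for `x` near
`p`, hence invertible. -/
theorem eventually_surjective_of_continuousAt {d : ℕ} {g : F → F' →L[ℝ] (Fin d → ℝ)} {p : F}
    (hg : ContinuousAt g p) (hs : Surjective (g p)) : ∀ᶠ x in 𝓝 p, Surjective (g x) := by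
  obtain ⟨r, hr⟩ := (g p : F' →ₗ[ℝ] (Fin d → ℝ)).exists_rightInverse_of_surjective
    (LinearMap.range_eq_top.2 hs)
  let R : (Fin d → ℝ) →L[ℝ] F' := LinearMap.toContinuousLinearMap r
  have hc : ContinuousAt (fun x => (g x).comp R) p :=
    hg.clm_comp continuousAt_const
  have h1 : (g p).comp R = 1 := by
    ext1 y
    exact congrArg (fun l => l y) hr
  have hU : ∀ᶠ x in 𝓝 p, IsUnit ((g x).comp R) := by
    refine hc.eventually (Units.isOpen.mem_nhds ?_)
    simp [h1]
  filter_upwards [hU] with x hx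
  obtain ⟨u, hu⟩ := hx
  intro y
  refine ⟨R ((u⁻¹ : ((Fin d → ℝ) →L[ℝ] (Fin d → ℝ))ˣ).1 y), ?_⟩
  have := congrArg (fun l : (Fin d → ℝ) →L[ℝ] (Fin d → ℝ) => l y) (Units.mul_inv u)
  rw [hu] at this
  exact this

theorem isSubmanifoldNormed_of_submanifoldAt {M : Set F} {d : ℕ}
    (h : ∀ p ∈ M, SubmanifoldAt M d p) : IsSubmanifoldNormed M d := by
  intro p hp
  obtain ⟨f, hf, hs, hz⟩ := h p hp
  -- This is why analytic maps are used: regularity `ω` at a point spreads to a neighbourhood, while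
  -- being `C^∞` at a point only gives neighbourhoods depending on the order of differentiation.
  have h1 : ∀ᶠ x in 𝓝 p, ContDiffAt ℝ ω f x := hf.eventually (by simp)
  have hc : ContinuousAt (fderiv ℝ f) p :=
    (hf.fderiv_right (m := 0) (by simp)).continuousAt
  have h2 := eventually_surjective_of_continuousAt hc hs
  obtain ⟨S, hS, hSo, hpS⟩ := eventually_nhds_iff.1 (h1.and (h2.and hz))
  refine ⟨S, f, hSo, hpS, fun x hx => ((hS x hx).1.of_le le_top).contDiffWithinAt,
    fun x hx => (hS x hx).2.1, ?_⟩
  ext x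
  constructor
  · rintro ⟨hM, hx⟩
    exact ⟨hx, ((hS x hx).2.2).1 hM⟩
  · rintro ⟨hx, h0⟩
    exact ⟨((hS x hx).2.2).2 h0, hx⟩

/-- The preimage of a submanifold under a submersion, intersected with the zero set of further
coordinates of that submersion. -/
theorem SubmanifoldAt.transfer [FiniteDimensional ℝ Y] {M : Set F} {M' : Set F'} {p : F}
    {d : ℕ} {f₁ : F → Y} {f₂ : F → F'} (hM' : SubmanifoldAt M' d (f₂ p))
    (h₁ : ContDiffAt ℝ ω f₁ p) (h₂ : ContDiffAt ℝ ω f₂ p)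
    (hs : Surjective (fderiv ℝ (fun x => (f₁ x, f₂ x)) p))
    (h : ∀ᶠ x in 𝓝 p, x ∈ M ↔ f₁ x = 0 ∧ f₂ x ∈ M') :
    SubmanifoldAt M (d + Module.finrank ℝ Y) p := by
  obtain ⟨f, hf, hfs, hz⟩ := hM'
  have hd1 : DifferentiableAt ℝ f₁ p := h₁.differentiableAt (by simp)
  have hd2 : DifferentiableAt ℝ f₂ p := h₂.differentiableAt (by simp)
  have hdf : DifferentiableAt ℝ f (f₂ p) := hf.differentiableAt (by simp)
  refine SubmanifoldAt.of_map (Y := Y × (Fin d → ℝ)) (by simp [add_comm])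
    (fun x => (f₁ x, f (f₂ x))) (h₁.prodMk (hf.comp p h₂)) ?_ ?_
  · have e1 := (hd1.hasFDerivAt.prodMk (hdf.hasFDerivAt.comp p hd2.hasFDerivAt)).fderiv
    have e2 := (hd1.hasFDerivAt.prodMk hd2.hasFDerivAt).fderiv
    rw [e2] at hs
    have e1' : fderiv ℝ (fun x => (f₁ x, f (f₂ x))) p =
      (fderiv ℝ f₁ p).prod ((fderiv ℝ f (f₂ p)).comp (fderiv ℝ f₂ p)) := e1
    rw [e1']
    rintro ⟨y, z⟩
    obtain ⟨w, hw⟩ := hfs z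
    obtain ⟨v, hv⟩ := hs (y, w)
    simp only [ContinuousLinearMap.prod_apply, Prod.mk.injEq] at hv
    exact ⟨v, by simp [hv.1, hv.2, hw]⟩
  · filter_upwards [h, h₂.continuousAt.eventually hz] with x hx hx'
    rw [hx, Prod.mk_eq_zero, hx']

/-- A map with a differentiable local section is a submersion. -/
theorem surjective_fderiv_of_section {f : F → F'} {σ : F' → F} {p : F}
    (hf : DifferentiableAt ℝ f p) (hσ : DifferentiableAt ℝ σ (f p)) (hp : σ (f p) = p)
    (h : ∀ᶠ y in 𝓝 (f p), f (σ y) = y) : Surjective (fderiv ℝ f p) := by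
  have h1 : HasFDerivAt (f ∘ σ) ((fderiv ℝ f p).comp (fderiv ℝ σ (f p))) (f p) := by
    refine HasFDerivAt.comp (f p) ?_ hσ.hasFDerivAt
    rw [hp]; exact hf.hasFDerivAt
  have h2 : HasFDerivAt (f ∘ σ) (ContinuousLinearMap.id ℝ F') (f p) :=
    (hasFDerivAt_id (f p)).congr_of_eventuallyEq h
  have h3 := h1.unique h2
  intro y
  exact ⟨fderiv ℝ σ (f p) y, congrArg (fun l => l y) h3⟩

theorem SubmanifoldAt.preimage {M' : Set F'} {p : F} {d : ℕ} (L : F →L[ℝ] F')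
    (hL : Surjective L) (hM' : SubmanifoldAt M' d (L p)) : SubmanifoldAt (L ⁻¹' M') d p := by
  have := SubmanifoldAt.transfer (Y := Fin 0 → ℝ) (M := L ⁻¹' M') (f₁ := fun _ => 0) (f₂ := L)
    (p := p) hM' contDiffAt_const L.contDiff.contDiffAt ?_ (Eventually.of_forall fun x => by simp)
  · simpa using this
  · have e2 : HasFDerivAt (fun x => ((0 : Fin 0 → ℝ), L x))
      ((0 : F →L[ℝ] (Fin 0 → ℝ)).prod L) p := (hasFDerivAt_const _ _).prodMk L.hasFDerivAt
    rw [e2.fderiv]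
    rintro ⟨y, z⟩
    obtain ⟨x, rfl⟩ := hL z
    exact ⟨x, Prod.ext (Subsingleton.elim _ _) rfl⟩

theorem SubmanifoldAt.prod {M : Set F} {M' : Set F'} {p : F × F'} {d d' : ℕ}
    (h : SubmanifoldAt M d p.1) (h' : SubmanifoldAt M' d' p.2) :
    SubmanifoldAt (M ×ˢ M') (d + d') p := by
  obtain ⟨f, hf, hs, hz⟩ := h
  obtain ⟨f', hf', hs', hz'⟩ := h'
  have a1 : ContDiffAt ℝ ω (fun x : F × F' => f x.1) p := hf.comp p contDiffAt_fst
  have a2 : ContDiffAt ℝ ω (fun x : F × F' => f' x.2) p := hf'.comp p contDiffAt_snd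
  refine SubmanifoldAt.of_map (Y := (Fin d → ℝ) × (Fin d' → ℝ)) (by simp)
    (fun x => (f x.1, f' x.2)) (a1.prodMk a2) ?_ ?_
  · have e : HasFDerivAt (fun x : F × F' => (f x.1, f' x.2))
      (((fderiv ℝ f p.1).comp (.fst ℝ F F')).prod ((fderiv ℝ f' p.2).comp (.snd ℝ F F'))) p :=
      ((hf.differentiableAt (by simp)).hasFDerivAt.comp p hasFDerivAt_fst).prodMk
        ((hf'.differentiableAt (by simp)).hasFDerivAt.comp p hasFDerivAt_snd)
    rw [e.fderiv]
    rintro ⟨y, z⟩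
    obtain ⟨x, rfl⟩ := hs y
    obtain ⟨x', rfl⟩ := hs' z
    exact ⟨(x, x'), rfl⟩
  · filter_upwards [continuousAt_fst.eventually hz, continuousAt_snd.eventually hz'] with x h1 h2
    rw [Set.mem_prod, h1, h2, Prod.mk_eq_zero]

theorem SubmanifoldAt.pi {ι : Type*} [Fintype ι] {E : ι → Type*}
    [∀ i, NormedAddCommGroup (E i)] [∀ i, NormedSpace ℝ (E i)] {M : ∀ i, Set (E i)}
    {p : ∀ i, E i} {d : ι → ℕ} (h : ∀ i, SubmanifoldAt (M i) (d i) (p i)) :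
    SubmanifoldAt (Set.univ.pi M) (∑ i, d i) p := by
  choose f hf hs hz using h
  refine SubmanifoldAt.of_map (Y := ∀ i, Fin (d i) → ℝ) (by simp [Module.finrank_pi_fintype])
    (fun x i => f i (x i)) (contDiffAt_pi.2 fun i =>
      (hf i).comp p ((ContinuousLinearMap.proj (R := ℝ) (φ := E) i).contDiff.contDiffAt)) ?_ ?_
  · have e : HasFDerivAt (fun (x : ∀ i, E i) i => f i (x i))
      (ContinuousLinearMap.pi fun i => (fderiv ℝ (f i) (p i)).comp (.proj i)) p :=
      hasFDerivAt_pi.2 fun i =>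
        ((hf i).differentiableAt (by simp)).hasFDerivAt.comp p
          (ContinuousLinearMap.proj (R := ℝ) (φ := E) i).hasFDerivAt
    rw [e.fderiv]
    intro y
    choose x hx using fun i => hs i (y i)
    exact ⟨x, funext hx⟩
  · have : ∀ᶠ x : ∀ i, E i in 𝓝 p, ∀ i, (x i ∈ M i ↔ f i (x i) = 0) :=
      eventually_all.2 fun i => (continuous_apply i).continuousAt.eventually (hz i)
    filter_upwards [this] with x hx
    simp [Set.mem_pi, hx, funext_iff]

end LocalSubmanifolds

/-! ### Adding a transverse line to a submanifold of a hyperplane -/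

section Suspension

variable {F : Type*} [NormedAddCommGroup F] [NormedSpace ℝ F] [CompleteSpace F]

/-- If the derivative killed `v`, then `(f, h)` would be a submersion at `p`, hence open there. So
`f = 0` would have solutions near `p` with `h ≠ 0`, against `M ⊆ ker h`. -/
theorem fderiv_apply_ne_zero_of_subset_ker {M : Set F} {n : ℕ} {p v : F} (h : F →L[ℝ] ℝ)
    (hv : h v = 1) (hM : ∀ x ∈ M, h x = 0) {f : F → (Fin n → ℝ)} (hp : p ∈ M)
    (hf : ContDiffAt ℝ ω f p) (hs : Surjective (fderiv ℝ f p))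
    (hz : ∀ᶠ x in 𝓝 p, x ∈ M ↔ f x = 0) : fderiv ℝ f p v ≠ 0 := by
  intro h0
  have hst : HasStrictFDerivAt (fun x => (f x, h x)) ((fderiv ℝ f p).prod h) p :=
    (hf.hasStrictFDerivAt (by simp)).prodMk h.hasStrictFDerivAt
  have hsurj : ((fderiv ℝ f p).prod h).range = ⊤ := by
    refine LinearMap.range_eq_top.2 ?_
    rintro ⟨y, t⟩
    obtain ⟨x, rfl⟩ := hs y
    exact ⟨x + (t - h x) • v, by simp [h0, hv]⟩
  have hmap := hst.map_nhds_eq_of_surj hsurj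
  have hfp : f p = 0 := hz.self_of_nhds.1 hp
  have h1 : ∀ᶠ y in 𝓝 (f p, h p), ∃ x, (x ∈ M ↔ f x = 0) ∧ (f x, h x) = y := by
    rw [← hmap, eventually_map]
    filter_upwards [hz] with x hx
    exact ⟨x, hx, rfl⟩
  rw [hfp, hM p hp] at h1
  have hc : Tendsto (fun t : ℝ => ((0 : Fin n → ℝ), t)) (𝓝[≠] 0) (𝓝 (0, 0)) :=
    (Continuous.prodMk_right (0 : Fin n → ℝ)).continuousAt.mono_left nhdsWithin_le_nhds
  obtain ⟨t, ⟨x, hx, hxt⟩, ht⟩ := ((hc.eventually h1).and self_mem_nhdsWithin).exists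
  simp only [Prod.mk.injEq] at hxt
  exact ht (by rw [← hxt.2]; exact hM x (hx.2 hxt.1))

/-- If a submanifold lies in the hyperplane `ker h`, then its sum with a line complementary to
`ker h` is a submanifold of one dimension more. -/
theorem SubmanifoldAt.add_line {M : Set F} {d : ℕ} {q v : F} (h : F →L[ℝ] ℝ) (hv : h v = 1)
    (hM : ∀ x ∈ M, h x = 0) (hq : q - h q • v ∈ M)
    (hsub : SubmanifoldAt M (d + 1) (q - h q • v)) :
    SubmanifoldAt {x | x - h x • v ∈ M} d q := by
  obtain ⟨f, hf, hs, hz⟩ := hsub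
  set p := q - h q • v with hpdef
  set f' := fderiv ℝ f p with hf'
  have hw0 := fderiv_apply_ne_zero_of_subset_ker h hv hM hq hf hs hz
  set w := f' v with hw
  obtain ⟨ℓ, hℓ⟩ : ∃ ℓ : (Fin (d + 1) → ℝ) →L[ℝ] ℝ, ℓ w = 1 :=
    SeparatingDual.exists_eq_one hw0
  let K := LinearMap.ker (ℓ : (Fin (d + 1) → ℝ) →ₗ[ℝ] ℝ)
  have hK : Module.finrank ℝ K = d := by
    have h1 := LinearMap.finrank_range_add_finrank_ker (ℓ : (Fin (d + 1) → ℝ) →ₗ[ℝ] ℝ)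
    have h2 : LinearMap.range (ℓ : (Fin (d + 1) → ℝ) →ₗ[ℝ] ℝ) = ⊤ :=
      LinearMap.range_eq_top.2 fun t => ⟨t • w, by simp [hℓ]⟩
    rw [h2, finrank_top] at h1
    simp only [Module.finrank_self, Module.finrank_fintype_fun_eq_card, Fintype.card_fin] at h1
    change 1 + Module.finrank ℝ K = d + 1 at h1
    omega
  let Pr : (Fin (d + 1) → ℝ) →L[ℝ] K :=
    ((ContinuousLinearMap.id ℝ (Fin (d + 1) → ℝ)) - ℓ.smulRight w).codRestrict K
      (fun y => by simp [K, hℓ])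
  have hPr : ∀ y, (Pr y : Fin (d + 1) → ℝ) = y - ℓ y • w := fun y => rfl
  have hPrw : Pr w = 0 := by ext1; simp [hPr, hℓ]
  let φ : F →L[ℝ] F := ContinuousLinearMap.id ℝ F - h.smulRight v
  have hφ : ∀ x, φ x = x - h x • v := fun x => rfl
  have hhφ : ∀ x, h (φ x) = 0 := fun x => by simp [hφ, hv]
  -- `φ` projects to `ker h` along `v`, and `A (x, t)` is the point at height `t` over `φ x`. One of
  -- the `d + 1` equations for `M`, namely `ℓ ∘ f = 0`, is used to solve for the height; the
  -- remaining `d` equations then define the suspension.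
  let A : F × ℝ →L[ℝ] F := φ.comp (.fst ℝ F ℝ) + (ContinuousLinearMap.snd ℝ F ℝ).smulRight v
  have hA : ∀ x t, A (x, t) = φ x + t • v := fun x t => rfl
  let G : F × ℝ → ℝ := fun x => ℓ (f (A x))
  have hAq : A (q, 0) = p := by simp [hA, hφ, hpdef]
  have hfA : ContDiffAt ℝ ω (fun x => f (A x)) (q, 0) := by
    refine ContDiffAt.comp (q, (0 : ℝ)) ?_ A.contDiff.contDiffAt
    rw [hAq]; exact hf
  have hG : ContDiffAt ℝ ω G (q, 0) := ℓ.contDiff.contDiffAt.comp _ hfA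
  have hG' : fderiv ℝ G (q, 0) = ℓ.comp (f'.comp A) := by
    have : HasFDerivAt G (ℓ.comp (f'.comp A)) (q, 0) := by
      refine ℓ.hasFDerivAt.comp _ (HasFDerivAt.comp (q, (0 : ℝ)) ?_ A.hasFDerivAt)
      rw [hAq]; exact (hf.differentiableAt (by simp)).hasFDerivAt
    exact this.fderiv
  have hinv : (fderiv ℝ G (q, 0) ∘L .inr ℝ F ℝ).IsInvertible := by
    have : fderiv ℝ G (q, 0) ∘L .inr ℝ F ℝ = ContinuousLinearMap.id ℝ ℝ := by
      rw [hG']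
      ext
      simp [hA, ← hw, hℓ]
    rw [this]
    exact ⟨ContinuousLinearEquiv.refl ℝ ℝ, rfl⟩
  let ψ := hG.implicitFunction (by simp) hinv
  have hψ0 : ψ q = 0 := hG.implicitFunction_apply_self (by simp) hinv
  have hψc : ContDiffAt ℝ ω ψ q := hG.contDiffAt_implicitFunction (by simp) hinv
  have hfp : f p = 0 := hz.self_of_nhds.1 hq
  have hG0 : G (q, 0) = 0 := by simp [G, hAq, hfp]
  have e1 : ∀ᶠ x in 𝓝 q, G (x, ψ x) = 0 := by
    filter_upwards [hG.eventually_apply_implicitFunction (by simp) hinv] with x hx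
    rw [← hG0]; exact hx
  have e2 : ∀ᶠ x in 𝓝 q, G (x, 0) = 0 → ψ x = 0 := by
    have hc : ContinuousAt (fun x : F => (x, (0 : ℝ))) q := by fun_prop
    filter_upwards [hc.eventually (hG.eventually_apply_eq_iff_implicitFunction (by simp) hinv)]
      with x hx h0
    exact hx.1 (by rw [h0, hG0])
  have hB : ContDiffAt ℝ ω (fun x => (x, ψ x)) q := contDiffAt_id.prodMk hψc
  have hfB : ContDiffAt ℝ ω (fun x => f (A (x, ψ x))) q :=
    ContDiffAt.comp (g := fun x => f (A x)) q (by rw [hψ0]; exact hfA) hB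
  have hcA : ContinuousAt (fun x => A (x, ψ x)) q :=
    A.continuous.continuousAt.comp hB.continuousAt
  have hcA' : Tendsto (fun x => A (x, ψ x)) (𝓝 q) (𝓝 p) := by
    have := hcA.tendsto
    rwa [hψ0, hAq] at this
  have hcφ : Tendsto φ (𝓝 q) (𝓝 p) := φ.continuous.continuousAt
  refine SubmanifoldAt.of_map (Y := K) hK (fun x => Pr (f (A (x, ψ x))))
    (Pr.contDiff.contDiffAt.comp q hfB) ?_ ?_
  · have hd : HasFDerivAt (fun x => Pr (f (A (x, ψ x))))
        (Pr.comp (f'.comp (A.comp ((ContinuousLinearMap.id ℝ F).prod (fderiv ℝ ψ q))))) q := by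
      refine Pr.hasFDerivAt.comp q (HasFDerivAt.comp q ?_ (A.hasFDerivAt.comp q
        ((hasFDerivAt_id q).prodMk (hψc.differentiableAt (by simp)).hasFDerivAt)))
      rw [hψ0, hAq]; exact (hf.differentiableAt (by simp)).hasFDerivAt
    rw [hd.fderiv]
    rintro ⟨z, hz'⟩
    obtain ⟨y, hy⟩ := hs z
    refine ⟨y, ?_⟩
    have : f' (φ y) = z - h y • w := by rw [hφ, map_sub, map_smul, hy]
    simp only [ContinuousLinearMap.comp_apply, ContinuousLinearMap.prod_apply, hA, map_add,
      map_smul, ContinuousLinearMap.id_apply, this, map_sub, ← hw, hPrw]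
    ext1
    have : ℓ z = 0 := hz'
    simp [hPr, this]
  · filter_upwards [e1, e2, hcA'.eventually hz, hcφ.eventually hz] with x h1 h2 h3 h4
    have h5 : Pr (f (A (x, ψ x))) = 0 ↔ f (A (x, ψ x)) = 0 := by
      rw [Subtype.ext_iff, hPr]
      have : ℓ (f (A (x, ψ x))) = 0 := h1
      simp [this]
    rw [h5, ← h3]
    -- If `φ x ∈ M`, height zero solves the equation, so `ψ x = 0`. Conversely, `f (A (x, ψ x)) = 0`
    -- puts that point in `M ⊆ ker h`, and its height `ψ x` vanishes.
    have h6 : ψ x = 0 → A (x, ψ x) = φ x := fun h => by simp [hA, h]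
    change φ x ∈ M ↔ _
    constructor
    · intro hx
      rw [h6 (h2 ?_)]
      · exact hx
      · have : A (x, 0) = φ x := by simp [hA]
        simp [G, this, h4.1 hx]
    · intro hx
      have := hM _ hx
      rw [hA, map_add, map_smul, hhφ, hv] at this
      rw [← h6 (by simpa using this)]
      exact hx

end Suspension

/-! ### Calculus of finite stratifications with a count of the minimal strata -/

section Stratifications

variable {F F' : Type*} [NormedAddCommGroup F] [NormedSpace ℝ F]
  [NormedAddCommGroup F'] [NormedSpace ℝ F']

/-- `N` is the disjoint union of finitely many `rel`-invariant (possibly empty) submanifolds of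
codimension at least `c`. Exactly `k` of them have codimension `c`, and each of these `k` meets
all of the sets `w t`. -/
def HasStrat (rel : F → F → Prop) (w : ℝ → Set F) (N : Set F) (c k : ℕ) : Prop :=
  ∃ (I : Type) (_ : Fintype I) (M : I → Set F) (d : I → ℕ),
    (Pairwise fun i j => Disjoint (M i) (M j)) ∧ N = ⋃ i, M i ∧
    (∀ i x y, rel x y → x ∈ M i → y ∈ M i) ∧ (∀ i, ∀ p ∈ M i, SubmanifoldAt (M i) (d i) p) ∧
    (∀ i, c ≤ d i) ∧ Nat.card {i // d i = c} = k ∧ ∀ i, d i = c → ∀ t, (M i ∩ w t).Nonempty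

variable {rel : F → F → Prop} {rel' : F' → F' → Prop} {w : ℝ → Set F} {w' : ℝ → Set F'}
  {N : Set F} {N' : Set F'} {c c' k k' : ℕ}

theorem HasStrat.of_fintype {I : Type*} [Fintype I] (M : I → Set F) (d : I → ℕ)
    (h1 : Pairwise fun i j => Disjoint (M i) (M j)) (h2 : N = ⋃ i, M i)
    (h3 : ∀ i x y, rel x y → x ∈ M i → y ∈ M i) (h4 : ∀ i, ∀ p ∈ M i, SubmanifoldAt (M i) (d i) p)
    (h5 : ∀ i, c ≤ d i) (h6 : Nat.card {i // d i = c} = k)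
    (h7 : ∀ i, d i = c → ∀ t, (M i ∩ w t).Nonempty) : HasStrat rel w N c k := by
  let e := Fintype.equivFin I
  refine ⟨Fin (Fintype.card I), inferInstance, M ∘ e.symm, d ∘ e.symm, ?_, ?_,
    fun i => h3 _, fun i => h4 _, fun i => h5 _, ?_, fun i => h7 _⟩
  · intro i j hij
    exact h1 (e.symm.injective.ne hij)
  · rw [h2]
    exact (e.symm.surjective.iUnion_comp M).symm
  · rw [← h6]
    exact Nat.card_congr (e.symm.subtypeEquiv fun _ => Iff.rfl)

theorem HasStrat.of_isEmpty (w : ℝ → Set F) (c : ℕ) : HasStrat rel w ∅ c 0 :=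
  .of_fintype (I := Empty) (fun i => i.elim) (fun i => i.elim) (fun i => i.elim) (by simp)
    (fun i => i.elim) (fun i => i.elim) (fun i => i.elim) (by simp) (fun i => i.elim)

theorem HasStrat.of_lt (h : HasStrat rel w N c k) (hc : c' < c) (w₁ : ℝ → Set F) :
    HasStrat rel w₁ N c' 0 := by
  obtain ⟨I, _, M, d, h1, h2, h3, h4, h5, h6, h7⟩ := h
  have hd : ∀ i, d i ≠ c' := fun i => (hc.trans_le (h5 i)).ne'
  refine ⟨I, inferInstance, M, d, h1, h2, h3, h4, fun i => hc.le.trans (h5 i), ?_,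
    fun i hi => absurd hi (hd i)⟩
  have : IsEmpty {i // d i = c'} := ⟨fun i => hd _ i.2⟩
  exact Nat.card_of_isEmpty

theorem HasStrat.iUnion {J : Type*} [Fintype J] {N : J → Set F} {k : J → ℕ}
    (hN : Pairwise fun i j => Disjoint (N i) (N j)) (h : ∀ j, HasStrat rel w (N j) c (k j)) :
    HasStrat rel w (⋃ j, N j) c (∑ j, k j) := by
  choose I hI M d h1 h2 h3 h4 h5 h6 h7 using h
  refine .of_fintype (I := Σ j, I j) (fun i => M i.1 i.2) (fun i => d i.1 i.2) ?_ ?_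
    (fun i => h3 _ _) (fun i => h4 _ _) (fun i => h5 _ _) ?_ (fun i => h7 _ _)
  · rintro ⟨i, x⟩ ⟨j, y⟩ hij
    by_cases hj : i = j
    · subst hj
      exact h1 i fun hxy : x = y => hij (by rw [hxy])
    · refine (hN hj).mono ?_ ?_
      · rw [h2 i]; exact Set.subset_iUnion (M i) x
      · rw [h2 j]; exact Set.subset_iUnion (M j) y
  · rw [Set.iUnion_sigma]
    exact Set.iUnion_congr h2
  · let e : {i : Σ j, I j // d i.1 i.2 = c} ≃ Σ j, {i : I j // d j i = c} :=
      { toFun := fun i => ⟨i.1.1, i.1.2, i.2⟩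
        invFun := fun i => ⟨⟨i.1, i.2.1⟩, i.2.2⟩
        left_inv := fun _ => rfl
        right_inv := fun _ => rfl }
    rw [Nat.card_congr e, Nat.card_sigma]
    exact Finset.sum_congr rfl fun j _ => h6 j

theorem HasStrat.union {N₁ N₂ : Set F} {k₁ k₂ : ℕ} (h₁ : HasStrat rel w N₁ c k₁)
    (h₂ : HasStrat rel w N₂ c k₂) (hN : Disjoint N₁ N₂) :
    HasStrat rel w (N₁ ∪ N₂) c (k₁ + k₂) := by
  have := HasStrat.iUnion (J := Bool) (rel := rel) (w := w) (c := c)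
    (N := fun b => cond b N₁ N₂) (k := fun b => cond b k₁ k₂) ?_ ?_
  · simpa [Set.union_eq_iUnion, add_comm] using this
  · rintro (_ | _) (_ | _) h
    · exact absurd rfl h
    · exact hN.symm
    · exact hN
    · exact absurd rfl h
  · rintro (_ | _)
    · exact h₂
    · exact h₁

/-- An open condition does not change codimensions. The test sets guarantee that it does not empty a
minimal stratum. -/
theorem HasStrat.inter_open (h : HasStrat rel w N c k) {O : Set F} (hO : IsOpen O)
    (hrel : ∀ x y, rel x y → x ∈ O → y ∈ O)
    {w' : ℝ → Set F} (hw : ∀ t, ∃ s, ∀ x ∈ N, x ∈ w s → x ∈ O ∧ x ∈ w' t) :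
    HasStrat rel w' (N ∩ O) c k := by
  obtain ⟨I, _, M, d, h1, h2, h3, h4, h5, h6, h7⟩ := h
  refine ⟨I, inferInstance, fun i => M i ∩ O, d,
    fun i j hij => (h1 hij).mono Set.inter_subset_left Set.inter_subset_left, ?_,
    fun i x y hxy hx => ⟨h3 i x y hxy hx.1, hrel x y hxy hx.2⟩, ?_, h5, h6, ?_⟩
  · rw [h2, Set.iUnion_inter]
  · rintro i p ⟨hp, hpO⟩
    refine (h4 i p hp).congr ?_
    filter_upwards [hO.mem_nhds hpO] with x hx
    exact ⟨fun h => h.1, fun h => ⟨h, hx⟩⟩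
  · intro i hi t
    obtain ⟨s, hs⟩ := hw t
    obtain ⟨x, hx, hxw⟩ := h7 i hi s
    have hxN : x ∈ N := by rw [h2]; exact Set.mem_iUnion_of_mem i hx
    exact ⟨x, ⟨hx, (hs x hxN hxw).1⟩, (hs x hxN hxw).2⟩

/-- A product stratum is minimal exactly when both factors are. In the hypothesis on test sets, `s`
may depend on the chosen `x'`: later the frequency of the first factor has to exceed a bound that
depends on the second. -/
theorem HasStrat.prod (h : HasStrat rel w N c k) (h' : HasStrat rel' w' N' c' k')
    {w₁ : ℝ → Set (F × F')}
    (hw : ∀ t, ∃ t', ∀ x' ∈ w' t', ∃ s, ∀ x ∈ w s, (x, x') ∈ w₁ t) :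
    HasStrat (fun x y : F × F' => rel x.1 y.1 ∧ rel' x.2 y.2) w₁ (N ×ˢ N') (c + c') (k * k') := by
  obtain ⟨I, _, M, d, h1, h2, h3, h4, h5, h6, h7⟩ := h
  obtain ⟨I', _, M', d', h1', h2', h3', h4', h5', h6', h7'⟩ := h'
  have hd : ∀ i i', d i + d' i' = c + c' ↔ d i = c ∧ d' i' = c' := by
    intro i i'
    have := h5 i
    have := h5' i'
    omega
  refine .of_fintype (I := I × I') (fun i => M i.1 ×ˢ M' i.2) (fun i => d i.1 + d' i.2) ?_ ?_ ?_
    (fun i p hp => (h4 i.1 _ hp.1).prod (h4' i.2 _ hp.2)) (fun i => add_le_add (h5 _) (h5' _)) ?_ ?_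
  · rintro ⟨i, i'⟩ ⟨j, j'⟩ hij
    rw [Set.disjoint_prod]
    by_cases hi : i = j
    · exact Or.inr (h1' fun h : i' = j' => hij (by rw [hi, h]))
    · exact Or.inl (h1 hi)
  · rw [h2, h2']
    ext x
    simp
  · rintro i x y ⟨hx, hy⟩ ⟨hx1, hx2⟩
    exact ⟨h3 _ _ _ hx hx1, h3' _ _ _ hy hx2⟩
  · let e : {i : I × I' // d i.1 + d' i.2 = c + c'} ≃ {i // d i = c} × {i // d' i = c'} :=
      { toFun := fun i => (⟨i.1.1, ((hd _ _).1 i.2).1⟩, ⟨i.1.2, ((hd _ _).1 i.2).2⟩)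
        invFun := fun i => ⟨(i.1.1, i.2.1), (hd _ _).2 ⟨i.1.2, i.2.2⟩⟩
        left_inv := fun _ => rfl
        right_inv := fun _ => rfl }
    rw [Nat.card_congr e, Nat.card_prod, h6, h6']
  · rintro ⟨i, i'⟩ hi t
    obtain ⟨e1, e2⟩ := (hd _ _).1 hi
    obtain ⟨t', ht'⟩ := hw t
    obtain ⟨x', hx', hxw'⟩ := h7' i' e2 t'
    obtain ⟨s, hs⟩ := ht' x' hxw'
    obtain ⟨x, hx, hxw⟩ := h7 i e1 s
    exact ⟨(x, x'), ⟨hx, hx'⟩, hs x hxw⟩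

theorem HasStrat.pi {ι : Type*} [Fintype ι] {E : ι → Type*}
    [∀ i, NormedAddCommGroup (E i)] [∀ i, NormedSpace ℝ (E i)] {r : ∀ i, E i → E i → Prop}
    {w : ∀ i, ℝ → Set (E i)} {N : ∀ i, Set (E i)} {c k : ι → ℕ}
    (h : ∀ i, HasStrat (r i) (w i) (N i) (c i) (k i)) :
    HasStrat (fun x y : ∀ i, E i => ∀ i, r i (x i) (y i)) (fun _ => Set.univ) (Set.univ.pi N)
      (∑ i, c i) (∏ i, k i) := by
  classical
  choose I hI M d h1 h2 h3 h4 h5 h6 h7 using h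
  have hd : ∀ j : ∀ i, I i, ∑ i, d i (j i) = ∑ i, c i ↔ ∀ i, d i (j i) = c i := by
    intro j
    have := Finset.sum_eq_sum_iff_of_le (s := Finset.univ) fun i _ => h5 i (j i)
    rw [eq_comm, this]
    simp [eq_comm]
  refine .of_fintype (I := ∀ i, I i) (fun j => Set.univ.pi fun i => M i (j i))
    (fun j => ∑ i, d i (j i)) ?_ ?_ (fun j x y hxy hx i hi => h3 _ _ _ _ (hxy i) (hx i hi))
    (fun j p hp => SubmanifoldAt.pi fun i => h4 i (j i) _ (hp i trivial))
    (fun j => Finset.sum_le_sum fun i _ => h5 _ _) ?_ ?_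
  · intro j j' hj
    obtain ⟨i, hi⟩ := Function.ne_iff.1 hj
    rw [Set.disjoint_left]
    intro x hx hx'
    exact Set.disjoint_left.1 (h1 i hi) (hx i trivial) (hx' i trivial)
  · ext x
    simp only [Set.mem_pi, Set.mem_univ, true_imp_iff, Set.mem_iUnion]
    constructor
    · intro hx
      have : ∀ i, ∃ j, x i ∈ M i j := fun i => by
        have := hx i
        rw [h2 i] at this
        simpa using this
      choose j hj using this
      exact ⟨j, hj⟩
    · rintro ⟨j, hj⟩ i
      rw [h2 i]
      exact Set.mem_iUnion_of_mem _ (hj i)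
  · rw [Nat.card_congr (Equiv.subtypeEquivRight hd)]
    let e : {j : ∀ i, I i // ∀ i, d i (j i) = c i} ≃ ∀ i, {j : I i // d i j = c i} :=
      { toFun := fun j i => ⟨j.1 i, j.2 i⟩
        invFun := fun j => ⟨fun i => (j i).1, fun i => (j i).2⟩
        left_inv := fun _ => rfl
        right_inv := fun _ => rfl }
    rw [Nat.card_congr e, Nat.card_pi]
    exact Finset.prod_congr rfl fun i _ => h6 i
  · intro j hj t
    choose x hx using fun i => h7 i (j i) ((hd j).1 hj i) t
    exact ⟨x, fun i _ => (hx i).1, trivial⟩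

/-- Locally the correspondence is the graph of `f₂` over the zero set of `f₁`, and `(f₁, f₂)` is a
submersion. So each stratum pulls back with codimension raised by `e = dim Y`. Invariance of the
strata under `rel'` removes the ambiguity in the choice of the related element. -/
theorem HasStrat.transfer_aux {Y : Type*} [NormedAddCommGroup Y] [NormedSpace ℝ Y]
    [FiniteDimensional ℝ Y] {e : ℕ} (he : Module.finrank ℝ Y = e) (h : HasStrat rel' w' N' c k)
    (R : F → F' → Prop) (huniq : ∀ x y z, y ∈ N' → z ∈ N' → R x y → R x z → rel' y z)
    (hinv : ∀ x y z, rel x y → R x z → R y z)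
    (hloc : ∀ p, ∀ q ∈ N', R p q → ∃ (f₁ : F → Y) (f₂ : F → F'), ContDiffAt ℝ ω f₁ p ∧
      ContDiffAt ℝ ω f₂ p ∧ f₂ p = q ∧ Surjective (fderiv ℝ (fun x => (f₁ x, f₂ x)) p) ∧
      ∀ᶠ x in 𝓝 p, ((∃ y ∈ N', R x y) → f₁ x = 0 ∧ f₂ x ∈ N' ∧ R x (f₂ x)) ∧
        (f₁ x = 0 → f₂ x ∈ N' → R x (f₂ x)))
    {c' : ℕ} (hc' : c' ≤ c + e)
    (hw : c' = c + e → k ≠ 0 → ∀ t, ∃ t', ∀ y ∈ N', y ∈ w' t' → ∃ x ∈ w t, R x y) :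
    HasStrat rel w {x | ∃ y ∈ N', R x y} c' (if c' = c + e then k else 0) := by
  obtain ⟨I, _, M, d, h1, h2, h3, h4, h5, h6, h7⟩ := h
  have hMN : ∀ i, M i ⊆ N' := fun i => by rw [h2]; exact Set.subset_iUnion M i
  refine ⟨I, inferInstance, fun i => {x | ∃ y ∈ M i, R x y}, fun i => d i + e, ?_, ?_, ?_, ?_,
    fun i => by have := h5 i; dsimp only; omega, ?_, ?_⟩
  · intro i j hij
    rw [Set.disjoint_left]
    rintro x ⟨y, hy, hxy⟩ ⟨z, hz, hxz⟩
    have := h3 i y z (huniq x y z (hMN i hy) (hMN j hz) hxy hxz) hy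
    exact Set.disjoint_left.1 (h1 hij) this hz
  · ext x
    simp only [Set.mem_ofPred_eq, Set.mem_iUnion, h2]
    constructor
    · rintro ⟨y, ⟨i, hi⟩, hy⟩
      exact ⟨i, y, hi, hy⟩
    · rintro ⟨i, y, hi, hy⟩
      exact ⟨y, ⟨i, hi⟩, hy⟩
  · rintro i x y hxy ⟨z, hz, hxz⟩
    exact ⟨z, hz, hinv _ _ _ hxy hxz⟩
  · rintro i p ⟨q, hq, hpq⟩
    obtain ⟨f₁, f₂, c1, c2, hf2, hs, hev⟩ := hloc p q (hMN i hq) hpq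
    rw [← he]
    refine SubmanifoldAt.transfer (f₁ := f₁) (f₂ := f₂) (hf2 ▸ h4 i q hq) c1 c2 hs ?_
    filter_upwards [hev] with x hx
    constructor
    · rintro ⟨y, hy, hxy⟩
      obtain ⟨g1, g2, g3⟩ := hx.1 ⟨y, hMN i hy, hxy⟩
      exact ⟨g1, h3 i y _ (huniq x y _ (hMN i hy) g2 hxy g3) hy⟩
    · rintro ⟨g1, g2⟩
      exact ⟨f₂ x, g2, hx.2 g1 (hMN i g2)⟩
  · split_ifs with hce
    · rw [← h6]
      exact Nat.card_congr (Equiv.subtypeEquivRight fun i => by dsimp only; omega)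
    · have : IsEmpty {i // d i + e = c'} := ⟨fun i => by have := h5 i.1; have := i.2; omega⟩
      exact Nat.card_of_isEmpty
  · intro i hi t
    have hi' : d i = c := by have := h5 i; dsimp only at hi; omega
    have hk : k ≠ 0 := by
      rw [← h6]
      exact (Nat.card_pos_iff.2 ⟨⟨⟨i, hi'⟩⟩, inferInstance⟩).ne'
    obtain ⟨t', ht'⟩ := hw (by dsimp only at hi; omega) hk t
    obtain ⟨y, hy, hyw⟩ := h7 i hi' t'
    obtain ⟨x, hx, hxy⟩ := ht' y (hMN i hy) hyw
    exact ⟨x, ⟨y, hy, hxy⟩, hx⟩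

/-- Stratifications are transported along a correspondence `R` between `F` and `F'` which
determines the second element up to `rel'` and is locally given by submersions. -/
theorem HasStrat.transfer {Y : Type*} [NormedAddCommGroup Y] [NormedSpace ℝ Y]
    [FiniteDimensional ℝ Y] {e : ℕ} (he : Module.finrank ℝ Y = e) (h : HasStrat rel' w' N' c k)
    (R : F → F' → Prop) (huniq : ∀ x y z, y ∈ N' → z ∈ N' → R x y → R x z → rel' y z)
    (hinv : ∀ x y z, rel x y → R x z → R y z)
    (hloc : ∀ p, ∀ q ∈ N', R p q → ∃ (f₁ : F → Y) (f₂ : F → F'), ContDiffAt ℝ ω f₁ p ∧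
      ContDiffAt ℝ ω f₂ p ∧ f₂ p = q ∧ Surjective (fderiv ℝ (fun x => (f₁ x, f₂ x)) p) ∧
      ∀ᶠ x in 𝓝 p, ((∃ y ∈ N', R x y) → f₁ x = 0 ∧ f₂ x ∈ N' ∧ R x (f₂ x)) ∧
        (f₁ x = 0 → f₂ x ∈ N' → R x (f₂ x)))
    (hw : k ≠ 0 → ∀ t, ∃ t', ∀ y ∈ N', y ∈ w' t' → ∃ x ∈ w t, R x y) :
    HasStrat rel w {x | ∃ y ∈ N', R x y} (c + e) k := by
  simpa using h.transfer_aux he R huniq hinv hloc le_rfl (fun _ => hw)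

theorem HasStrat.transfer_of_lt {Y : Type*} [NormedAddCommGroup Y] [NormedSpace ℝ Y]
    [FiniteDimensional ℝ Y] {e : ℕ} (he : Module.finrank ℝ Y = e) (h : HasStrat rel' w' N' c k)
    (R : F → F' → Prop) (huniq : ∀ x y z, y ∈ N' → z ∈ N' → R x y → R x z → rel' y z)
    (hinv : ∀ x y z, rel x y → R x z → R y z)
    (hloc : ∀ p, ∀ q ∈ N', R p q → ∃ (f₁ : F → Y) (f₂ : F → F'), ContDiffAt ℝ ω f₁ p ∧
      ContDiffAt ℝ ω f₂ p ∧ f₂ p = q ∧ Surjective (fderiv ℝ (fun x => (f₁ x, f₂ x)) p) ∧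
      ∀ᶠ x in 𝓝 p, ((∃ y ∈ N', R x y) → f₁ x = 0 ∧ f₂ x ∈ N' ∧ R x (f₂ x)) ∧
        (f₁ x = 0 → f₂ x ∈ N' → R x (f₂ x)))
    {c' : ℕ} (hc' : c' < c + e) : HasStrat rel w {x | ∃ y ∈ N', R x y} c' 0 := by
  simpa [hc'.ne] using h.transfer_aux he R huniq hinv hloc hc'.le (fun h => absurd h hc'.ne)

/-- The stratified form of `SubmanifoldAt.add_line`, with the coordinate along the line confined to
an open set `S`. All codimensions drop by one. -/
theorem HasStrat.add_line [CompleteSpace F] (h : HasStrat rel w N (c + 1) k) (l : F →L[ℝ] ℝ)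
    {v : F} (hv : l v = 1) (hN : ∀ x ∈ N, l x = 0)
    (hrel : ∀ x y, rel x y → l x = l y ∧ rel (x - l x • v) (y - l y • v)) {S : Set ℝ}
    (hS : IsOpen S) {w' : ℝ → Set F}
    (hw : ∀ t, ∃ t', ∀ x ∈ N, x ∈ w t' → ∃ s ∈ S, x + s • v ∈ w' t) :
    HasStrat rel w' {x | l x ∈ S ∧ x - l x • v ∈ N} c k := by
  obtain ⟨I, _, M, d, h1, h2, h3, h4, h5, h6, h7⟩ := h
  have hMN : ∀ i, M i ⊆ N := fun i => by rw [h2]; exact Set.subset_iUnion M i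
  refine ⟨I, inferInstance, fun i => {x | l x ∈ S ∧ x - l x • v ∈ M i}, fun i => d i - 1,
    ?_, ?_, ?_, ?_, fun i => by have := h5 i; dsimp only; omega, ?_, ?_⟩
  · intro i j hij
    rw [Set.disjoint_left]
    rintro x ⟨-, hx⟩ ⟨-, hx'⟩
    exact Set.disjoint_left.1 (h1 hij) hx hx'
  · ext x
    simp [h2]
  · rintro i x y hxy ⟨hx1, hx2⟩
    obtain ⟨g1, g2⟩ := hrel x y hxy
    exact ⟨g1 ▸ hx1, h3 i _ _ g2 hx2⟩
  · rintro i p ⟨hp1, hp2⟩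
    have hd : d i = (d i - 1) + 1 := by have := h5 i; omega
    have := SubmanifoldAt.add_line (M := M i) (d := d i - 1) (q := p) l hv
      (fun x hx => hN x (hMN i hx)) hp2 (hd ▸ h4 i _ hp2)
    refine this.congr ?_
    filter_upwards [l.continuous.continuousAt.eventually (hS.mem_nhds hp1)] with x hx
    exact ⟨fun h => h.2, fun h => ⟨hx, h⟩⟩
  · rw [← h6]
    exact Nat.card_congr (Equiv.subtypeEquivRight fun i => by have := h5 i; dsimp only; omega)
  · intro i hi t
    have hi' : d i = c + 1 := by dsimp only at hi; have := h5 i; omega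
    obtain ⟨t', ht'⟩ := hw t
    obtain ⟨x, hx, hxw⟩ := h7 i hi' t'
    obtain ⟨s, hs, hxs⟩ := ht' x (hMN i hx) hxw
    refine ⟨x + s • v, ⟨?_, ?_⟩, hxs⟩
    · rw [map_add, map_smul, hv, hN x (hMN i hx)]
      simpa using hs
    · have : x + s • v - l (x + s • v) • v = x := by
        rw [map_add, map_smul, hv, hN x (hMN i hx)]; simp
      rw [this]
      exact hx

end Stratifications

/-! ### Spectral idempotents in real algebras -/

section SpectralIdempotents

/-- The real polynomial with roots `z` and its conjugate. -/
noncomputable def conjQuad (z : ℂ) : ℝ[X] := X ^ 2 - C (2 * z.re) * X + C (Complex.normSq z)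

theorem aeval_conjQuad_complex (z w : ℂ) : aeval w (conjQuad z) = (w - z) * (w - conj z) := by
  simp only [conjQuad, map_add, map_sub, map_mul, map_pow, aeval_X, aeval_C,
    Complex.coe_algebraMap]
  rw [Complex.normSq_eq_conj_mul_self, Complex.ofReal_ofNat, Complex.re_eq_add_conj]
  ring

theorem aeval_conjQuad {R : Type*} [Ring R] [Algebra ℝ R] (z : ℂ) (A : R) :
    aeval A (conjQuad z) = A ^ 2 - (2 * z.re) • A + Complex.normSq z • 1 := by
  simp [conjQuad, Algebra.smul_def]

theorem minpoly_dvd_conjQuad (z : ℂ) : minpoly ℝ z ∣ conjQuad z :=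
  minpoly.dvd ℝ z (by simp [aeval_conjQuad_complex])

theorem eq_or_eq_conj_of_aeval_minpoly {z w : ℂ} (h : aeval w (minpoly ℝ z) = 0) :
    w = z ∨ w = conj z := by
  obtain ⟨r, hr⟩ := minpoly_dvd_conjQuad z
  have : aeval w (conjQuad z) = 0 := by rw [hr, map_mul, h, zero_mul]
  rw [aeval_conjQuad_complex, mul_eq_zero, sub_eq_zero, sub_eq_zero] at this
  exact this

theorem isCoprime_of_roots {Z : Set ℂ} {p q : ℝ[X]} (hp : ∀ z : ℂ, aeval z p = 0 → z ∈ Z)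
    (hq : ∀ z ∈ Z, aeval z q ≠ 0) : IsCoprime p q := by
  rw [isCoprime_iff_aeval_ne_zero_of_isAlgClosed ℝ ℂ]
  intro z
  by_cases h : aeval z p = 0
  · exact Or.inr (hq z (hp z h))
  · exact Or.inl h

/-- Real minimal polynomials of roots in `Z` are split off one after another. Since such a minimal
polynomial has no roots besides `z` and its conjugate, invariance of `Z` keeps all removed roots in
`Z`. -/
theorem exists_mul_eq_of_conj_mem {Z : Set ℂ} (hZ : ∀ z ∈ Z, conj z ∈ Z) (m : ℝ[X]) (hm : m ≠ 0) :
    ∃ p q : ℝ[X], m = p * q ∧ (∀ z : ℂ, aeval z p = 0 → z ∈ Z) ∧ ∀ z ∈ Z, aeval z q ≠ 0 := by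
  induction h : m.natDegree using Nat.strong_induction_on generalizing m with
  | _ n ih =>
    by_cases hr : ∀ z ∈ Z, aeval z m ≠ 0
    · exact ⟨1, m, by simp, fun z hz => by simp at hz, hr⟩
    push Not at hr
    obtain ⟨z, hz, hz0⟩ := hr
    obtain ⟨m', hm'⟩ := minpoly.dvd ℝ z hz0
    have hint : IsIntegral ℝ z := Algebra.IsIntegral.isIntegral z
    have hm0 : m' ≠ 0 := by rintro rfl; simp [hm'] at hm
    have hdeg : m'.natDegree < n := by
      have := natDegree_mul (minpoly.ne_zero hint) hm0
      rw [← hm', h] at this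
      have := minpoly.natDegree_pos hint
      omega
    obtain ⟨p, q, hpq, hp, hq⟩ := ih _ hdeg m' hm0 rfl
    refine ⟨minpoly ℝ z * p, q, by rw [hm', hpq]; ring, ?_, hq⟩
    intro w hw
    rw [map_mul, mul_eq_zero] at hw
    rcases hw with hw | hw
    · rcases eq_or_eq_conj_of_aeval_minpoly hw with rfl | rfl
      · exact hz
      · exact hZ _ hz
    · exact hp w hw

variable {R S : Type*} [Ring R] [Algebra ℝ R] [Ring S] [Algebra ℝ S]

/-- `e` is the spectral idempotent of `A` belonging to the eigenvalues in `Z`. -/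
def IsSpectralIdem (Z : Set ℂ) (A e : R) : Prop :=
  e * e = e ∧ Commute A e ∧
    (∃ p : ℝ[X], (∀ z : ℂ, aeval z p = 0 → z ∈ Z) ∧ aeval A p * e = 0) ∧
    ∃ q : ℝ[X], (∀ z ∈ Z, aeval z q ≠ 0) ∧ aeval A q * (1 - e) = 0

theorem commute_aeval {K R : Type*} [Field K] [Ring R] [Algebra K R] {A B : R} (h : Commute A B)
    (p : K[X]) : Commute (aeval A p) B := by
  induction p using Polynomial.induction_on' with
  | add p q hp hq => rw [map_add]; exact hp.add_left hq
  | monomial n a =>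
    rw [aeval_monomial]
    exact Commute.mul_left (Algebra.commutes a B) (h.pow_left n)

theorem IsSpectralIdem.map {Z : Set ℂ} {A e : R} (h : IsSpectralIdem Z A e) (φ : R →ₐ[ℝ] S) :
    IsSpectralIdem Z (φ A) (φ e) := by
  obtain ⟨h1, h2, ⟨p, hp, hpe⟩, q, hq, hqe⟩ := h
  refine ⟨by rw [← map_mul, h1], h2.map φ, ⟨p, hp, ?_⟩, q, hq, ?_⟩
  · rw [aeval_algHom_apply, ← map_mul, hpe, map_zero]
  · rw [aeval_algHom_apply, ← map_one φ, ← map_sub, ← map_mul, hqe, map_zero]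

/-- The polynomial annihilating `A` on `e` has its roots in `Z`, the one annihilating `A` on `1 - f`
has none there. They are coprime, so a Bézout relation shows that `e` and `1 - f` are orthogonal. -/
theorem IsSpectralIdem.mul_eq {Z : Set ℂ} {A e f : R} (h : IsSpectralIdem Z A e)
    (h' : IsSpectralIdem Z A f) : f * e = e ∧ e * f = e := by
  obtain ⟨-, h2, ⟨p, hp, hpe⟩, -⟩ := h
  obtain ⟨-, h2', -, q, hq, hqf⟩ := h'
  obtain ⟨u, v, huv⟩ := isCoprime_of_roots hp hq
  have he : e = aeval A v * aeval A q * e := by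
    have := congrArg (fun r => aeval A r * e) huv
    simp only [map_add, map_mul, map_one, one_mul, add_mul] at this
    rw [mul_assoc, hpe, mul_zero, zero_add] at this
    exact this.symm
  have c1 : Commute (aeval A v * aeval A q) e :=
    (commute_aeval h2 v).mul_left (commute_aeval h2 q)
  have c2 : Commute (aeval A v * aeval A q) (1 - f) :=
    (Commute.one_right _).sub_right ((commute_aeval h2' v).mul_left (commute_aeval h2' q))
  have h0 : aeval A v * aeval A q * (1 - f) = 0 := by rw [mul_assoc, hqf, mul_zero]
  constructor
  · have : (1 - f) * e = 0 := by
      rw [he, ← mul_assoc, ← c2.eq, h0, zero_mul]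
    rw [sub_mul, one_mul, sub_eq_zero] at this
    exact this.symm
  · have : e * (1 - f) = 0 := by
      rw [he, c1.eq, mul_assoc, h0, mul_zero]
    rw [mul_sub, mul_one, sub_eq_zero] at this
    exact this.symm

theorem IsSpectralIdem.unique {Z : Set ℂ} {A e f : R} (h : IsSpectralIdem Z A e)
    (h' : IsSpectralIdem Z A f) : e = f := by
  rw [← (h.mul_eq h').1, (h'.mul_eq h).2]

theorem exists_isSpectralIdem_aeval [FiniteDimensional ℝ R] {Z : Set ℂ}
    (hZ : ∀ z ∈ Z, conj z ∈ Z) (A : R) : ∃ r : ℝ[X], IsSpectralIdem Z A (aeval A r) := by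
  obtain ⟨p, q, hpq, hp, hq⟩ := exists_mul_eq_of_conj_mem hZ (minpoly ℝ A)
    (minpoly.ne_zero (Algebra.IsIntegral.isIntegral A))
  obtain ⟨u, v, huv⟩ := isCoprime_of_roots hp hq
  have h0 : aeval A (p * q) = 0 := by rw [← hpq]; exact minpoly.aeval ℝ A
  have hz : ∀ r, aeval A (p * q * r) = 0 := fun r => by rw [map_mul, h0, zero_mul]
  have h1 : (1 : R) - aeval A (v * q) = aeval A (u * p) := by
    rw [← map_one (aeval (R := ℝ) A), ← huv, map_add]; abel
  refine ⟨v * q, ?_, (commute_aeval (Commute.refl A) _).symm, ⟨p, hp, ?_⟩, q, hq, ?_⟩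
  · have : v * q * (v * q) = v * q - p * q * (u * v) := by
      linear_combination (v * q) * huv
    rw [← map_mul, this, map_sub, hz, sub_zero]
  · rw [← map_mul, show p * (v * q) = p * q * v by ring, hz]
  · rw [h1, ← map_mul, show q * (u * p) = p * q * u by ring, hz]

theorem exists_isSpectralIdem [FiniteDimensional ℝ R] {Z : Set ℂ}
    (hZ : ∀ z ∈ Z, conj z ∈ Z) (A : R) : ∃ e, IsSpectralIdem Z A e :=
  (exists_isSpectralIdem_aeval hZ A).imp' _ fun _ h => h

theorem IsSpectralIdem.commute [FiniteDimensional ℝ R] {Z : Set ℂ}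
    (hZ : ∀ z ∈ Z, conj z ∈ Z) {A e B : R} (h : IsSpectralIdem Z A e) (hB : Commute A B) :
    Commute e B := by
  obtain ⟨r, hr⟩ := exists_isSpectralIdem_aeval hZ A
  rw [h.unique hr]
  exact commute_aeval hB r

/-- `A` has no eigenvalues in `Z`. -/
def SpectrumFree (Z : Set ℂ) (A : R) : Prop := ∀ z ∈ Z, IsUnit (aeval A (conjQuad z))

theorem isUnit_aeval_of_isCoprime {K R : Type*} [Field K] [Ring R] [Algebra K R] {A : R}
    {p q : K[X]} (h : IsCoprime p q) (hq : IsNilpotent (aeval A q)) : IsUnit (aeval A p) := by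
  obtain ⟨n, hn⟩ := hq
  obtain ⟨u, v, huv⟩ := h.pow_right (n := n)
  have := congrArg (aeval A) huv
  rw [map_add, map_mul, map_mul, map_pow, hn, mul_zero, add_zero, map_one] at this
  have c : Commute (aeval A u) (aeval A p) := commute_aeval (commute_aeval (Commute.refl A) p).symm u
  exact ⟨⟨aeval A p, aeval A u, by rw [← c.eq]; exact this, this⟩, rfl⟩

theorem isCoprime_conjQuad {Z : Set ℂ} (hZ : ∀ z ∈ Z, conj z ∈ Z) {q : ℝ[X]}
    (hq : ∀ z ∈ Z, aeval z q ≠ 0) {z : ℂ} (hz : z ∈ Z) : IsCoprime (conjQuad z) q := by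
  refine isCoprime_of_roots (Z := Z) (fun w hw => ?_) hq
  rw [aeval_conjQuad_complex, mul_eq_zero, sub_eq_zero, sub_eq_zero] at hw
  rcases hw with rfl | rfl
  · exact hz
  · exact hZ _ hz

theorem SpectrumFree.of_aeval_eq_zero {Z : Set ℂ} (hZ : ∀ z ∈ Z, conj z ∈ Z) {A : R} {q : ℝ[X]}
    (hq : ∀ z ∈ Z, aeval z q ≠ 0) (h : aeval A q = 0) : SpectrumFree Z A := fun _ hz =>
  isUnit_aeval_of_isCoprime (isCoprime_conjQuad hZ hq hz) (h ▸ IsNilpotent.zero)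

/-- If `z` were a root, the minimal polynomial of `A` would be that of `z` times some `m`.
Invertibility of `conjQuad z` at `A` would force `m` to annihilate `A`, although its degree is too
small. -/
theorem SpectrumFree.aeval_minpoly_ne_zero [FiniteDimensional ℝ R] {Z : Set ℂ} {A : R}
    (h : SpectrumFree Z A) (z : ℂ) (hz : z ∈ Z) : aeval z (minpoly ℝ A) ≠ 0 := by
  intro h0
  have hA : IsIntegral ℝ A := Algebra.IsIntegral.isIntegral A
  obtain ⟨m, hm⟩ := minpoly.dvd ℝ z h0
  obtain ⟨r, hr⟩ := minpoly_dvd_conjQuad z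
  have hm0 : m ≠ 0 := by
    rintro rfl
    exact minpoly.ne_zero hA (by simpa using hm)
  have h1 : aeval A (conjQuad z) * aeval A m = 0 := by
    rw [← map_mul, hr, mul_comm (minpoly ℝ z) r, mul_assoc, ← hm, map_mul, minpoly.aeval, mul_zero]
  have h2 : aeval A m = 0 := (h z hz).mul_right_eq_zero.1 h1
  have h3 := natDegree_le_of_dvd (minpoly.dvd ℝ A h2) hm0
  have h4 := natDegree_mul (minpoly.ne_zero (Algebra.IsIntegral.isIntegral (R := ℝ) z)) hm0
  have h5 := minpoly.natDegree_pos (Algebra.IsIntegral.isIntegral (R := ℝ) z)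
  rw [← hm] at h4
  omega

theorem isSpectralIdem_zero_iff [FiniteDimensional ℝ R] {Z : Set ℂ} (hZ : ∀ z ∈ Z, conj z ∈ Z)
    {A : R} : IsSpectralIdem Z A 0 ↔ SpectrumFree Z A := by
  constructor
  · rintro ⟨-, -, -, q, hq, h⟩
    exact .of_aeval_eq_zero hZ hq (by simpa using h)
  · intro h
    exact ⟨by simp, Commute.zero_right _, ⟨1, fun z hz => by simp at hz, by simp⟩,
      _, h.aeval_minpoly_ne_zero, by simp⟩

theorem finite_setOf_not_isUnit_conjQuad [FiniteDimensional ℝ R] (A : R) :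
    {z : ℂ | ¬ IsUnit (aeval A (conjQuad z))}.Finite := by
  have hA : IsIntegral ℝ A := Algebra.IsIntegral.isIntegral A
  have hf : {z : ℂ | aeval z (minpoly ℝ A) = 0}.Finite := by
    refine ((minpoly ℝ A).rootSet_finite ℂ).subset fun z hz => ?_
    rw [mem_rootSet]
    exact ⟨minpoly.ne_zero hA, hz⟩
  refine (hf.union (hf.preimage (f := conj) (star_injective.injOn))).subset fun z hz => ?_
  by_contra hn
  simp only [Set.mem_union, Set.mem_ofPred_eq, Set.mem_preimage, not_or] at hn
  refine hz (isUnit_aeval_of_isCoprime (q := minpoly ℝ A) (isCoprime_conjQuad (Z := {z, conj z})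
    ?_ ?_ (Or.inl rfl)) (by rw [minpoly.aeval]; exact IsNilpotent.zero))
  · rintro w (rfl | rfl) <;> simp
  · rintro w (rfl | rfl)
    · exact hn.1
    · exact hn.2

end SpectralIdempotents

/-! ### Openness of having no eigenvalues in a closed set -/

section Openness

variable {R P : Type*} [NormedRing R] [CompleteSpace R] [NormedAddCommGroup P] [ProperSpace P]

/-- On a bounded set of `A`, parameters of large norm are harmless, so only a compact part of `K`
matters; there the tube lemma applies. -/
theorem isOpen_setOf_forall_isUnit {g : P → R → R} (hg : Continuous fun x : P × R => g x.1 x.2)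
    (hl : ∀ r : ℝ, ∃ c : ℝ, ∀ z A, ‖A‖ ≤ r → c ≤ ‖z‖ → IsUnit (g z A)) {K : Set P}
    (hK : IsClosed K) : IsOpen {A | ∀ z ∈ K, IsUnit (g z A)} := by
  rw [isOpen_iff_eventually]
  intro A hA
  obtain ⟨c, hc⟩ := hl (‖A‖ + 1)
  have h1 : ∀ᶠ B in 𝓝 A, ‖B‖ ≤ ‖A‖ + 1 := by
    filter_upwards [(continuous_norm.tendsto A).eventually (gt_mem_nhds (lt_add_one ‖A‖))] with B hB
    exact hB.le
  have hcomp : IsCompact (K ∩ Metric.closedBall 0 c) :=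
    (isCompact_closedBall _ _).inter_left hK
  have h2 : ∀ᶠ B in 𝓝 A, ∀ z ∈ K ∩ Metric.closedBall 0 c, IsUnit (g z B) := by
    refine hcomp.eventually_forall_of_forall_eventually fun z hz => ?_
    have : ContinuousAt (fun x : R × P => g x.2 x.1) (A, z) :=
      (hg.comp continuous_swap).continuousAt
    exact this.eventually (Units.isOpen.mem_nhds (hA z hz.1))
  filter_upwards [h1, h2] with B hB1 hB2 z hz
  by_cases h : ‖z‖ ≤ c
  · exact hB2 z ⟨hz, by simpa using h⟩
  · exact hc z B hB1 (not_le.1 h).le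

theorem isOpen_spectrumFree [NormedAlgebra ℝ R] {Z : Set ℂ} (hZ : IsClosed Z) :
    IsOpen {A : R | SpectrumFree Z A} := by
  refine isOpen_setOf_forall_isUnit (g := fun z A => aeval A (conjQuad z)) ?_ (fun r => ?_) hZ
  · simp only [aeval_conjQuad]
    have : Continuous fun z : ℂ => Complex.normSq z := Complex.continuous_normSq
    fun_prop
  -- The constant gives `‖A‖ ≤ ‖z‖ / 4`. Then `conjQuad z` at `A` is `|z|²(1 - B)` with `‖B‖ ≤ 1/2 +
  -- 1/16 < 1`, and the Neumann series inverts it.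
  · refine ⟨4 * (|r| + 1), fun z A hA hz => ?_⟩
    have hz0 : 0 < ‖z‖ := lt_of_lt_of_le (by positivity) hz
    have hA' : ‖A‖ ≤ ‖z‖ / 4 := by
      have := le_abs_self r
      linarith
    set t := Complex.normSq z with ht
    have htz : t = ‖z‖ ^ 2 := Complex.normSq_eq_norm_sq z
    have ht0 : 0 < t := by rw [htz]; positivity
    set B := t⁻¹ • ((2 * z.re) • A - A ^ 2) with hB
    have hB1 : ‖B‖ < 1 := by
      rw [hB, norm_smul, norm_inv, Real.norm_of_nonneg ht0.le, inv_mul_lt_iff₀ ht0, mul_one]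
      have h1 : ‖(2 * z.re) • A‖ ≤ 2 * ‖z‖ * (‖z‖ / 4) := by
        rw [norm_smul, Real.norm_eq_abs, abs_mul, abs_two]
        gcongr
        exact Complex.abs_re_le_norm z
      have h2 : ‖A ^ 2‖ ≤ (‖z‖ / 4) ^ 2 := by
        rw [pow_two]
        calc ‖A * A‖ ≤ ‖A‖ * ‖A‖ := norm_mul_le A A
          _ ≤ (‖z‖ / 4) * (‖z‖ / 4) := by gcongr
          _ = _ := by ring
      have := norm_sub_le ((2 * z.re) • A) (A ^ 2)
      rw [htz]
      nlinarith [sq_nonneg ‖z‖, pow_pos hz0 2]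
    have hu : IsUnit (1 - B) := isUnit_one_sub_of_norm_lt_one hB1
    have : aeval A (conjQuad z) = t • (1 - B) := by
      rw [aeval_conjQuad, hB, smul_sub, smul_smul, mul_inv_cancel₀ ht0.ne', one_smul, ← ht]
      abel
    rw [this]
    exact (hu.smul (Units.mk0 t ht0.ne'))

end Openness

/-! ### Rank and splittings over a division ring -/

section MatrixRank

variable {D : Type*} [DivisionRing D]
variable {l m n p q p' q' : Type*} [Fintype l] [Fintype m] [Fintype n] [Fintype p] [Fintype q]
  [Fintype p'] [Fintype q']
  [DecidableEq l] [DecidableEq m] [DecidableEq n] [DecidableEq p] [DecidableEq q]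
  [DecidableEq p'] [DecidableEq q']

/-- `A = Q * s` is a rank factorization. -/
structure IsRankFactorization (A : Matrix m n D) (Q : Matrix m p D) (s : Matrix p n D) : Prop where
  left : ∃ L : Matrix p m D, L * Q = 1
  right : ∃ R : Matrix n p D, s * R = 1
  eq : A = Q * s

/-- The matrix `A` over a division ring has rank `r`. -/
def HasRank (A : Matrix m n D) (r : ℕ) : Prop :=
  ∃ (Q : Matrix m (Fin r) D) (s : Matrix (Fin r) n D), IsRankFactorization A Q s

theorem exists_hasRank (A : Matrix m n D) : ∃ r, HasRank A r := by
  -- Matrices act on row vectors, since over a noncommutative `D` this is the action that is linear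
  -- for left scalars. The rank factorization is the factorization of `f` through its range.
  let f := A.toLinearMapRight'
  let r := Module.finrank D (LinearMap.range f)
  let e : LinearMap.range f ≃ₗ[D] (Fin r → D) := (Module.finBasis D (LinearMap.range f)).equivFun
  let f₁ : (m → D) →ₗ[D] (Fin r → D) := e.toLinearMap ∘ₗ f.rangeRestrict
  let f₂ : (Fin r → D) →ₗ[D] (n → D) := (LinearMap.range f).subtype ∘ₗ e.symm.toLinearMap
  have hf : f₂ ∘ₗ f₁ = f := by ext; simp [f₁, f₂]
  obtain ⟨g₁, hg₁⟩ := f₁.exists_rightInverse_of_surjective (LinearMap.range_eq_top.2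
    (e.surjective.comp f.surjective_rangeRestrict))
  obtain ⟨g₂, hg₂⟩ := f₂.exists_leftInverse_of_injective (LinearMap.ker_eq_bot.2
    ((Submodule.subtype_injective _).comp e.symm.injective))
  obtain ⟨F₁, hF₁⟩ := Matrix.toLinearMapRight'.surjective f₁
  obtain ⟨F₂, hF₂⟩ := Matrix.toLinearMapRight'.surjective f₂
  obtain ⟨G₁, hG₁⟩ := Matrix.toLinearMapRight'.surjective g₁
  obtain ⟨G₂, hG₂⟩ := Matrix.toLinearMapRight'.surjective g₂
  refine ⟨r, F₁, F₂, ⟨G₁, ?_⟩, ⟨G₂, ?_⟩, ?_⟩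
  all_goals
    apply Matrix.toLinearMapRight'.injective
    simp only [Matrix.toLinearMapRight'_mul, Matrix.toLinearMapRight'_one, hF₁, hF₂, hG₁, hG₂]
  · exact hg₁
  · exact hg₂
  · exact hf.symm

theorem le_of_mul_eq_one {r r' : ℕ} (f : Matrix (Fin r') (Fin r) D) (g : Matrix (Fin r) (Fin r') D)
    (h : g * f = 1) : r ≤ r' :=
  rankCondition_iff_matrix.1 inferInstance _ _ f g h

theorem HasRank.unique {A : Matrix m n D} {r r' : ℕ} (h : HasRank A r) (h' : HasRank A r') :
    r = r' := by
  obtain ⟨Q, s, ⟨L, hL⟩, ⟨R, hR⟩, hA⟩ := h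
  obtain ⟨Q', s', ⟨L', hL'⟩, ⟨R', hR'⟩, hA'⟩ := h'
  have h1 : L * Q' * (s' * R) = 1 := by
    calc L * Q' * (s' * R) = L * (Q' * s') * R := by simp only [Matrix.mul_assoc]
      _ = (L * Q) * (s * R) := by rw [← hA', hA]; simp only [Matrix.mul_assoc]
      _ = 1 := by rw [hL, hR, Matrix.one_mul]
  have h2 : L' * Q * (s * R') = 1 := by
    calc L' * Q * (s * R') = L' * (Q * s) * R' := by simp only [Matrix.mul_assoc]
      _ = (L' * Q') * (s' * R') := by rw [← hA, hA']; simp only [Matrix.mul_assoc]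
      _ = 1 := by rw [hL', hR', Matrix.one_mul]
  exact le_antisymm (le_of_mul_eq_one _ _ h1) (le_of_mul_eq_one _ _ h2)

omit [DecidableEq m] [DecidableEq n] [Fintype n] [Fintype m] in
theorem mul_submatrix_equiv (σ : p ≃ q) (Q : Matrix m q D) (s : Matrix q n D) :
    Q.submatrix id σ * s.submatrix σ id = Q * s := by
  rw [Matrix.submatrix_mul_equiv]; simp

theorem IsRankFactorization.reindex {A : Matrix m n D} {Q : Matrix m p D} {s : Matrix p n D}
    (h : IsRankFactorization A Q s) (σ : q ≃ p) :
    IsRankFactorization A (Q.submatrix id σ) (s.submatrix σ id) := by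
  obtain ⟨⟨L, hL⟩, ⟨R, hR⟩, hA⟩ := h
  refine ⟨⟨L.submatrix σ id, ?_⟩, ⟨R.submatrix id σ, ?_⟩, ?_⟩
  · rw [← Matrix.submatrix_mul L Q σ id σ bijective_id, hL]; simp
  · rw [← Matrix.submatrix_mul s R σ id σ bijective_id, hR]; simp
  · rw [mul_submatrix_equiv, hA]

theorem IsRankFactorization.hasRank {A : Matrix m n D} {Q : Matrix m p D} {s : Matrix p n D}
    (h : IsRankFactorization A Q s) {r : ℕ} (hr : Fintype.card p = r) : HasRank A r :=
  ⟨_, _, h.reindex (Fintype.equivFinOfCardEq hr).symm⟩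

theorem hasRank_one : HasRank (1 : Matrix n n D) (Fintype.card n) :=
  IsRankFactorization.hasRank (p := n) (Q := 1) (s := 1) ⟨⟨1, by simp⟩, ⟨1, by simp⟩, by simp⟩ rfl

theorem hasRank_zero : HasRank (0 : Matrix m n D) 0 :=
  IsRankFactorization.hasRank (p := Fin 0) (Q := 0) (s := 0)
    ⟨⟨0, Subsingleton.elim _ _⟩, ⟨0, Subsingleton.elim _ _⟩, by simp⟩ (by simp)

theorem hasRank_zero_iff {A : Matrix m n D} : HasRank A 0 ↔ A = 0 := by
  constructor
  · rintro ⟨Q, s, h⟩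
    rw [h.eq]
    ext i j
    simp [Matrix.mul_apply]
  · rintro rfl
    exact hasRank_zero

theorem HasRank.sandwich {X : Matrix p q D} {r : ℕ} (h : HasRank X r) {Q : Matrix m p D}
    {L : Matrix p m D} {s : Matrix q n D} {R : Matrix n q D} (hL : L * Q = 1) (hR : s * R = 1) :
    HasRank (Q * X * s) r := by
  obtain ⟨Q₁, s₁, ⟨L₁, hL₁⟩, ⟨R₁, hR₁⟩, hX⟩ := h
  refine ⟨Q * Q₁, s₁ * s, ⟨L₁ * L, ?_⟩, ⟨R * R₁, ?_⟩, ?_⟩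
  · calc L₁ * L * (Q * Q₁) = L₁ * (L * Q) * Q₁ := by simp only [Matrix.mul_assoc]
      _ = 1 := by rw [hL, Matrix.mul_one, hL₁]
  · calc s₁ * s * (R * R₁) = s₁ * (s * R) * R₁ := by simp only [Matrix.mul_assoc]
      _ = 1 := by rw [hR, Matrix.mul_one, hR₁]
  · rw [hX]; simp only [Matrix.mul_assoc]

theorem hasRank_sandwich_iff {X : Matrix p q D} {r : ℕ} {Q : Matrix m p D}
    {L : Matrix p m D} {s : Matrix q n D} {R : Matrix n q D} (hL : L * Q = 1) (hR : s * R = 1) :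
    HasRank (Q * X * s) r ↔ HasRank X r := by
  refine ⟨fun h => ?_, fun h => h.sandwich hL hR⟩
  obtain ⟨r', h'⟩ := exists_hasRank X
  rwa [h.unique (h'.sandwich hL hR)]

/-- The matrices `Q, Q'` (columns) and `s, s'` (rows) describe a direct sum decomposition. -/
structure IsSplit (Q : Matrix n p D) (s : Matrix p n D) (Q' : Matrix n q D) (s' : Matrix q n D) :
    Prop where
  s_mul_Q : s * Q = 1
  s'_mul_Q' : s' * Q' = 1
  s_mul_Q' : s * Q' = 0
  s'_mul_Q : s' * Q = 0
  add_eq : Q * s + Q' * s' = 1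

theorem IsRankFactorization.mul_eq_one_of_idem {e : Matrix n n D} {Q : Matrix n p D}
    {s : Matrix p n D} (h : IsRankFactorization e Q s) (he : e * e = e) : s * Q = 1 := by
  obtain ⟨⟨L, hL⟩, ⟨R, hR⟩, hA⟩ := h
  calc s * Q = (L * Q) * (s * Q) * (s * R) := by rw [hL, hR, Matrix.one_mul, Matrix.mul_one]
    _ = L * ((Q * s) * (Q * s)) * R := by simp only [Matrix.mul_assoc]
    _ = (L * Q) * (s * R) := by rw [← hA, he, hA]; simp only [Matrix.mul_assoc]
    _ = 1 := by rw [hL, hR, Matrix.one_mul]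

theorem isSplit_of_idem {e : Matrix n n D} {Q : Matrix n p D} {s : Matrix p n D}
    {Q' : Matrix n q D} {s' : Matrix q n D} (he : e * e = e) (h : IsRankFactorization e Q s)
    (h' : IsRankFactorization (1 - e) Q' s') : IsSplit Q s Q' s' := by
  have he' : (1 - e) * (1 - e) = 1 - e := by simp [sub_mul, mul_sub, he]
  have h1 := h.mul_eq_one_of_idem he
  have h2 := h'.mul_eq_one_of_idem he'
  have h3 : e * (1 - e) = 0 := by simp [mul_sub, he]
  have h4 : (1 - e) * e = 0 := by simp [sub_mul, he]
  refine ⟨h1, h2, ?_, ?_, by rw [← h.eq, ← h'.eq]; abel⟩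
  · calc s * Q' = (s * Q) * (s * Q') * (s' * Q') := by
          rw [h1, h2, Matrix.one_mul, Matrix.mul_one]
      _ = s * ((Q * s) * (Q' * s')) * Q' := by simp only [Matrix.mul_assoc]
      _ = 0 := by rw [← h.eq, ← h'.eq, h3]; simp
  · calc s' * Q = (s' * Q') * (s' * Q) * (s * Q) := by
          rw [h1, h2, Matrix.one_mul, Matrix.mul_one]
      _ = s' * ((Q' * s') * (Q * s)) * Q := by simp only [Matrix.mul_assoc]
      _ = 0 := by rw [← h.eq, ← h'.eq, h4]; simp

theorem IsSplit.card {Q : Matrix n p D} {s : Matrix p n D} {Q' : Matrix n q D} {s' : Matrix q n D}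
    (h : IsSplit Q s Q' s') : Fintype.card n = Fintype.card p + Fintype.card q := by
  have h1 : Matrix.fromCols Q Q' * Matrix.fromRows s s' = 1 := by
    rw [Matrix.fromCols_mul_fromRows, h.add_eq]
  have h2 : Matrix.fromRows s s' * Matrix.fromCols Q Q' = 1 := by
    rw [Matrix.fromRows_mul_fromCols, h.s_mul_Q, h.s'_mul_Q', h.s_mul_Q', h.s'_mul_Q,
      Matrix.fromBlocks_one]
  have e := (Matrix.toLinearEquivRight'OfInv h1 h2).finrank_eq
  simpa using e.symm

theorem exists_isSplit_of_idem {e : Matrix n n D} (he : e * e = e) {r : ℕ} (h : HasRank e r)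
    {k : ℕ} (hk : Fintype.card n = r + k) :
    ∃ (Q : Matrix n (Fin r) D) (s : Matrix (Fin r) n D) (Q' : Matrix n (Fin k) D)
      (s' : Matrix (Fin k) n D), IsSplit Q s Q' s' ∧ e = Q * s := by
  obtain ⟨Q, s, hQ⟩ := h
  obtain ⟨k', Q', s', hQ'⟩ := exists_hasRank (1 - e)
  have hs := isSplit_of_idem he hQ hQ'
  have := hs.card
  simp only [Fintype.card_fin] at this
  obtain rfl : k' = k := by omega
  exact ⟨Q, s, Q', s', hs, hQ.eq⟩

theorem HasRank.le_card {e : Matrix n n D} (he : e * e = e) {r : ℕ} (h : HasRank e r) :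
    r ≤ Fintype.card n := by
  obtain ⟨Q, s, hQ⟩ := h
  obtain ⟨k', Q', s', hQ'⟩ := exists_hasRank (1 - e)
  have := (isSplit_of_idem he hQ hQ').card
  simp only [Fintype.card_fin] at this
  omega

theorem one_submatrix_mul_one_submatrix {a b : Type*} (f : a → n) (g : b → n) :
    (1 : Matrix n n D).submatrix f id * (1 : Matrix n n D).submatrix id g =
      (1 : Matrix n n D).submatrix f g := by
  rw [← Matrix.submatrix_mul _ _ f id g bijective_id, Matrix.one_mul]

/-- The decomposition belonging to a partition of the coordinates. -/
theorem isSplit_of_equiv (σ : p ⊕ q ≃ n) :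
    IsSplit ((1 : Matrix n n D).submatrix id (σ ∘ Sum.inl)) ((1 : Matrix n n D).submatrix
      (σ ∘ Sum.inl) id) ((1 : Matrix n n D).submatrix id (σ ∘ Sum.inr))
      ((1 : Matrix n n D).submatrix (σ ∘ Sum.inr) id) := by
  refine ⟨?_, ?_, ?_, ?_, ?_⟩
  · rw [one_submatrix_mul_one_submatrix]; exact Matrix.submatrix_one _ (σ.injective.comp Sum.inl_injective)
  · rw [one_submatrix_mul_one_submatrix]; exact Matrix.submatrix_one _ (σ.injective.comp Sum.inr_injective)
  · rw [one_submatrix_mul_one_submatrix]; ext i j; simp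
  · rw [one_submatrix_mul_one_submatrix]; ext i j; simp
  · have h1 : (1 : Matrix n n D).submatrix id σ * (1 : Matrix n n D).submatrix σ id = 1 := by
      rw [Matrix.submatrix_mul_equiv]; simp
    rw [← h1]
    ext i j
    simp [Matrix.mul_apply, Fintype.sum_sum_type]
    rfl

end MatrixRank

/-! ### Local structure of the matrices of given rank -/

section MatrixAnalysis

attribute [local instance] Matrix.linftyOpNormedAddCommGroup Matrix.linftyOpNormedSpace
  Matrix.linftyOpNormedRing Matrix.linftyOpNormedAlgebra

variable {D : Type*} [NormedDivisionRing D] [NormedAlgebra ℝ D] [FiniteDimensional ℝ D]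
variable {l m n p q : Type*} [Fintype l] [Fintype m] [Fintype n] [Fintype p] [Fintype q]
  [DecidableEq l] [DecidableEq m] [DecidableEq n] [DecidableEq p] [DecidableEq q]

variable {F : Type*} [NormedAddCommGroup F] [NormedSpace ℝ F] {x : F}

theorem isBoundedBilinearMap_matrix_mul :
    IsBoundedBilinearMap ℝ fun x : Matrix l m D × Matrix m n D => x.1 * x.2 where
  add_left := fun _ _ _ => Matrix.add_mul _ _ _
  smul_left := fun _ _ _ => Matrix.smul_mul _ _ _
  add_right := fun _ _ _ => Matrix.mul_add _ _ _
  smul_right := fun _ _ _ => Matrix.mul_smul _ _ _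
  bound := ⟨1, one_pos, fun A B => by simpa using Matrix.linfty_opNorm_mul A B⟩

theorem _root_.ContDiffAt.matrix_mul {f : F → Matrix l m D} {g : F → Matrix m n D}
    (hf : ContDiffAt ℝ ω f x) (hg : ContDiffAt ℝ ω g x) :
    ContDiffAt ℝ ω (fun y => f y * g y) x :=
  ContDiffAt.comp (g := fun y : Matrix l m D × Matrix m n D => y.1 * y.2) x
    isBoundedBilinearMap_matrix_mul.contDiff.contDiffAt (hf.prodMk hg)

theorem _root_.ContDiffAt.ringInverse {R : Type*} [NormedRing R] [NormedAlgebra ℝ R]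
    [CompleteSpace R] {f : F → R} (hf : ContDiffAt ℝ ω f x) (hu : IsUnit (f x)) :
    ContDiffAt ℝ ω (fun y => Ring.inverse (f y)) x := by
  obtain ⟨u, hu⟩ := hu
  exact ContDiffAt.comp x (by rw [← hu]; exact contDiffAt_ringInverse ℝ u) hf

/-- `A` and `B` are conjugate. -/
def ConjRel {R : Type*} [Monoid R] (A B : R) : Prop :=
  ∃ g h : R, g * h = 1 ∧ h * g = 1 ∧ B = g * A * h

/-- `B` describes the restriction of `A` to the range of `A`. -/
def IsRangeRestriction (A : Matrix m m D) (B : Matrix p p D) : Prop :=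
  ∃ (Q : Matrix m p D) (s : Matrix p m D), IsRankFactorization A Q s ∧ B = s * Q

/-- Two rank factorizations of `A` differ by the invertible matrix `L' * Q`, where `L'` is a left
inverse of `Q'`, and this matrix conjugates `s * Q` into `s' * Q'`. -/
theorem IsRangeRestriction.conjRel {A : Matrix m m D} {B C : Matrix p p D}
    (h : IsRangeRestriction A B) (h' : IsRangeRestriction A C) : ConjRel B C := by
  obtain ⟨Q, s, ⟨⟨L, hL⟩, ⟨R, hR⟩, hA⟩, rfl⟩ := h
  obtain ⟨Q', s', ⟨⟨L', hL'⟩, ⟨R', hR'⟩, hA'⟩, rfl⟩ := h'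
  have e : Q * s = Q' * s' := by rw [← hA, ← hA']
  have h1 : s = L * Q' * s' := by
    rw [Matrix.mul_assoc, ← e, ← Matrix.mul_assoc, hL, Matrix.one_mul]
  have h2 : s' = L' * Q * s := by
    rw [Matrix.mul_assoc, e, ← Matrix.mul_assoc, hL', Matrix.one_mul]
  have g1 : L * Q' * (L' * Q) = 1 := by
    calc L * Q' * (L' * Q) = (L * Q' * (L' * Q * s)) * R := by
          simp only [Matrix.mul_assoc]; rw [hR]; simp
      _ = 1 := by rw [← h2, ← h1, hR]
  have g2 : L' * Q * (L * Q') = 1 := mul_eq_one_comm.1 g1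
  have h3 : Q' = Q * (L * Q') := by
    have : Q' = Q' * (s' * R') := by rw [hR', Matrix.mul_one]
    rw [← Matrix.mul_assoc, ← e] at this
    conv_lhs => rw [this, h1]
    simp only [Matrix.mul_assoc]
    rw [hR', Matrix.mul_one]
  refine ⟨L' * Q, L * Q', g2, g1, ?_⟩
  conv_lhs => rw [h3, h2]
  simp only [Matrix.mul_assoc]

theorem IsRangeRestriction.of_conjRel {A B : Matrix m m D} {C : Matrix p p D} (h : ConjRel A B)
    (h' : IsRangeRestriction A C) : IsRangeRestriction B C := by
  obtain ⟨g, k, hgk, hkg, rfl⟩ := h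
  obtain ⟨Q, s, ⟨⟨L, hL⟩, ⟨R, hR⟩, hA⟩, rfl⟩ := h'
  refine ⟨g * Q, s * k, ⟨⟨L * k, ?_⟩, ⟨g * R, ?_⟩, ?_⟩, ?_⟩
  · calc L * k * (g * Q) = L * (k * g) * Q := by simp only [Matrix.mul_assoc]
      _ = 1 := by rw [hkg, Matrix.mul_one, hL]
  · calc s * k * (g * R) = s * (k * g) * R := by simp only [Matrix.mul_assoc]
      _ = 1 := by rw [hkg, Matrix.mul_one, hR]
  · rw [hA]; simp only [Matrix.mul_assoc]
  · calc s * Q = s * (1 : Matrix m m D) * Q := by rw [Matrix.mul_one]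
      _ = s * k * (g * Q) := by rw [← hkg]; simp only [Matrix.mul_assoc]

theorem IsRankFactorization.pow_succ {A : Matrix m m D} {Q : Matrix m p D} {s : Matrix p m D}
    (h : IsRankFactorization A Q s) (k : ℕ) : A ^ (k + 1) = Q * (s * Q) ^ k * s := by
  induction k with
  | zero => simp [h.eq]
  | succ k ih =>
    rw [_root_.pow_succ, ih, _root_.pow_succ]
    conv_lhs => rw [h.eq]
    simp only [Matrix.mul_assoc]

theorem exists_isSplit_of_left_inverse {r k : ℕ} (hn : Fintype.card n = r + k)
    {Q : Matrix n (Fin r) D} {L : Matrix (Fin r) n D} (h : L * Q = 1) :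
    ∃ (Q' : Matrix n (Fin k) D) (L' : Matrix (Fin k) n D), IsSplit Q L Q' L' := by
  have he : (Q * L) * (Q * L) = Q * L := by
    calc (Q * L) * (Q * L) = Q * (L * Q) * L := by simp only [Matrix.mul_assoc]
      _ = Q * L := by rw [h, Matrix.mul_one]
  have hr : IsRankFactorization (Q * L) Q L := ⟨⟨L, h⟩, ⟨Q, h⟩, rfl⟩
  obtain ⟨k', Q', s', hQ'⟩ := exists_hasRank (1 - Q * L)
  have hs := isSplit_of_idem he hr hQ'
  have := hs.card
  simp only [Fintype.card_fin] at this
  obtain rfl : k' = k := by omega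
  exact ⟨Q', s', hs⟩

/-- The local description of matrices of rank `r` by a vanishing block and a submersion onto the
matrix of the restriction to the range. -/
theorem exists_local_isRangeRestriction {r k : ℕ} (hn : Fintype.card n = r + k)
    {A₀ : Matrix n n D} {B₀ : Matrix (Fin r) (Fin r) D} (h₀ : IsRangeRestriction A₀ B₀) :
    ∃ (f₁ : Matrix n n D → Matrix (Fin k) (Fin k) D) (f₂ : Matrix n n D → Matrix (Fin r) (Fin r) D),
      ContDiffAt ℝ ω f₁ A₀ ∧ ContDiffAt ℝ ω f₂ A₀ ∧ f₂ A₀ = B₀ ∧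
      Surjective (fderiv ℝ (fun x => (f₁ x, f₂ x)) A₀) ∧
      ∀ᶠ A in 𝓝 A₀, ((∃ B : Matrix (Fin r) (Fin r) D, IsRangeRestriction A B) →
        f₁ A = 0 ∧ IsRangeRestriction A (f₂ A)) ∧
        (f₁ A = 0 → IsRangeRestriction A (f₂ A)) := by
  obtain ⟨Q₀, s₀, ⟨⟨P, hP⟩, ⟨R, hR⟩, hA₀⟩, rfl⟩ := h₀
  obtain ⟨Q', P', hQP⟩ := exists_isSplit_of_left_inverse hn hP
  obtain ⟨R', s', hRs⟩ := exists_isSplit_of_left_inverse hn hR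
  let u : Matrix n n D → Matrix (Fin r) (Fin r) D := fun A => P * A * R
  let v : Matrix n n D → Matrix (Fin r) (Fin r) D := fun A => Ring.inverse (u A)
  -- The compressed Schur complement of the block `u A = P * A * R`, which is the identity at `A₀`
  -- and so invertible nearby. When it vanishes, `A = (A * R * v A) * (P * A)` is a rank
  -- factorization, and `f₂` is the resulting restriction to the range.
  let f₁ : Matrix n n D → Matrix (Fin k) (Fin k) D :=
    fun A => P' * (A - A * R * v A * (P * A)) * R'
  let f₂ : Matrix n n D → Matrix (Fin r) (Fin r) D := fun A => P * A * (A * R * v A)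
  have hu₀ : u A₀ = 1 := by
    calc P * A₀ * R = (P * Q₀) * (s₀ * R) := by rw [hA₀]; simp only [Matrix.mul_assoc]
      _ = 1 := by rw [hP, hR, Matrix.one_mul]
  have hv₀ : v A₀ = 1 := by simp [v, hu₀]
  have hcu : ContDiffAt ℝ ω u A₀ :=
    (contDiffAt_const.matrix_mul contDiffAt_id).matrix_mul contDiffAt_const
  have hcv : ContDiffAt ℝ ω v A₀ := hcu.ringInverse (by rw [hu₀]; exact isUnit_one)
  have hcPA : ContDiffAt ℝ ω (fun A : Matrix n n D => P * A) A₀ :=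
    contDiffAt_const.matrix_mul contDiffAt_id
  have hcAR : ContDiffAt ℝ ω (fun A : Matrix n n D => A * R * v A) A₀ :=
    (contDiffAt_id.matrix_mul contDiffAt_const).matrix_mul hcv
  have hc₁ : ContDiffAt ℝ ω f₁ A₀ :=
    (contDiffAt_const.matrix_mul (contDiffAt_id.sub (hcAR.matrix_mul hcPA))).matrix_mul
      contDiffAt_const
  have hc₂ : ContDiffAt ℝ ω f₂ A₀ := hcPA.matrix_mul hcAR
  have hPA₀ : P * A₀ = s₀ := by rw [hA₀, ← Matrix.mul_assoc, hP, Matrix.one_mul]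
  have hAR₀ : A₀ * R = Q₀ := by rw [hA₀, Matrix.mul_assoc, hR, Matrix.mul_one]
  have hf₂ : f₂ A₀ = s₀ * Q₀ := by simp only [f₂, hPA₀, hAR₀, hv₀, Matrix.mul_one]
  have hf₁ : f₁ A₀ = 0 := by
    simp only [f₁, hPA₀, hAR₀, hv₀, Matrix.mul_one]
    rw [hA₀, sub_self, Matrix.mul_zero, Matrix.zero_mul]
  have hunit : ∀ᶠ A in 𝓝 A₀, IsUnit (u A) :=
    hcu.continuousAt.eventually (Units.isOpen.mem_nhds (by simp [hu₀]))
  refine ⟨f₁, f₂, hc₁, hc₂, hf₂, ?_, ?_⟩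
  -- `Z` is chosen so that `Z Y * Q₀ = Y` and `Z (s₀ * Q₀) = s₀`. Keeping the column factor `Q₀` and
  -- varying the row factor by `Z`, together with the complementary block, yields a section through
  -- `A₀`.
  · let Z : Matrix (Fin r) (Fin r) D → Matrix (Fin r) n D := fun Y => s₀ + (Y - s₀ * Q₀) * P
    let σ : Matrix (Fin k) (Fin k) D × Matrix (Fin r) (Fin r) D → Matrix n n D :=
      fun y => Q₀ * Z y.2 + Q' * y.1 * s'
    have hZ : ContDiff ℝ ω Z := contDiff_iff_contDiffAt.2 fun Y =>
      contDiffAt_const.add ((contDiffAt_id.sub contDiffAt_const).matrix_mul contDiffAt_const)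
    have hσ : ContDiff ℝ ω σ := contDiff_iff_contDiffAt.2 fun y =>
      (contDiffAt_const.matrix_mul (hZ.contDiffAt.comp y contDiffAt_snd)).add
        ((contDiffAt_const.matrix_mul contDiffAt_fst).matrix_mul contDiffAt_const)
    have hfA₀ : ((f₁ A₀, f₂ A₀) : _ × _) = (0, s₀ * Q₀) := by rw [hf₁, hf₂]
    have hσ₀ : σ (f₁ A₀, f₂ A₀) = A₀ := by
      rw [hfA₀]
      simp only [σ, Z, sub_self, Matrix.zero_mul, add_zero, Matrix.mul_zero]
      exact hA₀.symm
    refine surjective_fderiv_of_section (f := fun x => (f₁ x, f₂ x)) (σ := σ)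
      ((hc₁.prodMk hc₂).differentiableAt (by simp)) ((hσ.differentiable (by simp)).differentiableAt)
      hσ₀ ?_
    have hσt : Tendsto σ (𝓝 (f₁ A₀, f₂ A₀)) (𝓝 A₀) := by
      have := hσ.continuous.continuousAt (x := (f₁ A₀, f₂ A₀)).tendsto
      rwa [hσ₀] at this
    filter_upwards [hσt.eventually hunit] with y hy
    have e1 : P * σ y = Z y.2 := by
      calc P * σ y = (P * Q₀) * Z y.2 + (P * Q') * y.1 * s' := by
            simp only [σ, Matrix.mul_add, Matrix.mul_assoc]
        _ = Z y.2 := by rw [hP, hQP.s_mul_Q', Matrix.one_mul]; simp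
    have e2 : σ y * R = Q₀ * u (σ y) := by
      have h1 : u (σ y) = Z y.2 * R := by simp only [u, e1]
      calc σ y * R = Q₀ * (Z y.2 * R) + Q' * y.1 * (s' * R) := by
            simp only [σ, Matrix.add_mul, Matrix.mul_assoc]
        _ = _ := by rw [hRs.s'_mul_Q, h1]; simp
    have e3 : σ y * R * v (σ y) = Q₀ := by
      rw [e2, Matrix.mul_assoc, Ring.mul_inverse_cancel _ hy, Matrix.mul_one]
    have e4 : f₂ (σ y) = y.2 := by
      simp only [f₂, e1, e3]
      simp only [Z, Matrix.add_mul, Matrix.mul_assoc, hP]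
      simp
    have e5 : f₁ (σ y) = y.1 := by
      simp only [f₁, e3, e1]
      simp only [σ, add_sub_cancel_left]
      calc P' * (Q' * y.1 * s') * R' = (P' * Q') * y.1 * (s' * R') := by
            simp only [Matrix.mul_assoc]
        _ = y.1 := by rw [hQP.s'_mul_Q', hRs.s'_mul_Q']; simp
    exact Prod.ext e5 e4
  · filter_upwards [hunit] with A hA
    have key : A = A * R * v A * (P * A) → IsRangeRestriction A (f₂ A) := by
      intro h
      refine ⟨A * R * v A, P * A, ⟨⟨P, ?_⟩, ⟨R * v A, ?_⟩, h⟩, rfl⟩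
      · calc P * (A * R * v A) = u A * v A := by simp only [u, Matrix.mul_assoc]
          _ = 1 := Ring.mul_inverse_cancel _ hA
      · calc P * A * (R * v A) = u A * v A := by simp only [u, Matrix.mul_assoc]
          _ = 1 := Ring.mul_inverse_cancel _ hA
    constructor
    · rintro ⟨B, Q, s, ⟨⟨L, hL⟩, ⟨T, hT⟩, hAQ⟩, -⟩
      have huA : u A = (P * Q) * (s * R) := by
        simp only [u]; rw [hAQ]; simp only [Matrix.mul_assoc]
      have h1 : (s * R) * v A * (P * Q) = 1 := by
        have : (P * Q) * ((s * R) * v A) = 1 := by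
          rw [← Matrix.mul_assoc, ← huA]; exact Ring.mul_inverse_cancel _ hA
        exact mul_eq_one_comm.1 this
      have h2 : A = A * R * v A * (P * A) := by
        calc A = Q * (1 : Matrix (Fin r) (Fin r) D) * s := by rw [Matrix.mul_one]; exact hAQ
          _ = (Q * s) * R * v A * (P * (Q * s)) := by rw [← h1]; simp only [Matrix.mul_assoc]
          _ = _ := by rw [← hAQ]
      refine ⟨?_, key h2⟩
      simp only [f₁]
      rw [← h2, sub_self, Matrix.mul_zero, Matrix.zero_mul]
    · intro hf
      apply key
      rw [← sub_eq_zero]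
      set E := A - A * R * v A * (P * A) with hE
      -- The Schur complement automatically vanishes after `P` on the left or `R` on the right, so
      -- its block `f₁ A` is the only one that could survive.
      have hPE : P * E = 0 := by
        have : P * (A * R * v A * (P * A)) = u A * v A * (P * A) := by
          simp only [u, Matrix.mul_assoc]
        rw [hE, Matrix.mul_sub, this, Ring.mul_inverse_cancel _ hA, Matrix.one_mul, sub_self]
      have hER : E * R = 0 := by
        have : A * R * v A * (P * A) * R = A * R * (v A * u A) := by
          simp only [u, Matrix.mul_assoc]
        rw [hE, Matrix.sub_mul, this, Ring.inverse_mul_cancel _ hA, Matrix.mul_one, sub_self]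
      calc E = (Q₀ * P + Q' * P') * E * (R * s₀ + R' * s') := by
            rw [hQP.add_eq, hRs.add_eq, Matrix.one_mul, Matrix.mul_one]
        _ = Q₀ * (P * E) * (R * s₀ + R' * s') + Q' * P' * ((E * R) * s₀) +
            Q' * (P' * E * R') * s' := by
            simp only [Matrix.add_mul, Matrix.mul_add, Matrix.mul_assoc]; abel
        _ = 0 := by
            have : P' * E * R' = 0 := hf
            rw [hPE, hER, this]; simp

end MatrixAnalysis

/-! ### Stratification by the rank of high powers -/

section StableRank

variable {D : Type*} [NormedDivisionRing D] [NormedAlgebra ℝ D] [FiniteDimensional ℝ D]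
variable {n p : Type*} [Fintype n] [Fintype p] [DecidableEq n] [DecidableEq p]

theorem ConjRel.symm {R : Type*} [Monoid R] {A B : R} (h : ConjRel A B) : ConjRel B A := by
  obtain ⟨g, k, h1, h2, rfl⟩ := h
  refine ⟨k, g, h2, h1, ?_⟩
  calc A = (k * g) * A * (k * g) := by simp [h2]
    _ = _ := by simp only [mul_assoc]

theorem ConjRel.pow {R : Type*} [Monoid R] {A B : R} (h : ConjRel A B) (N : ℕ) :
    ConjRel (A ^ N) (B ^ N) := by
  obtain ⟨g, k, h1, h2, rfl⟩ := h
  refine ⟨g, k, h1, h2, ?_⟩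
  induction N with
  | zero => simp [h1]
  | succ N ih =>
    rw [pow_succ, ih, pow_succ]
    calc g * A ^ N * k * (g * A * k) = g * A ^ N * (k * g) * A * k := by simp only [mul_assoc]
      _ = _ := by rw [h2, mul_one]; simp only [mul_assoc]

theorem HasRank.conjRel {A B : Matrix n n D} {r : ℕ} (h : HasRank A r) (hc : ConjRel A B) :
    HasRank B r := by
  obtain ⟨g, k, h1, h2, rfl⟩ := hc
  exact h.sandwich h2 h2

/-- The powers of `A` eventually have rank `ρ`. -/
def StableRank (A : Matrix n n D) (ρ : ℕ) : Prop := ∀ᶠ N in atTop, HasRank (A ^ N) ρ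

theorem StableRank.conjRel {A B : Matrix n n D} {ρ : ℕ} (h : StableRank A ρ) (hc : ConjRel A B) :
    StableRank B ρ := h.mono fun N hN => hN.conjRel (hc.pow N)

theorem StableRank.unique {A : Matrix n n D} {ρ ρ' : ℕ} (h : StableRank A ρ)
    (h' : StableRank A ρ') : ρ = ρ' := by
  obtain ⟨N, h1, h2⟩ := (h.and h').exists
  exact h1.unique h2

/-- From `A ^ (N + 1) = Q * B ^ N * s`, where `Q` and `s` do not change ranks. -/
theorem IsRangeRestriction.stableRank_iff {A : Matrix n n D} {B : Matrix p p D}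
    (h : IsRangeRestriction A B) {ρ : ℕ} : StableRank A ρ ↔ StableRank B ρ := by
  obtain ⟨Q, s, hA, rfl⟩ := h
  have := fun N => hA.pow_succ N
  obtain ⟨⟨L, hL⟩, ⟨R, hR⟩, -⟩ := hA
  unfold StableRank
  rw [← map_add_atTop_eq_nat 1, eventually_map, map_add_atTop_eq_nat 1]
  have e : ∀ N, HasRank (A ^ (N + 1)) ρ ↔ HasRank ((s * Q) ^ N) ρ := fun N => by
    rw [this, hasRank_sandwich_iff hL hR]
  simp only [e]

theorem stableRank_fin_self_iff {m : ℕ} {A : Matrix (Fin m) (Fin m) D} :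
    StableRank A m ↔ IsUnit A := by
  constructor
  · intro h
    obtain ⟨N, h, hN⟩ := (h.and (eventually_gt_atTop 0)).exists
    obtain ⟨Q, s, ⟨L, hL⟩, ⟨R, hR⟩, hQ⟩ := h
    rw [← isUnit_pow_iff hN.ne', hQ]
    exact (IsUnit.of_mul_eq_one L (mul_eq_one_comm.1 hL)).mul (IsUnit.of_mul_eq_one R hR)
  · rintro ⟨u, rfl⟩
    refine Eventually.of_forall fun N => ?_
    exact ⟨((u ^ N : (Matrix (Fin m) (Fin m) D)ˣ) : Matrix (Fin m) (Fin m) D), 1,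
      ⟨⟨_, Units.inv_mul (u ^ N)⟩, ⟨1, by simp⟩, by simp⟩⟩

theorem StableRank.le {m ρ : ℕ} {A : Matrix (Fin m) (Fin m) D} (h : StableRank A ρ) : ρ ≤ m := by
  obtain ⟨N, Q, s, ⟨L, hL⟩, -⟩ := h.exists
  exact le_of_mul_eq_one _ _ hL

theorem exists_isRangeRestriction {m : ℕ} (A : Matrix (Fin m) (Fin m) D) :
    ∃ r ≤ m, ∃ B : Matrix (Fin r) (Fin r) D, IsRangeRestriction A B := by
  obtain ⟨r, Q, s, h⟩ := exists_hasRank A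
  obtain ⟨L, hL⟩ := h.left
  exact ⟨r, le_of_mul_eq_one _ _ hL, s * Q, Q, s, h, rfl⟩

theorem IsRangeRestriction.isUnit {m : ℕ} {A B : Matrix (Fin m) (Fin m) D}
    (h : IsRangeRestriction A B) : IsUnit A := by
  obtain ⟨Q, s, ⟨⟨L, hL⟩, ⟨R, hR⟩, rfl⟩, -⟩ := h
  exact (IsUnit.of_mul_eq_one L (mul_eq_one_comm.1 hL)).mul (IsUnit.of_mul_eq_one R hR)

/-- The direct sum of an identity matrix of size `ρ` and a nilpotent Jordan block. -/
def shiftMatrix (D : Type*) [Zero D] [One D] (m ρ : ℕ) : Matrix (Fin m) (Fin m) D :=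
  .of fun i j => if (j : ℕ) = (if (i : ℕ) < ρ then (i : ℕ) else i + 1) then 1 else 0

theorem shiftMatrix_self (m : ℕ) : shiftMatrix D m m = 1 := by
  ext i j
  simp [shiftMatrix, Matrix.one_apply, Fin.ext_iff, eq_comm]

theorem isRangeRestriction_shiftMatrix {m ρ : ℕ} (h : ρ ≤ m) :
    IsRangeRestriction (shiftMatrix D (m + 1) ρ) (shiftMatrix D m ρ) := by
  -- Only the last row of the larger matrix is zero, and row `a` is the unit vector with index `f
  -- a`, which skips `ρ`. So the matrix factors through the first `m` coordinates, and the nilpotent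
  -- block shortens by one.
  let f : Fin m → Fin (m + 1) := fun a => if (a : ℕ) < ρ then a.castSucc else a.succ
  have hf : Injective f := by
    intro a b hab
    simp only [f] at hab
    split_ifs at hab <;> simp_all [Fin.ext_iff] <;> omega
  let Q : Matrix (Fin (m + 1)) (Fin m) D := (1 : Matrix _ _ D).submatrix id Fin.castSucc
  let s : Matrix (Fin m) (Fin (m + 1)) D := (1 : Matrix _ _ D).submatrix f id
  refine ⟨Q, s, ⟨⟨(1 : Matrix _ _ D).submatrix Fin.castSucc id, ?_⟩,
    ⟨(1 : Matrix _ _ D).submatrix id f, ?_⟩, ?_⟩, ?_⟩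
  · rw [one_submatrix_mul_one_submatrix, Matrix.submatrix_one _ (Fin.castSucc_injective m)]
  · rw [one_submatrix_mul_one_submatrix, Matrix.submatrix_one _ hf]
  · ext i j
    rw [Matrix.mul_apply]
    induction i using Fin.lastCases with
    | last =>
      rw [Finset.sum_eq_zero]
      · have := j.2
        simp [shiftMatrix, h.not_gt]
        omega
      · intro a _
        simp [Q, (Fin.castSucc_lt_last a).ne']
    | cast i =>
      rw [Finset.sum_eq_single i]
      · simp only [Q, s, shiftMatrix, Matrix.submatrix_apply, id,
          Matrix.one_apply, Matrix.of_apply, Fin.val_castSucc, f]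
        split_ifs <;> simp_all [Fin.ext_iff]
      · intro b _ hb
        simp [Q, Fin.ext_iff, Fin.val_ne_of_ne hb.symm]
      · simp
  · rw [one_submatrix_mul_one_submatrix]
    ext a b
    simp only [shiftMatrix, Matrix.submatrix_apply, Matrix.one_apply, Matrix.of_apply, f]
    split_ifs <;> simp_all [Fin.ext_iff]

theorem exists_shiftMatrix_pow_succ_eq {m ρ : ℕ} (h : ρ ≤ m) :
    ∃ k, shiftMatrix D m ρ ^ (k + 1) = shiftMatrix D m ρ ^ k := by
  induction m, h using Nat.le_induction with
  | base => exact ⟨0, by simp [shiftMatrix_self]⟩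
  | succ m h ih =>
    obtain ⟨k, hk⟩ := ih
    obtain ⟨Q, s, hQ, hs⟩ := isRangeRestriction_shiftMatrix (D := D) h
    exact ⟨k + 1, by rw [hQ.pow_succ, hQ.pow_succ, ← hs, hk]⟩

attribute [local instance] Matrix.linftyOpNormedAddCommGroup Matrix.linftyOpNormedSpace
  Matrix.linftyOpNormedRing Matrix.linftyOpNormedAlgebra

theorem finrank_matrix_fin (k : ℕ) :
    Module.finrank ℝ (Matrix (Fin k) (Fin k) D) = k * k * Module.finrank ℝ D := by
  simp [Module.finrank_matrix]

theorem exists_local_stableRank {m r k ρ : ℕ} (hm : m = r + k) (p : Matrix (Fin m) (Fin m) D)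
    (q : Matrix (Fin r) (Fin r) D) (_ : q ∈ {B : Matrix (Fin r) (Fin r) D | StableRank B ρ})
    (hpq : IsRangeRestriction p q) :
    ∃ (f₁ : Matrix (Fin m) (Fin m) D → Matrix (Fin k) (Fin k) D)
      (f₂ : Matrix (Fin m) (Fin m) D → Matrix (Fin r) (Fin r) D), ContDiffAt ℝ ω f₁ p ∧
      ContDiffAt ℝ ω f₂ p ∧ f₂ p = q ∧ Surjective (fderiv ℝ (fun x => (f₁ x, f₂ x)) p) ∧
      ∀ᶠ x in 𝓝 p, ((∃ y ∈ {B : Matrix (Fin r) (Fin r) D | StableRank B ρ},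
          IsRangeRestriction x y) → f₁ x = 0 ∧
          f₂ x ∈ {B : Matrix (Fin r) (Fin r) D | StableRank B ρ} ∧ IsRangeRestriction x (f₂ x)) ∧
        (f₁ x = 0 → f₂ x ∈ {B : Matrix (Fin r) (Fin r) D | StableRank B ρ} →
          IsRangeRestriction x (f₂ x)) := by
  obtain ⟨f₁, f₂, h1, h2, h3, h4, h5⟩ := exists_local_isRangeRestriction (n := Fin m) (k := k)
    (by simpa using hm) hpq
  refine ⟨f₁, f₂, h1, h2, h3, h4, h5.mono fun x hx => ⟨?_, fun h _ => hx.2 h⟩⟩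
  rintro ⟨y, hy, hxy⟩
  obtain ⟨a, b⟩ := hx.1 ⟨y, hxy⟩
  exact ⟨a, StableRank.conjRel hy (hxy.conjRel b), b⟩

theorem hasStrat_of_isOpen {F : Type*} [NormedAddCommGroup F] [NormedSpace ℝ F]
    {rel : F → F → Prop} {w : ℝ → Set F} {N : Set F} (hN : IsOpen N)
    (hrel : ∀ x y, rel x y → x ∈ N → y ∈ N) (hw : ∀ t, (N ∩ w t).Nonempty) :
    HasStrat rel w N 0 1 := by
  refine .of_fintype (I := Unit) (fun _ => N) (fun _ => 0) (fun i j h => absurd rfl h)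
    (by simp [Set.iUnion_const]) (fun _ => hrel) (fun _ p hp => ?_) (by simp) (by simp) (fun _ _ => hw)
  refine SubmanifoldAt.of_map (Y := Fin 0 → ℝ) (by simp) (fun _ => 0) contDiffAt_const ?_ ?_
  · exact fun y => ⟨0, Subsingleton.elim _ _⟩
  · filter_upwards [hN.mem_nhds hp] with x hx
    simp [hx]

/-- Induction over the size, passing to the restriction to the range. Corank `k` contributes `k² ·
dim D` to the codimension but only `k` to `m - ρ`, so equality needs `k = 1` at every step. The
unique minimal stratum contains `shiftMatrix`, which serves as its test point. -/
theorem hasStrat_stableRank {m ρ : ℕ} (h : ρ ≤ m) :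
    HasStrat ConjRel (fun _ => {shiftMatrix D m ρ}) {A : Matrix (Fin m) (Fin m) D | StableRank A ρ}
      (Module.finrank ℝ D * (m - ρ)) 1 := by
  induction m using Nat.strong_induction_on with
  | _ m ih =>
  obtain rfl | hlt := h.eq_or_lt
  · rw [Nat.sub_self, mul_zero]
    have : {A : Matrix (Fin ρ) (Fin ρ) D | StableRank A ρ} = {A | IsUnit A} :=
      Set.ext fun A => stableRank_fin_self_iff
    refine hasStrat_of_isOpen (by rw [this]; exact Units.isOpen)
      (fun x y h1 h2 => StableRank.conjRel h2 h1) fun _ => ⟨_, ?_, rfl⟩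
    rw [Set.mem_ofPred_eq, stableRank_fin_self_iff, shiftMatrix_self]
    exact isUnit_one
  let T : Fin (m - ρ) → Set (Matrix (Fin m) (Fin m) D) := fun j =>
    {A | ∃ B ∈ {B : Matrix (Fin (ρ + j)) (Fin (ρ + j)) D | StableRank B ρ}, IsRangeRestriction A B}
  have hT : {A : Matrix (Fin m) (Fin m) D | StableRank A ρ} = ⋃ j, T j := by
    ext A
    rw [Set.mem_iUnion]
    constructor
    · intro hA
      obtain ⟨r, hr, B, hB⟩ := exists_isRangeRestriction A
      have hBs := hB.stableRank_iff.1 hA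
      have hρ := hBs.le
      have hrm : r ≠ m := by
        rintro rfl
        exact hlt.ne (StableRank.unique hA (stableRank_fin_self_iff.2 hB.isUnit))
      obtain ⟨j, rfl⟩ := Nat.exists_eq_add_of_le hρ
      exact ⟨⟨j, by omega⟩, B, hBs, hB⟩
    · rintro ⟨j, B, hB, hAB⟩
      exact hAB.stableRank_iff.2 hB
  have hdisj : Pairwise fun i j => Disjoint (T i) (T j) := by
    intro i j hij
    rw [Set.disjoint_left]
    rintro A ⟨B, -, Q, s, hQ, -⟩ ⟨B', -, Q', s', hQ', -⟩
    have := HasRank.unique ⟨Q, s, hQ⟩ ⟨Q', s', hQ'⟩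
    exact hij (Fin.ext (by omega))
  have hδ : 0 < Module.finrank ℝ D := Module.finrank_pos
  have main : ∀ j, HasStrat ConjRel (fun _ => {shiftMatrix D m ρ}) (T j)
      (Module.finrank ℝ D * (m - ρ)) (if j = ⟨m - ρ - 1, by omega⟩ then 1 else 0) := by
    intro j
    have hj := j.2
    have h0 := ih (ρ + j) (by omega) (by omega)
    split_ifs with hjm
    · have hjv : m = ρ + j + 1 := by
        have : (j : ℕ) = m - ρ - 1 := by rw [hjm]
        omega
      have := HasStrat.transfer (w := fun _ => {shiftMatrix D m ρ}) (finrank_matrix_fin 1) h0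
        IsRangeRestriction (fun x y z _ _ hy hz => hy.conjRel hz)
        (fun x y z h1 h2 => h2.of_conjRel h1) (exists_local_stableRank hjv) ?_
      · convert this using 1
        rw [one_mul, one_mul, ← Nat.mul_succ]
        congr 1
        omega
      · rintro - -
        refine ⟨0, ?_⟩
        rintro y - rfl
        refine ⟨_, rfl, ?_⟩
        have := isRangeRestriction_shiftMatrix (D := D) (m := ρ + j) (ρ := ρ) (by omega)
        rwa [← hjv] at this
    · have hjv : (j : ℕ) ≠ m - ρ - 1 := fun h => hjm (Fin.ext h)
      refine h0.transfer_of_lt (finrank_matrix_fin (m - (ρ + j)))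
        IsRangeRestriction (fun x y z _ _ hy hz => hy.conjRel hz)
        (fun x y z h1 h2 => h2.of_conjRel h1) (exists_local_stableRank (by omega)) ?_
      -- Corank `k + 2` at least two: the codimension `dim D * ((k + 2)² + a)` strictly exceeds `dim
      -- D * (k + 2 + a)`, so no minimal stratum arises.
      generalize (j : ℕ) = a at *
      obtain ⟨k, hk⟩ : ∃ k, m - (ρ + a) = k + 2 := ⟨m - (ρ + a) - 2, by omega⟩
      rw [hk, show m - ρ = a + (k + 2) by omega, show ρ + a - ρ = a by omega]
      nlinarith [mul_pos hδ (Nat.succ_pos k)]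
  have := HasStrat.iUnion hdisj main
  rwa [← hT, Finset.sum_ite_eq' , if_pos (Finset.mem_univ _)] at this

end StableRank

/-! ### Block diagonal matrices attached to a splitting -/

section Blocks

variable {D : Type*} [DivisionRing D]
variable {n p q : Type*} [Fintype n] [Fintype p] [Fintype q]
  [DecidableEq n] [DecidableEq p] [DecidableEq q]
variable {Q : Matrix n p D} {s : Matrix p n D} {Q' : Matrix n q D} {s' : Matrix q n D}

/-- The block diagonal embedding attached to a splitting. -/
def IsSplit.blockDiag (h : IsSplit Q s Q' s') (K : Type*) [CommSemiring K] [Algebra K D] :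
    Matrix p p D × Matrix q q D →ₐ[K] Matrix n n D :=
  AlgHom.ofLinearMap
    { toFun := fun x => Q * x.1 * s + Q' * x.2 * s'
      map_add' := fun x y => by
        simp only [Prod.fst_add, Prod.snd_add, Matrix.mul_add, Matrix.add_mul]; abel
      map_smul' := fun r x => by
        simp only [Prod.smul_fst, Prod.smul_snd, Matrix.mul_smul, Matrix.smul_mul, smul_add,
          RingHom.id_apply] }
    (by simpa using h.add_eq)
    (fun x y => by
      have e1 : ∀ X : Matrix p n D, s * (Q * X) = X := fun X => by
        rw [← Matrix.mul_assoc, h.s_mul_Q, Matrix.one_mul]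
      have e2 : ∀ X : Matrix q n D, s' * (Q' * X) = X := fun X => by
        rw [← Matrix.mul_assoc, h.s'_mul_Q', Matrix.one_mul]
      have e3 : ∀ X : Matrix q n D, s * (Q' * X) = 0 := fun X => by
        rw [← Matrix.mul_assoc, h.s_mul_Q', Matrix.zero_mul]
      have e4 : ∀ X : Matrix p n D, s' * (Q * X) = 0 := fun X => by
        rw [← Matrix.mul_assoc, h.s'_mul_Q, Matrix.zero_mul]
      simp [Matrix.add_mul, Matrix.mul_add, Matrix.mul_assoc, e1, e2, e3, e4])

theorem IsSplit.swap (h : IsSplit Q s Q' s') : IsSplit Q' s' Q s :=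
  ⟨h.2, h.1, h.4, h.3, by rw [add_comm]; exact h.5⟩

variable {K : Type*} [CommSemiring K] [Algebra K D]

theorem IsSplit.blockDiag_apply (h : IsSplit Q s Q' s') (x : Matrix p p D × Matrix q q D) :
    h.blockDiag K x = Q * x.1 * s + Q' * x.2 * s' := rfl

theorem IsSplit.left_mul_blockDiag (h : IsSplit Q s Q' s') (x : Matrix p p D × Matrix q q D) :
    s * h.blockDiag K x = x.1 * s := by
  rw [h.blockDiag_apply, Matrix.mul_add]
  calc s * (Q * x.1 * s) + s * (Q' * x.2 * s') = (s * Q) * x.1 * s + (s * Q') * x.2 * s' := by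
        simp only [Matrix.mul_assoc]
    _ = _ := by rw [h.s_mul_Q, h.s_mul_Q']; simp

theorem IsSplit.left'_mul_blockDiag (h : IsSplit Q s Q' s') (x : Matrix p p D × Matrix q q D) :
    s' * h.blockDiag K x = x.2 * s' := by
  have := h.swap.left_mul_blockDiag (K := K) x.swap
  rwa [h.swap.blockDiag_apply, add_comm] at this

theorem IsSplit.left_mul_blockDiag_mul (h : IsSplit Q s Q' s')
    (x : Matrix p p D × Matrix q q D) : s * h.blockDiag K x * Q = x.1 := by
  rw [h.left_mul_blockDiag, Matrix.mul_assoc, h.s_mul_Q, Matrix.mul_one]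

theorem IsSplit.left'_mul_blockDiag_mul (h : IsSplit Q s Q' s')
    (x : Matrix p p D × Matrix q q D) : s' * h.blockDiag K x * Q' = x.2 := by
  rw [h.left'_mul_blockDiag, Matrix.mul_assoc, h.s'_mul_Q', Matrix.mul_one]

theorem IsSplit.blockDiag_injective (h : IsSplit Q s Q' s') : Injective (h.blockDiag K) :=
  fun x y hxy => by
    ext1
    · rw [← h.left_mul_blockDiag_mul (K := K) x, hxy, h.left_mul_blockDiag_mul]
    · rw [← h.left'_mul_blockDiag_mul (K := K) x, hxy, h.left'_mul_blockDiag_mul]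

theorem IsSplit.isUnit_blockDiag_iff (h : IsSplit Q s Q' s')
    {x : Matrix p p D × Matrix q q D} :
    IsUnit (h.blockDiag K x) ↔ IsUnit x.1 ∧ IsUnit x.2 := by
  constructor
  · rintro hu
    obtain ⟨y, hy⟩ := hu.exists_right_inv
    refine ⟨IsUnit.of_mul_eq_one (s * y * Q) ?_, IsUnit.of_mul_eq_one (s' * y * Q') ?_⟩
    · calc x.1 * (s * y * Q) = s * h.blockDiag K x * y * Q := by
            rw [h.left_mul_blockDiag]; simp only [Matrix.mul_assoc]
        _ = s * (h.blockDiag K x * y) * Q := by simp only [Matrix.mul_assoc]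
        _ = 1 := by rw [hy, Matrix.mul_one, h.s_mul_Q]
    · calc x.2 * (s' * y * Q') = s' * h.blockDiag K x * y * Q' := by
            rw [h.left'_mul_blockDiag]; simp only [Matrix.mul_assoc]
        _ = s' * (h.blockDiag K x * y) * Q' := by simp only [Matrix.mul_assoc]
        _ = 1 := by rw [hy, Matrix.mul_one, h.s'_mul_Q']
  · rintro ⟨h1, h2⟩
    exact (Prod.isUnit_iff.2 ⟨h1, h2⟩).map (h.blockDiag K)

theorem IsSplit.hasRank_blockDiag (h : IsSplit Q s Q' s') {x : Matrix p p D × Matrix q q D}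
    {r r' : ℕ} (h1 : HasRank x.1 r) (h2 : HasRank x.2 r') :
    HasRank (h.blockDiag K x) (r + r') := by
  obtain ⟨A, B, ⟨L, hL⟩, ⟨R, hR⟩, hAB⟩ := h1
  obtain ⟨A', B', ⟨L', hL'⟩, ⟨R', hR'⟩, hAB'⟩ := h2
  refine IsRankFactorization.hasRank (p := Fin r ⊕ Fin r')
    (Q := Matrix.fromCols (Q * A) (Q' * A')) (s := Matrix.fromRows (B * s) (B' * s'))
    ⟨⟨Matrix.fromRows (L * s) (L' * s'), ?_⟩, ⟨Matrix.fromCols (Q * R) (Q' * R'), ?_⟩, ?_⟩ (by simp)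
  · rw [Matrix.fromRows_mul_fromCols, ← Matrix.fromBlocks_one]
    congr 1
    · rw [Matrix.mul_assoc, ← Matrix.mul_assoc s, h.s_mul_Q, Matrix.one_mul, hL]
    · rw [Matrix.mul_assoc, ← Matrix.mul_assoc s, h.s_mul_Q', Matrix.zero_mul, Matrix.mul_zero]
    · rw [Matrix.mul_assoc, ← Matrix.mul_assoc s', h.s'_mul_Q, Matrix.zero_mul, Matrix.mul_zero]
    · rw [Matrix.mul_assoc, ← Matrix.mul_assoc s', h.s'_mul_Q', Matrix.one_mul, hL']
  · rw [Matrix.fromRows_mul_fromCols, ← Matrix.fromBlocks_one]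
    congr 1
    · rw [Matrix.mul_assoc, ← Matrix.mul_assoc s, h.s_mul_Q, Matrix.one_mul, hR]
    · rw [Matrix.mul_assoc, ← Matrix.mul_assoc s, h.s_mul_Q', Matrix.zero_mul, Matrix.mul_zero]
    · rw [Matrix.mul_assoc, ← Matrix.mul_assoc s', h.s'_mul_Q, Matrix.zero_mul, Matrix.mul_zero]
    · rw [Matrix.mul_assoc, ← Matrix.mul_assoc s', h.s'_mul_Q', Matrix.one_mul, hR']
  · rw [Matrix.fromCols_mul_fromRows, h.blockDiag_apply, hAB, hAB']
    simp only [Matrix.mul_assoc]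

/-- A matrix commuting with the idempotent of a splitting is block diagonal. -/
theorem IsSplit.eq_blockDiag (h : IsSplit Q s Q' s') {A : Matrix n n D}
    (hA : Commute A (Q * s)) : h.blockDiag K (s * A * Q, s' * A * Q') = A := by
  have hc : Q * s * A = A * (Q * s) := hA.eq.symm
  have h' : Q' * s' = 1 - Q * s := by rw [← h.add_eq, add_sub_cancel_left]
  have hc' : Q' * s' * A = A * (Q' * s') := by
    rw [h', Matrix.sub_mul, hc, Matrix.mul_sub, Matrix.one_mul, Matrix.mul_one]
  have e1 : Q * (s * A * Q) * s = A * (Q * s) := by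
    calc Q * (s * A * Q) * s = (Q * s * A) * (Q * s) := by simp only [Matrix.mul_assoc]
      _ = A * (Q * (s * Q) * s) := by rw [hc]; simp only [Matrix.mul_assoc]
      _ = _ := by rw [h.s_mul_Q, Matrix.mul_one]
  have e2 : Q' * (s' * A * Q') * s' = A * (Q' * s') := by
    calc Q' * (s' * A * Q') * s' = (Q' * s' * A) * (Q' * s') := by simp only [Matrix.mul_assoc]
      _ = A * (Q' * (s' * Q') * s') := by
        rw [hc']; simp only [Matrix.mul_assoc]
      _ = _ := by rw [h.s'_mul_Q', Matrix.mul_one]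
  rw [h.blockDiag_apply, e1, e2, ← Matrix.mul_add, h.add_eq, Matrix.mul_one]

/-- Two splittings with the same idempotent are related by an invertible matrix. -/
theorem IsSplit.conj_of_eq {Q₁ : Matrix n p D} {s₁ : Matrix p n D} {Q₁' : Matrix n q D}
    {s₁' : Matrix q n D} (h : IsSplit Q s Q' s') (h₁ : IsSplit Q₁ s₁ Q₁' s₁')
    (he : Q * s = Q₁ * s₁) {x y : Matrix p p D × Matrix q q D}
    (hxy : h.blockDiag K x = h₁.blockDiag K y) : ConjRel x.1 y.1 := by
  refine ⟨s₁ * Q, s * Q₁, ?_, ?_, ?_⟩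
  · calc s₁ * Q * (s * Q₁) = s₁ * (Q * s) * Q₁ := by simp only [Matrix.mul_assoc]
      _ = (s₁ * Q₁) * (s₁ * Q₁) := by rw [he]; simp only [Matrix.mul_assoc]
      _ = 1 := by rw [h₁.s_mul_Q, Matrix.one_mul]
  · calc s * Q₁ * (s₁ * Q) = s * (Q₁ * s₁) * Q := by simp only [Matrix.mul_assoc]
      _ = (s * Q) * (s * Q) := by rw [← he]; simp only [Matrix.mul_assoc]
      _ = 1 := by rw [h.s_mul_Q, Matrix.one_mul]
  · calc y.1 = s₁ * h.blockDiag K x * Q₁ := by rw [hxy, h₁.left_mul_blockDiag_mul]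
      _ = s₁ * (h.blockDiag K x * (Q₁ * s₁)) * Q₁ := by
        rw [← Matrix.mul_assoc _ Q₁, ← Matrix.mul_assoc s₁, Matrix.mul_assoc _ s₁, h₁.s_mul_Q,
          Matrix.mul_one, Matrix.mul_assoc]
      _ = _ := by
        rw [← he, h.blockDiag_apply]
        calc s₁ * ((Q * x.1 * s + Q' * x.2 * s') * (Q * s)) * Q₁ =
            s₁ * (Q * x.1 * ((s * Q) * s) + Q' * x.2 * ((s' * Q) * s)) * Q₁ := by
              simp only [Matrix.mul_assoc, Matrix.add_mul]
          _ = _ := by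
              rw [h.s_mul_Q, h.s'_mul_Q]; simp [Matrix.mul_assoc]

theorem IsSplit.conj (h : IsSplit Q s Q' s') {g k : Matrix n n D} (h1 : g * k = 1)
    (h2 : k * g = 1) : IsSplit (g * Q) (s * k) (g * Q') (s' * k) := by
  refine ⟨?_, ?_, ?_, ?_, ?_⟩
  · rw [Matrix.mul_assoc, ← Matrix.mul_assoc k, h2, Matrix.one_mul, h.s_mul_Q]
  · rw [Matrix.mul_assoc, ← Matrix.mul_assoc k, h2, Matrix.one_mul, h.s'_mul_Q']
  · rw [Matrix.mul_assoc, ← Matrix.mul_assoc k, h2, Matrix.one_mul, h.s_mul_Q']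
  · rw [Matrix.mul_assoc, ← Matrix.mul_assoc k, h2, Matrix.one_mul, h.s'_mul_Q]
  · calc g * Q * (s * k) + g * Q' * (s' * k) = g * (Q * s + Q' * s') * k := by
          simp only [Matrix.mul_add, Matrix.add_mul, Matrix.mul_assoc]
      _ = 1 := by rw [h.add_eq, Matrix.mul_one, h1]

theorem IsSplit.blockDiag_conj (h : IsSplit Q s Q' s') {g k : Matrix n n D} (h1 : g * k = 1)
    (h2 : k * g = 1) (x : Matrix p p D × Matrix q q D) :
    (h.conj h1 h2).blockDiag K x = g * h.blockDiag K x * k := by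
  simp only [blockDiag_apply, Matrix.mul_add, Matrix.add_mul, Matrix.mul_assoc]

end Blocks

/-! ### Rank of the spectral idempotent and the Fitting decomposition -/

section SpectralRank

theorem IsSpectralIdem.prod {R S : Type*} [Ring R] [Algebra ℝ R] [Ring S] [Algebra ℝ S] {Z : Set ℂ}
    {a e : R} {c f : S} (h : IsSpectralIdem Z a e) (h' : IsSpectralIdem Z c f) :
    IsSpectralIdem Z (a, c) (e, f) := by
  obtain ⟨h1, h2, ⟨p, hp, hpe⟩, ⟨q, hq, hqe⟩⟩ := h
  obtain ⟨h1', h2', ⟨p', hp', hpe'⟩, ⟨q', hq', hqe'⟩⟩ := h'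
  have ev : ∀ u : ℝ[X], aeval (a, c) u = (aeval a u, aeval c u) := fun u => by
    ext
    · exact (aeval_algHom_apply (AlgHom.fst ℝ R S) (a, c) u).symm
    · exact (aeval_algHom_apply (AlgHom.snd ℝ R S) (a, c) u).symm
  refine ⟨Prod.ext h1 h1', Prod.ext h2 h2', ⟨p * p', fun z hz => ?_, ?_⟩,
    ⟨q * q', fun z hz => ?_, ?_⟩⟩
  · rw [map_mul, mul_eq_zero] at hz
    exact hz.elim (hp z) (hp' z)
  · rw [ev]
    ext
    · simp only [Prod.fst_mul, Prod.fst_zero]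
      rw [mul_comm, map_mul, mul_assoc, hpe, mul_zero]
    · simp only [Prod.snd_mul, Prod.snd_zero]
      rw [map_mul, mul_assoc, hpe', mul_zero]
  · rw [map_mul]
    exact mul_ne_zero (hq z hz) (hq' z hz)
  · rw [ev]
    ext
    · simp only [Prod.fst_mul, Prod.fst_zero, Prod.fst_sub, Prod.fst_one]
      rw [mul_comm, map_mul, mul_assoc, hqe, mul_zero]
    · simp only [Prod.snd_mul, Prod.snd_zero, Prod.snd_sub, Prod.snd_one]
      rw [map_mul, mul_assoc, hqe', mul_zero]

variable {D : Type*} [DivisionRing D] [Algebra ℝ D] [FiniteDimensional ℝ D]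
variable {n p q : Type*} [Fintype n] [Fintype p] [Fintype q]
  [DecidableEq n] [DecidableEq p] [DecidableEq q]
variable {Q : Matrix n p D} {s : Matrix p n D} {Q' : Matrix n q D} {s' : Matrix q n D}
variable {Z : Set ℂ}

/-- The spectral idempotent of `A` attached to `Z` has rank `r`. -/
def SpectralRank (Z : Set ℂ) (A : Matrix n n D) (r : ℕ) : Prop :=
  ∃ e, IsSpectralIdem Z A e ∧ HasRank e r

theorem SpectralRank.unique {A : Matrix n n D} {r r' : ℕ} (h : SpectralRank Z A r)
    (h' : SpectralRank Z A r') : r = r' := by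
  obtain ⟨e, he, hr⟩ := h
  obtain ⟨e', he', hr'⟩ := h'
  obtain rfl := he.unique he'
  exact hr.unique hr'

theorem exists_spectralRank (hZ : ∀ z ∈ Z, conj z ∈ Z) (A : Matrix n n D) :
    ∃ r, SpectralRank Z A r := by
  obtain ⟨e, he⟩ := exists_isSpectralIdem hZ A
  obtain ⟨r, hr⟩ := exists_hasRank e
  exact ⟨r, e, he, hr⟩

theorem SpectralRank.le_card {A : Matrix n n D} {r : ℕ} (h : SpectralRank Z A r) :
    r ≤ Fintype.card n := by
  obtain ⟨e, he, hr⟩ := h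
  exact hr.le_card he.1

theorem spectralRank_zero_iff (hZ : ∀ z ∈ Z, conj z ∈ Z) {A : Matrix n n D} :
    SpectralRank Z A 0 ↔ SpectrumFree Z A := by
  rw [← isSpectralIdem_zero_iff hZ]
  constructor
  · rintro ⟨e, he, hr⟩
    rwa [hasRank_zero_iff.1 hr] at he
  · exact fun h => ⟨0, h, hasRank_zero⟩

theorem spectralRank_card {A : Matrix n n D} {f : ℝ[X]}
    (hf : ∀ z : ℂ, aeval z f = 0 → z ∈ Z) (h : aeval A f = 0) :
    SpectralRank Z A (Fintype.card n) :=
  ⟨1, ⟨one_mul 1, Commute.one_right A, ⟨f, hf, by rw [h, zero_mul]⟩,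
    ⟨1, fun z _ => by simp, by simp⟩⟩, hasRank_one⟩

/-- Conjugation by an invertible element as an algebra automorphism. -/
def conjAlgHom {R : Type*} [Ring R] [Algebra ℝ R] (g k : R) (h1 : g * k = 1) (h2 : k * g = 1) :
    R →ₐ[ℝ] R :=
  AlgHom.ofLinearMap (LinearMap.mulLeft ℝ g ∘ₗ LinearMap.mulRight ℝ k) (by simp [h1])
    fun x y => by
      simp only [LinearMap.comp_apply, LinearMap.mulLeft_apply, LinearMap.mulRight_apply]
      calc g * (x * y * k) = g * (x * 1 * y * k) := by rw [mul_one]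
        _ = _ := by rw [← h2]; simp only [mul_assoc]

theorem conjAlgHom_apply {R : Type*} [Ring R] [Algebra ℝ R] (g k : R) (h1 : g * k = 1)
    (h2 : k * g = 1) (x : R) : conjAlgHom g k h1 h2 x = g * x * k := (mul_assoc g x k).symm

theorem SpectralRank.conjRel {A B : Matrix n n D} {r : ℕ} (h : SpectralRank Z A r)
    (hAB : ConjRel A B) : SpectralRank Z B r := by
  obtain ⟨e, he, hr⟩ := h
  obtain ⟨g, k, h1, h2, rfl⟩ := hAB
  have := he.map (conjAlgHom g k h1 h2)
  rw [conjAlgHom_apply, conjAlgHom_apply] at this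
  exact ⟨_, this, hr.sandwich h2 h2⟩

theorem SpectralRank.blockDiag {a : Matrix p p D} {c : Matrix q q D} {r r' : ℕ}
    (h : IsSplit Q s Q' s') (ha : SpectralRank Z a r) (hc : SpectralRank Z c r') :
    SpectralRank Z (h.blockDiag ℝ (a, c)) (r + r') := by
  obtain ⟨e, he, hr⟩ := ha
  obtain ⟨f, hf, hr'⟩ := hc
  exact ⟨_, (he.prod hf).map (h.blockDiag ℝ), h.hasRank_blockDiag hr hr'⟩

theorem SpectralRank.of_blockDiag (hZ : ∀ z ∈ Z, conj z ∈ Z) {a : Matrix p p D}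
    {c : Matrix q q D} {r t : ℕ} (h : IsSplit Q s Q' s')
    (ht : SpectralRank Z (h.blockDiag ℝ (a, c)) t) (ha : SpectralRank Z a r) :
    r ≤ t ∧ SpectralRank Z c (t - r) := by
  obtain ⟨r', hc⟩ := exists_spectralRank hZ c
  have := ht.unique (ha.blockDiag h hc)
  subst this
  exact ⟨by omega, by rwa [Nat.add_sub_cancel_left]⟩

theorem exists_eq_C_mul_X_pow {f : ℝ[X]} (hf : ∀ z : ℂ, aeval z f = 0 → z ∈ ({0} : Set ℂ)) :
    ∃ (c : ℝ) (N : ℕ), c ≠ 0 ∧ f = C c * X ^ N := by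
  have hf0 : f ≠ 0 := by
    rintro rfl
    exact one_ne_zero (hf 1 (by simp))
  obtain ⟨g, hg, hg0⟩ := exists_eq_pow_rootMultiplicity_mul_and_not_dvd f hf0 0
  rw [C_0, sub_zero] at hg hg0
  have hd : g.degree = 0 := by
    by_contra hd
    have hd' : (g.map (algebraMap ℝ ℂ)).degree ≠ 0 := by rwa [degree_map]
    obtain ⟨z, hz⟩ := IsAlgClosed.exists_root _ hd'
    have hz' : aeval z g = 0 := by rwa [IsRoot, eval_map_algebraMap] at hz
    have := hf z (by rw [hg, map_mul, hz', mul_zero])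
    rw [Set.mem_singleton_iff] at this
    subst this
    apply hg0
    rw [X_dvd_iff, coeff_zero_eq_eval_zero]
    rw [← map_zero (algebraMap ℝ ℂ), aeval_algebraMap_apply] at hz'
    simpa using hz'
  rw [eq_C_of_degree_eq_zero hd] at hg
  refine ⟨g.coeff 0, rootMultiplicity 0 f, ?_, by rw [mul_comm]; exact hg⟩
  intro h
  rw [h, C_0, mul_zero] at hg
  exact hf0 hg

/-- The Fitting decomposition of `A` with respect to a polynomial `f`. -/
theorem exists_fitting {K : Type*} [Field K] [Algebra K D] {m : ℕ}
    (A : Matrix (Fin m) (Fin m) D) (f : K[X]) :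
    ∃ (α k : ℕ) (Q : Matrix (Fin m) (Fin α) D) (s : Matrix (Fin α) (Fin m) D)
      (Q' : Matrix (Fin m) (Fin k) D) (s' : Matrix (Fin k) (Fin m) D) (_ : IsSplit Q s Q' s')
      (a : Matrix (Fin α) (Fin α) D) (c : Matrix (Fin k) (Fin k) D), m = α + k ∧
      A = Q * a * s + Q' * c * s' ∧
      IsNilpotent (aeval a f) ∧ IsUnit (aeval c f) := by
  have h0 : ∀ z ∈ ({0} : Set ℂ), conj z ∈ ({0} : Set ℂ) := by simp
  -- The Fitting projection is the spectral idempotent of `f(A)` for the eigenvalue zero. It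
  -- commutes with everything commuting with `f(A)`, in particular with `A`, also when the
  -- coefficients of `f` lie in a field `K` other than `ℝ`.
  obtain ⟨e, he⟩ := exists_isSpectralIdem h0 (aeval A f)
  obtain ⟨α, hα⟩ := exists_hasRank e
  have hle := hα.le_card he.1
  rw [Fintype.card_fin] at hle
  obtain ⟨Q, s, Q', s', h, rfl⟩ := exists_isSplit_of_idem (k := m - α) he.1 hα
    (by rw [Fintype.card_fin]; omega)
  have hc : Commute A (Q * s) :=
    (he.commute h0 (commute_aeval (Commute.refl A) f)).symm
  have hA := h.eq_blockDiag (K := K) hc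
  have hfA : h.blockDiag K (aeval (s * A * Q) f, aeval (s' * A * Q') f) = aeval A f := by
    conv_rhs => rw [← hA, aeval_algHom_apply]
    congr 1
    ext1
    · exact (aeval_algHom_apply (AlgHom.fst K _ _) (s * A * Q, s' * A * Q') f)
    · exact (aeval_algHom_apply (AlgHom.snd K _ _) (s * A * Q, s' * A * Q') f)
  have hfA' : h.blockDiag ℝ (aeval (s * A * Q) f, aeval (s' * A * Q') f) = aeval A f := hfA
  have hg : ∀ g : ℝ[X], aeval (aeval A f) g =
      h.blockDiag ℝ (aeval (aeval (s * A * Q) f) g, aeval (aeval (s' * A * Q') f) g) := by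
    intro g
    rw [← hfA', aeval_algHom_apply]
    congr 1
    ext1
    · exact (aeval_algHom_apply (AlgHom.fst ℝ _ _) (_, _) g).symm
    · exact (aeval_algHom_apply (AlgHom.snd ℝ _ _) (_, _) g).symm
  obtain ⟨-, -, ⟨u, hu, hue⟩, ⟨v, hv, hve⟩⟩ := he
  refine ⟨α, m - α, Q, s, Q', s', h, _, _, by omega, hA.symm, ?_, ?_⟩
  · obtain ⟨c, N, hc0, rfl⟩ := exists_eq_C_mul_X_pow hu
    refine ⟨N, ?_⟩
    have h1 : aeval (aeval (s * A * Q) f) (C c * X ^ N : ℝ[X]) = 0 := by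
      calc _ = s * (aeval (aeval A f) (C c * X ^ N : ℝ[X]) * (Q * s)) * Q := by
            have e : ∀ Y : Matrix (Fin m) (Fin m) D, s * (Y * (Q * s)) * Q = s * Y * Q * (s * Q) :=
              fun Y => by simp only [Matrix.mul_assoc]
            rw [hg, e, h.left_mul_blockDiag_mul, h.s_mul_Q, Matrix.mul_one]
        _ = 0 := by rw [hue, Matrix.mul_zero, Matrix.zero_mul]
    rw [map_mul, aeval_C, map_pow, aeval_X, ← Algebra.smul_def] at h1
    exact (smul_eq_zero.1 h1).resolve_left hc0
  · have h1 : aeval (aeval (s' * A * Q') f) v = 0 := by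
      calc _ = s' * (aeval (aeval A f) v * (Q' * s')) * Q' := by
            have e : ∀ Y : Matrix (Fin m) (Fin m) D,
                s' * (Y * (Q' * s')) * Q' = s' * Y * Q' * (s' * Q') :=
              fun Y => by simp only [Matrix.mul_assoc]
            rw [hg, e, h.left'_mul_blockDiag_mul, h.s'_mul_Q', Matrix.mul_one]
        _ = 0 := by
          rw [show Q' * s' = 1 - Q * s by rw [← h.add_eq, add_sub_cancel_left], hve,
            Matrix.mul_zero, Matrix.zero_mul]
    have h2 := SpectrumFree.of_aeval_eq_zero h0 hv h1 0 rfl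
    rw [aeval_conjQuad] at h2
    simpa using h2

/-- In the Fitting decomposition high powers kill the nilpotent block and keep the rank of the
invertible one. -/
theorem stableRank_iff_spectralRank {m r : ℕ} (hr : r ≤ m) {A : Matrix (Fin m) (Fin m) D} :
    (∀ᶠ N in atTop, HasRank (A ^ N) (m - r)) ↔ SpectralRank {0} A r := by
  have h0 : ∀ z ∈ ({0} : Set ℂ), conj z ∈ ({0} : Set ℂ) := by simp
  obtain ⟨α, k, Q, s, Q', s', h, a, c, rfl, rfl, ha, hc⟩ := exists_fitting A (X : ℝ[X])
  rw [aeval_X] at ha hc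
  have h1 : SpectralRank {0} (Q * a * s + Q' * c * s') (α + 0) := by
    refine SpectralRank.blockDiag h ?_ ((spectralRank_zero_iff h0).2 ?_)
    · obtain ⟨N, hN⟩ := ha
      have := spectralRank_card (Z := {0}) (f := X ^ N) (A := a)
        (fun z hz => by simp at hz; simpa using hz.1) (by simpa using hN)
      rwa [Fintype.card_fin] at this
    · rintro _ rfl
      rw [aeval_conjQuad]
      simpa using hc
  have h2 : ∀ᶠ N in atTop, HasRank ((Q * a * s + Q' * c * s') ^ N) k := by
    obtain ⟨N, hN⟩ := ha
    filter_upwards [eventually_ge_atTop N] with M hM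
    have e : (Q * a * s + Q' * c * s') ^ M = Q' * c ^ M * s' := by
      have := map_pow (h.blockDiag ℝ) (a, c) M
      rw [Prod.pow_def, h.blockDiag_apply, h.blockDiag_apply] at this
      rw [← this, pow_eq_zero_of_le hM hN]
      simp
    rw [e]
    refine HasRank.sandwich ?_ h.s'_mul_Q' h.s'_mul_Q'
    obtain ⟨u, hu⟩ := hc.pow M
    rw [← hu]
    exact ⟨u, 1, ⟨⟨_, Units.inv_mul u⟩, ⟨1, by simp⟩, by simp⟩⟩
  constructor
  · intro h'
    obtain ⟨N, h3, h4⟩ := (h'.and h2).exists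
    have := h3.unique h4
    obtain rfl : r = α + 0 := by omega
    exact h1
  · intro h'
    have := h'.unique h1
    have : α + k - r = k := by omega
    rwa [this]

end SpectralRank

/-! ### Transversality to conjugacy classes -/

section LocalConjugation

/-- A finite-dimensional family of elements of an algebra which is transverse to the conjugacy
class of its member `Ψ b` meets all nearby conjugacy classes. -/
theorem exists_local_conj {R S : Type*} [NormedRing R] [NormedAlgebra ℝ R] [FiniteDimensional ℝ R]
    [CompleteSpace R] [NormedAddCommGroup S] [NormedSpace ℝ S] [FiniteDimensional ℝ S]
    (Ψ : S →L[ℝ] R) (hΨ : Injective Ψ) (b : S)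
    (h : ∀ x, ∃ κ y, x = κ * Ψ b - Ψ b * κ + Ψ y) :
    ∃ f : R → S, ContDiffAt ℝ ω f (Ψ b) ∧ f (Ψ b) = b ∧ Surjective (fderiv ℝ f (Ψ b)) ∧
      ∀ᶠ A in 𝓝 (Ψ b), ConjRel (Ψ (f A)) A := by
  have : CompleteSpace S := FiniteDimensional.complete ℝ S
  obtain ⟨C, hC⟩ := Submodule.exists_isCompl (LinearMap.range (Ψ : S →ₗ[ℝ] R))
  let ad : R →ₗ[ℝ] R := LinearMap.mulRight ℝ (Ψ b) - LinearMap.mulLeft ℝ (Ψ b)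
  have had : ∀ κ, ad κ = κ * Ψ b - Ψ b * κ := fun κ => rfl
  let π : R →ₗ[ℝ] C := Submodule.projectionOnto C _ hC.symm
  have hπΨ : ∀ y, π (Ψ y) = 0 := fun y =>
    (Submodule.projectionOnto_apply_eq_zero_iff hC.symm).2 ⟨y, rfl⟩
  have hπ0 : ∀ x, π x = 0 → ∃ y, Ψ y = x := fun x hx =>
    (Submodule.projectionOnto_apply_eq_zero_iff hC.symm).1 hx
  have hsurj : Surjective (π ∘ₗ ad) := by
    intro c
    obtain ⟨κ, y, hκ⟩ := h c
    refine ⟨κ, ?_⟩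
    have : π (c : R) = π (ad κ) := by
      rw [hκ, map_add, hπΨ, add_zero, ← had]
    rw [LinearMap.comp_apply, ← this]
    exact Submodule.projectionOnto_apply_left hC.symm c
  obtain ⟨g₀, hg₀⟩ := (π ∘ₗ ad).exists_rightInverse_of_surjective (LinearMap.range_eq_top.2 hsurj)
  have hg₀' : ∀ c, π (ad (g₀ c)) = c := fun c => LinearMap.congr_fun hg₀ c
  have : CompleteSpace C := FiniteDimensional.complete ℝ C
  let g : C →L[ℝ] R := LinearMap.toContinuousLinearMap g₀
  have hg : ∀ c, π (ad (g c)) = c := hg₀'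
  -- The derivative of `Φ` at `(0, b)` is `Φ'`, commutator with `Ψ b` plus `Ψ`. By the choice of `g`
  -- the commutators fill a complement of the range of `Ψ` exactly once, so `Φ'` is bijective, and
  -- `f` is the second component of a local inverse of `Φ`.
  let Φ : C × S → R := fun x => (1 + g x.1) * Ψ x.2 * Ring.inverse (1 + g x.1)
  let Φ' : C × S →ₗ[ℝ] R := (ad ∘ₗ (g : C →ₗ[ℝ] R)).coprod (Ψ : S →ₗ[ℝ] R)
  have hΦ'apply : ∀ x, Φ' x = ad (g x.1) + Ψ x.2 := fun x => rfl
  have hbij : Bijective Φ' := by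
    constructor
    · rw [← LinearMap.ker_eq_bot, LinearMap.ker_eq_bot']
      rintro ⟨c, y⟩ hx
      rw [hΦ'apply] at hx
      have h1 := congrArg π hx
      rw [map_add, hg, hπΨ, add_zero, map_zero] at h1
      dsimp only at h1
      subst h1
      simp only [map_zero, zero_add] at hx
      rw [show y = 0 from hΨ (by rw [hx, map_zero])]
      rfl
    · intro x
      obtain ⟨y, hy⟩ := hπ0 (x - ad (g (π x))) (by rw [map_sub, hg, sub_self])
      exact ⟨(π x, y), by rw [hΦ'apply, hy]; abel⟩
  let e : (C × S) ≃L[ℝ] R := (LinearEquiv.ofBijective Φ' hbij).toContinuousLinearEquiv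
  have he : ∀ x, e x = ad (g x.1) + Ψ x.2 := fun x => rfl
  have hu : ContDiffAt ℝ ω (fun x : C × S => 1 + g x.1) ((0, b) : C × S) :=
    contDiffAt_const.add (g.contDiff.contDiffAt.comp _ contDiffAt_fst)
  have hu0 : (1 : R) + g ((0, b) : C × S).1 = 1 := by simp
  have hinv : ContDiffAt ℝ ω (fun x : C × S => Ring.inverse (1 + g x.1)) ((0, b) : C × S) :=
    hu.ringInverse (by rw [hu0]; exact isUnit_one)
  have hΨ2 : ContDiffAt ℝ ω (fun x : C × S => Ψ x.2) ((0, b) : C × S) :=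
    Ψ.contDiff.contDiffAt.comp _ contDiffAt_snd
  have hΦ : ContDiffAt ℝ ω Φ ((0, b) : C × S) := (hu.mul hΨ2).mul hinv
  have hder : HasFDerivAt Φ (e : C × S →L[ℝ] R) ((0, b) : C × S) := by
    have d1 : HasFDerivAt (fun x : C × S => 1 + g x.1) (g.comp (.fst ℝ C S)) ((0, b) : C × S) :=
      (g.comp (.fst ℝ C S)).hasFDerivAt.const_add 1
    have d2 : HasFDerivAt (fun x : C × S => Ψ x.2) (Ψ.comp (.snd ℝ C S)) ((0, b) : C × S) :=
      (Ψ.comp (.snd ℝ C S)).hasFDerivAt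
    have d3 : HasFDerivAt (fun x : C × S => Ring.inverse (1 + g x.1))
        ((-ContinuousLinearMap.mulLeftRight ℝ R ((1 : Rˣ)⁻¹ : Rˣ) ((1 : Rˣ)⁻¹ : Rˣ)).comp
          (g.comp (.fst ℝ C S))) ((0, b) : C × S) := by
      refine HasFDerivAt.comp (g := Ring.inverse) (f := fun x : C × S => 1 + g x.1)
        ((0, b) : C × S) ?_ d1
      rw [hu0]
      exact hasFDerivAt_ringInverse (𝕜 := ℝ) (1 : Rˣ)
    refine ((d1.mul' d2).mul' d3).congr_fderiv ?_
    ext x <;> simp [he, had]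
    noncomm_ring
  have h1ω : (ω : WithTop ℕ∞) ≠ 0 := by simp
  have hΦ0 : Φ (0, b) = Ψ b := by simp [Φ]
  let θ := hΦ.localInverse hder h1ω
  have hθ : ContDiffAt ℝ ω θ (Ψ b) := by
    have := hΦ.to_localInverse hder h1ω
    rwa [hΦ0] at this
  have hst := hΦ.hasStrictFDerivAt' hder h1ω
  have hθr : ∀ᶠ A in 𝓝 (Ψ b), Φ (θ A) = A := by
    have := hst.eventually_right_inverse
    rwa [hΦ0] at this
  have hθl : ∀ᶠ x in 𝓝 ((0, b) : C × S), θ (Φ x) = x := hst.eventually_left_inverse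
  have hθ0 : θ (Ψ b) = (0, b) := by
    have := hθl.self_of_nhds
    rwa [hΦ0] at this
  have hf : ContDiffAt ℝ ω (fun A => (θ A).2) (Ψ b) := hθ.snd
  refine ⟨fun A => (θ A).2, hf, congrArg Prod.snd hθ0, ?_, ?_⟩
  · refine surjective_fderiv_of_section (σ := Ψ) (hf.differentiableAt h1ω) ?_ ?_ ?_
    · exact Ψ.differentiableAt
    · rw [hθ0]
    · rw [hθ0]
      have : Tendsto (fun y : S => ((0, y) : C × S)) (𝓝 b) (𝓝 (0, b)) :=
        (Continuous.prodMk_right (0 : C)).tendsto b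
      filter_upwards [this.eventually hθl] with y hy
      have e1 : Φ (0, y) = Ψ y := by simp [Φ]
      rw [e1] at hy
      rw [hy]
  · have hc : ContinuousAt (fun A => 1 + g (θ A).1) (Ψ b) :=
      continuousAt_const.add (g.continuous.continuousAt.comp hθ.continuousAt.fst)
    have hunit : ∀ᶠ A in 𝓝 (Ψ b), IsUnit (1 + g (θ A).1) :=
      hc.eventually (Units.isOpen.mem_nhds (by
        change IsUnit (1 + g (θ (Ψ b)).1)
        rw [hθ0]; simp))
    filter_upwards [hθr, hunit] with A hA hAu
    exact ⟨1 + g (θ A).1, Ring.inverse (1 + g (θ A).1), Ring.mul_inverse_cancel _ hAu,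
      Ring.inverse_mul_cancel _ hAu, hA.symm⟩

end LocalConjugation

/-! ### Conjugating nearby matrices into block form -/

section BlockConjugation

variable {D : Type*} [NormedDivisionRing D] [NormedAlgebra ℝ D] [FiniteDimensional ℝ D]
variable {n p q : Type*} [Fintype n] [Fintype p] [Fintype q]
  [DecidableEq n] [DecidableEq p] [DecidableEq q]
variable {Q : Matrix n p D} {s : Matrix p n D} {Q' : Matrix n q D} {s' : Matrix q n D}

theorem aeval_mul_eq_of_intertwine {K : Type*} [Field K] [Algebra K D] {a : Matrix p p D}
    {c : Matrix q q D} {X : Matrix p q D} (h : a * X = X * c) (f : K[X]) :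
    aeval a f * X = X * aeval c f := by
  induction f using Polynomial.induction_on' with
  | add f g hf hg => rw [map_add, map_add, Matrix.add_mul, Matrix.mul_add, hf, hg]
  | monomial k r =>
    have : ∀ k : ℕ, a ^ k * X = X * c ^ k := by
      intro k
      induction k with
      | zero => simp
      | succ k ih =>
        rw [pow_succ, pow_succ, Matrix.mul_assoc, h, ← Matrix.mul_assoc, ih, Matrix.mul_assoc]
    rw [aeval_monomial, aeval_monomial, ← Algebra.smul_def, ← Algebra.smul_def, Matrix.smul_mul,
      this, Matrix.mul_smul]

/-- An intertwiner of `a` and `c` also intertwines `f(a)` and `f(c)`; a nilpotent on one side and a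
unit on the other leave only zero. -/
theorem eq_zero_of_intertwine {K : Type*} [Field K] [Algebra K D] {a : Matrix p p D}
    {c : Matrix q q D} {f : K[X]} (ha : IsNilpotent (aeval a f)) (hc : IsUnit (aeval c f))
    {X : Matrix p q D} (h : a * X = X * c) : X = 0 := by
  obtain ⟨N, hN⟩ := ha
  have h1 := aeval_mul_eq_of_intertwine h (f ^ N)
  rw [map_pow, hN, Matrix.zero_mul, map_pow] at h1
  obtain ⟨y, hy⟩ := (hc.pow N).exists_right_inv
  calc X = X * aeval c f ^ N * y := by rw [Matrix.mul_assoc, hy, Matrix.mul_one]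
    _ = 0 := by rw [← h1, Matrix.zero_mul]

theorem eq_zero_of_intertwine' {K : Type*} [Field K] [Algebra K D] {a : Matrix p p D}
    {c : Matrix q q D} {f : K[X]} (ha : IsNilpotent (aeval a f)) (hc : IsUnit (aeval c f))
    {X : Matrix q p D} (h : c * X = X * a) : X = 0 := by
  obtain ⟨N, hN⟩ := ha
  have h1 := aeval_mul_eq_of_intertwine h (f ^ N)
  rw [map_pow, map_pow, hN, Matrix.mul_zero] at h1
  obtain ⟨y, hy⟩ := (hc.pow N).exists_left_inv
  calc X = y * (aeval c f ^ N * X) := by rw [← Matrix.mul_assoc, hy, Matrix.one_mul]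
    _ = 0 := by rw [h1, Matrix.mul_zero]

/-- The Sylvester operator is real linear on a finite-dimensional space, so injectivity suffices. -/
theorem surjective_sylvester {a : Matrix p p D} {c : Matrix q q D}
    (h : ∀ X : Matrix p q D, a * X = X * c → X = 0) (Y : Matrix p q D) :
    ∃ X : Matrix p q D, X * c - a * X = Y := by
  let T : Matrix p q D →ₗ[ℝ] Matrix p q D :=
    { toFun := fun X => X * c - a * X
      map_add' := fun X Y => by rw [Matrix.add_mul, Matrix.mul_add]; abel
      map_smul' := fun r X => by
        rw [Matrix.smul_mul, Matrix.mul_smul, smul_sub, RingHom.id_apply] }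
  have hT : Injective T := by
    rw [← LinearMap.ker_eq_bot, LinearMap.ker_eq_bot']
    intro X hX
    exact h X (sub_eq_zero.1 hX).symm
  exact LinearMap.injective_iff_surjective.1 hT Y

/-- The infinitesimal form of block diagonalization: both off-diagonal blocks of `x` are
commutators, by solving two Sylvester equations, and the upper diagonal block is treated by `h1`. -/
theorem IsSplit.exists_commutator_add (h : IsSplit Q s Q' s') {S : Type*} {ι : S → Matrix p p D}
    {a : Matrix p p D} {c : Matrix q q D} (h1 : ∀ x, ∃ κ y, x = κ * a - a * κ + ι y)
    (h2 : ∀ X : Matrix p q D, a * X = X * c → X = 0)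
    (h3 : ∀ X : Matrix q p D, c * X = X * a → X = 0) (x : Matrix n n D) :
    ∃ κ y z, x = κ * h.blockDiag ℝ (a, c) - h.blockDiag ℝ (a, c) * κ + h.blockDiag ℝ (ι y, z) := by
  obtain ⟨κ, y, hκ⟩ := h1 (s * x * Q)
  obtain ⟨X, hX⟩ := surjective_sylvester h2 (s * x * Q')
  obtain ⟨Y, hY⟩ := surjective_sylvester h3 (s' * x * Q)
  refine ⟨h.blockDiag ℝ (κ, 0) + Q * X * s' + Q' * Y * s, y, s' * x * Q', ?_⟩
  have e1 : (Q * X * s' + Q' * Y * s) * h.blockDiag ℝ (a, c) = Q * (X * c) * s' +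
      Q' * (Y * a) * s := by
    rw [Matrix.add_mul, Matrix.mul_assoc, h.left'_mul_blockDiag, Matrix.mul_assoc _ s,
      h.left_mul_blockDiag]
    simp only [Matrix.mul_assoc]
  have e2 : h.blockDiag ℝ (a, c) * (Q * X * s' + Q' * Y * s) = Q * (a * X) * s' +
      Q' * (c * Y) * s := by
    have f1 : h.blockDiag ℝ (a, c) * Q = Q * a := by
      rw [h.blockDiag_apply, Matrix.add_mul, Matrix.mul_assoc _ s, h.s_mul_Q,
        Matrix.mul_assoc _ s', h.s'_mul_Q]
      simp
    have f2 : h.blockDiag ℝ (a, c) * Q' = Q' * c := by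
      rw [h.blockDiag_apply, Matrix.add_mul, Matrix.mul_assoc _ s, h.s_mul_Q',
        Matrix.mul_assoc _ s', h.s'_mul_Q']
      simp
    rw [Matrix.mul_add, ← Matrix.mul_assoc, ← Matrix.mul_assoc, f1, ← Matrix.mul_assoc,
      ← Matrix.mul_assoc, f2]
    simp only [Matrix.mul_assoc]
  have e3 : h.blockDiag ℝ (κ, 0) * h.blockDiag ℝ (a, c) - h.blockDiag ℝ (a, c) *
      h.blockDiag ℝ (κ, 0) = Q * (κ * a - a * κ) * s := by
    rw [← map_mul, ← map_mul, ← map_sub, h.blockDiag_apply]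
    simp
  have e4 : x = Q * (s * x * Q) * s + Q * (s * x * Q') * s' + Q' * (s' * x * Q) * s +
      Q' * (s' * x * Q') * s' := by
    calc x = (Q * s + Q' * s') * x * (Q * s + Q' * s') := by
          rw [h.add_eq, Matrix.one_mul, Matrix.mul_one]
      _ = _ := by simp only [Matrix.mul_add, Matrix.add_mul, Matrix.mul_assoc]; abel
  have e5 : (h.blockDiag ℝ (κ, 0) + Q * X * s' + Q' * Y * s) * h.blockDiag ℝ (a, c) -
      h.blockDiag ℝ (a, c) * (h.blockDiag ℝ (κ, 0) + Q * X * s' + Q' * Y * s) =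
      (h.blockDiag ℝ (κ, 0) * h.blockDiag ℝ (a, c) - h.blockDiag ℝ (a, c) *
      h.blockDiag ℝ (κ, 0)) + ((Q * X * s' + Q' * Y * s) * h.blockDiag ℝ (a, c) -
      h.blockDiag ℝ (a, c) * (Q * X * s' + Q' * Y * s)) := by
    rw [add_assoc, add_mul, mul_add]; abel
  rw [e5, e1, e2, e3, h.blockDiag_apply]
  conv_lhs => rw [e4, hκ, ← hX, ← hY]
  simp only [Matrix.mul_add, Matrix.add_mul, Matrix.mul_sub, Matrix.sub_mul]
  abel

attribute [local instance] Matrix.linftyOpNormedAddCommGroup Matrix.linftyOpNormedSpace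
  Matrix.linftyOpNormedRing Matrix.linftyOpNormedAlgebra

theorem IsSplit.exists_local_retraction (h : IsSplit Q s Q' s') {S : Type*}
    [NormedAddCommGroup S] [NormedSpace ℝ S] [FiniteDimensional ℝ S]
    (ι : S →ₗ[ℝ] Matrix p p D) (hι : Injective ι) (b : S) (c : Matrix q q D)
    (h1 : ∀ x, ∃ κ y, x = κ * ι b - ι b * κ + ι y)
    (h2 : ∀ X : Matrix p q D, ι b * X = X * c → X = 0)
    (h3 : ∀ X : Matrix q p D, c * X = X * ι b → X = 0) :
    ∃ f : Matrix n n D → S × Matrix q q D, ContDiffAt ℝ ω f (h.blockDiag ℝ (ι b, c)) ∧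
      f (h.blockDiag ℝ (ι b, c)) = (b, c) ∧
      Surjective (fderiv ℝ f (h.blockDiag ℝ (ι b, c))) ∧
      ∀ᶠ A in 𝓝 (h.blockDiag ℝ (ι b, c)),
        ConjRel (h.blockDiag ℝ (ι (f A).1, (f A).2)) A := by
  let Ψ : S × Matrix q q D →L[ℝ] Matrix n n D := LinearMap.toContinuousLinearMap
    ((h.blockDiag ℝ).toLinearMap ∘ₗ ι.prodMap LinearMap.id)
  refine exists_local_conj Ψ ?_ (b, c) ?_
  · intro x y hxy
    have := h.blockDiag_injective (K := ℝ) hxy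
    rw [Prod.ext_iff] at this
    exact Prod.ext (hι this.1) this.2
  · intro x
    obtain ⟨κ, y, z, e⟩ := h.exists_commutator_add h1 h2 h3 x
    exact ⟨κ, (y, z), e⟩

/-- Upper semicontinuity: `A` is the sum of its `Z`-part of size `r₀ ≤ r` and a part without
eigenvalues in `Z`. A nearby matrix is conjugate to a block diagonal one of the same shape whose
second block still avoids the closed set `Z`, so its spectral rank is at most `r₀`. -/
theorem isOpen_spectralRank_le {Z : Set ℂ} (hZ : ∀ z ∈ Z, conj z ∈ Z) (hZc : IsClosed Z) (r : ℕ) :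
    IsOpen {A : Matrix n n D | ∃ r' ≤ r, SpectralRank Z A r'} := by
  rw [isOpen_iff_eventually]
  rintro A ⟨r₀, hr₀, e, he, hr⟩
  have hle := hr.le_card he.1
  obtain ⟨Q, s, Q', s', h, rfl⟩ := exists_isSplit_of_idem he.1 hr
    (show Fintype.card n = r₀ + (Fintype.card n - r₀) by omega)
  have hA := h.eq_blockDiag (K := ℝ) he.2.1
  have hfA : ∀ u : ℝ[X], aeval A u =
      h.blockDiag ℝ (aeval (s * A * Q) u, aeval (s' * A * Q') u) := by
    intro u
    conv_lhs => rw [← hA, aeval_algHom_apply]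
    congr 1
    ext1
    · exact (aeval_algHom_apply (AlgHom.fst ℝ _ _) (s * A * Q, s' * A * Q') u).symm
    · exact (aeval_algHom_apply (AlgHom.snd ℝ _ _) (s * A * Q, s' * A * Q') u).symm
  obtain ⟨-, -, ⟨u, hu, hue⟩, ⟨v, hv, hve⟩⟩ := he
  have h1 : aeval (s * A * Q) u = 0 := by
    have e : ∀ Y : Matrix n n D, s * (Y * (Q * s)) * Q = s * Y * Q * (s * Q) :=
      fun Y => by simp only [Matrix.mul_assoc]
    have := e (aeval A u)
    rw [hue, hfA, h.left_mul_blockDiag_mul, h.s_mul_Q, Matrix.mul_one, Matrix.mul_zero,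
      Matrix.zero_mul] at this
    exact this.symm
  have h2 : aeval (s' * A * Q') v = 0 := by
    have e : ∀ Y : Matrix n n D, s' * (Y * (Q' * s')) * Q' = s' * Y * Q' * (s' * Q') :=
      fun Y => by simp only [Matrix.mul_assoc]
    have := e (aeval A v)
    rw [show Q' * s' = 1 - Q * s by rw [← h.add_eq, add_sub_cancel_left], hve, hfA,
      h.left'_mul_blockDiag_mul, h.s'_mul_Q', Matrix.mul_one, Matrix.mul_zero,
      Matrix.zero_mul] at this
    exact this.symm
  have hn : IsNilpotent (aeval (s * A * Q) u) := by rw [h1]; exact IsNilpotent.zero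
  have hc : IsUnit (aeval (s' * A * Q') u) :=
    isUnit_aeval_of_isCoprime (isCoprime_of_roots hu hv) (by rw [h2]; exact IsNilpotent.zero)
  obtain ⟨f, hf, hf0, -, hconj⟩ := h.exists_local_retraction
    (LinearMap.id : Matrix (Fin r₀) (Fin r₀) D →ₗ[ℝ] _) injective_id (s * A * Q) (s' * A * Q')
    (fun x => ⟨0, x, by simp⟩) (fun X hX => eq_zero_of_intertwine hn hc hX)
    (fun X hX => eq_zero_of_intertwine' hn hc hX)
  simp only [LinearMap.id_apply] at hf hf0 hconj
  rw [hA] at hf hf0 hconj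
  have hfree : SpectrumFree Z (f A).2 := by
    rw [hf0]; exact SpectrumFree.of_aeval_eq_zero hZ hv h2
  have hev : ∀ᶠ B in 𝓝 A, SpectrumFree Z (f B).2 :=
    hf.continuousAt.snd.eventually ((isOpen_spectrumFree hZc).mem_nhds hfree)
  filter_upwards [hconj, hev] with B hB hBf
  obtain ⟨r', hr'⟩ := exists_spectralRank hZ (f B).1
  have := hr'.le_card
  rw [Fintype.card_fin] at this
  exact ⟨r' + 0, by omega,
    (hr'.blockDiag h ((spectralRank_zero_iff hZ).2 hBf)).conjRel hB⟩

end BlockConjugation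

theorem HasStrat.transfer_retraction {F F' : Type*} [NormedAddCommGroup F] [NormedSpace ℝ F]
    [NormedAddCommGroup F'] [NormedSpace ℝ F'] {rel : F → F → Prop} {rel' : F' → F' → Prop}
    {w : ℝ → Set F} {w' : ℝ → Set F'} {N' : Set F'} {c k : ℕ} (h : HasStrat rel' w' N' c k)
    (R : F → F' → Prop) (huniq : ∀ x y z, y ∈ N' → z ∈ N' → R x y → R x z → rel' y z)
    (hinv : ∀ x y z, rel x y → R x z → R y z)
    (hloc : ∀ p, ∀ q ∈ N', R p q → ∃ f : F → F', ContDiffAt ℝ ω f p ∧ f p = q ∧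
      Surjective (fderiv ℝ f p) ∧ ∀ᶠ x in 𝓝 p, ((∃ y ∈ N', R x y) → f x ∈ N') ∧ R x (f x))
    (hw : k ≠ 0 → ∀ t, ∃ t', ∀ y ∈ N', y ∈ w' t' → ∃ x ∈ w t, R x y) :
    HasStrat rel w {x | ∃ y ∈ N', R x y} c k := by
  refine h.transfer (Y := Fin 0 → ℝ) (e := 0) (by simp) R huniq hinv ?_ hw
  intro p q hq hpq
  obtain ⟨f, h1, h2, h3, h4⟩ := hloc p q hq hpq
  refine ⟨fun _ => 0, f, contDiffAt_const, h1, h2, ?_, ?_⟩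
  · have e : HasFDerivAt (fun x => ((0 : Fin 0 → ℝ), f x))
        ((0 : F →L[ℝ] (Fin 0 → ℝ)).prod (fderiv ℝ f p)) p :=
      (hasFDerivAt_const _ _).prodMk (h1.differentiableAt (by simp)).hasFDerivAt
    rw [e.fderiv]
    rintro ⟨a, b⟩
    obtain ⟨x, hx⟩ := h3 b
    exact ⟨x, Prod.ext (Subsingleton.elim _ _) hx⟩
  · filter_upwards [h4] with x hx
    exact ⟨fun h => ⟨rfl, hx.1 h, hx.2⟩, fun _ _ => hx.2⟩

/-! ### Commutation with a complex structure -/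

section ComplexStructure

variable {R : Type*} [Ring R] [Algebra ℝ R] {J : R}

/-- Moving `J` across `y` changes its sign, so the intertwining relation becomes `(2θJ + ν') y = y
ν`, with a unit on the left and a nilpotent on the right. -/
theorem eq_zero_of_anticommute {θ : ℝ} (hω : θ ≠ 0) (hJ : J * J = -1) {ν ν' y : R}
    (hν : IsNilpotent ν) (hν' : IsNilpotent ν') (hc' : Commute ν' J) (hy : y * J = -(J * y))
    (h : y * (θ • J + ν) = (θ • J + ν') * y) : y = 0 := by
  have h1 : ((2 * θ) • J + ν') * y = y * ν := by
    rw [mul_add, add_mul, mul_smul_comm, hy, smul_mul_assoc] at h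
    rw [add_mul, smul_mul_assoc, two_mul, add_smul, add_assoc, ← h, smul_neg]
    abel
  have hu : IsUnit ((2 * θ) • J) := by
    refine ⟨⟨(2 * θ) • J, -((2 * θ)⁻¹ • J), ?_, ?_⟩, rfl⟩
    · rw [mul_neg, smul_mul_smul_comm, hJ, mul_inv_cancel₀ (by simpa using hω)]; simp
    · rw [neg_mul, smul_mul_smul_comm, hJ, inv_mul_cancel₀ (by simpa using hω)]; simp
  have hu' : IsUnit ((2 * θ) • J + ν') := by
    rw [add_comm]
    exact hν'.isUnit_add_right_of_commute hu (hc'.smul_right _)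
  obtain ⟨N, hN⟩ := hν
  have h2 : ∀ k, ((2 * θ) • J + ν') ^ k * y = y * ν ^ k := by
    intro k
    induction k with
    | zero => simp
    | succ k ih => rw [pow_succ, pow_succ, mul_assoc, h1, ← mul_assoc, ih, mul_assoc]
  obtain ⟨z, hz⟩ := (hu'.pow N).exists_left_inv
  calc y = z * (((2 * θ) • J + ν') ^ N * y) := by rw [← mul_assoc, hz, one_mul]
    _ = 0 := by rw [h2, hN, mul_zero, mul_zero]

theorem commute_add_anticommute (hJ : J * J = -1) (x : R) :
    Commute ((1 / 2 : ℝ) • (x - J * x * J)) J ∧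
      (1 / 2 : ℝ) • (x + J * x * J) * J = -(J * ((1 / 2 : ℝ) • (x + J * x * J))) ∧
      x = (1 / 2 : ℝ) • (x - J * x * J) + (1 / 2 : ℝ) • (x + J * x * J) := by
  have e1 : J * x * J * J = -(J * x) := by rw [mul_assoc, hJ]; simp
  have e2 : J * (J * x * J) = -(x * J) := by
    rw [← mul_assoc, ← mul_assoc, hJ]; simp
  refine ⟨?_, ?_, ?_⟩
  · rw [commute_iff_eq, smul_mul_assoc, mul_smul_comm, sub_mul, mul_sub, e1, e2]
    congr 1; abel
  · rw [smul_mul_assoc, mul_smul_comm, add_mul, mul_add, e1, e2, ← smul_neg]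
    congr 1; abel
  · rw [← smul_add, show x - J * x * J + (x + J * x * J) = (2 : ℝ) • x by rw [two_smul]; abel,
      smul_smul]
    norm_num

/-- The commutator with `θJ + ν` preserves the space of elements anticommuting with `J` and is
injective there by `eq_zero_of_anticommute`, hence surjective. -/
theorem exists_commutator_of_anticommute [FiniteDimensional ℝ R] {θ : ℝ} (hω : θ ≠ 0)
    (hJ : J * J = -1) {ν : R} (hν : IsNilpotent ν) (hc : Commute ν J) {x : R}
    (hx : x * J = -(J * x)) : ∃ κ, κ * (θ • J + ν) - (θ • J + ν) * κ = x := by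
  let V : Submodule ℝ R := LinearMap.ker (LinearMap.mulRight ℝ J + LinearMap.mulLeft ℝ J)
  have hV : ∀ y, y ∈ V ↔ y * J = -(J * y) := fun y => by
    rw [LinearMap.mem_ker, LinearMap.add_apply, LinearMap.mulRight_apply, LinearMap.mulLeft_apply,
      add_eq_zero_iff_eq_neg]
  let a := θ • J + ν
  have ha : Commute a J := ((Commute.refl J).smul_left θ).add_left hc
  let T : R →ₗ[ℝ] R := LinearMap.mulRight ℝ a - LinearMap.mulLeft ℝ a
  have hT : ∀ y, T y = y * a - a * y := fun y => rfl
  have hTV : ∀ y ∈ V, T y ∈ V := by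
    intro y hy
    rw [hV] at *
    rw [hT, sub_mul, mul_assoc, ha.eq, ← mul_assoc, hy, mul_assoc a, hy, mul_sub, ← mul_assoc J a,
      ← ha.eq]
    simp only [neg_mul, mul_neg, mul_assoc]
    abel
  have hinj : Injective (T.restrict hTV) := by
    rw [← LinearMap.ker_eq_bot, LinearMap.ker_eq_bot']
    rintro ⟨y, hy⟩ h
    have h' : T y = 0 := congrArg Subtype.val h
    exact Subtype.ext (eq_zero_of_anticommute hω hJ hν hν hc ((hV y).1 hy) (sub_eq_zero.1 h'))
  obtain ⟨κ, hκ⟩ := LinearMap.injective_iff_surjective.1 hinj ⟨x, (hV x).2 hx⟩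
  exact ⟨κ, congrArg Subtype.val hκ⟩

end ComplexStructure

/-! ### Frequencies and their abstract models -/

/-- The imaginary axis. -/
def imAxis : Set ℂ := {z | z.re = 0}

theorem conj_mem_imAxis : ∀ z ∈ imAxis, conj z ∈ imAxis := fun z hz => by simpa [imAxis] using hz

theorem isClosed_imAxis : IsClosed imAxis := isClosed_eq Complex.continuous_re continuous_const

/-- The element `i` of the algebra of complex matrices. -/
noncomputable def imUnit (s : ℕ) : Matrix (Fin s) (Fin s) ℂ := Complex.I • 1

/-- The data needed to describe the matrices over `D` having a single pair of eigenvalues on the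
imaginary axis in terms of complex matrices. -/
structure FrequencyModel (D K : Type*) [NormedDivisionRing D] [NormedAlgebra ℝ D]
    [FiniteDimensional ℝ D] [Field K] [Algebra K D] where
  /-- the size over `D` of a one-by-one complex matrix -/
  mult : ℕ
  mult_pos : 0 < mult
  /-- the set of all frequencies -/
  closedFreq : Set ℝ
  /-- the set of frequencies described by complex matrices -/
  freq : Set ℝ
  isClosed_closedFreq : IsClosed closedFreq
  isOpen_freq : IsOpen freq
  freq_subset : freq ⊆ closedFreq
  mem_freq_of_pos : ∀ θ : ℝ, 0 < θ → θ ∈ freq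
  mem_freq_of_le : ∀ θ ∈ freq, ∀ θ', θ ≤ θ' → θ' ∈ freq
  /-- the polynomial detecting a frequency -/
  poly : ℝ → K[X]
  isCoprime_poly : ∀ θ ∈ closedFreq, ∀ θ' ∈ closedFreq, θ ≠ θ' → IsCoprime (poly θ) (poly θ')
  exists_poly_mul : ∀ (n : Type) [Fintype n] [DecidableEq n] (A : Matrix n n D) (θ : ℝ),
    ∃ B, Commute B (aeval A (poly θ)) ∧
      aeval A (conjQuad (θ * Complex.I)) = B * aeval A (poly θ)
  spectrumFree_of_isUnit : ∀ (n : Type) [Fintype n] [DecidableEq n] (A : Matrix n n D),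
    (∀ θ ∈ closedFreq, IsUnit (aeval A (poly θ))) → SpectrumFree imAxis A
  isOpen_setOf_isUnit : ∀ (n : Type) [Fintype n] [DecidableEq n] (A : Matrix n n D),
    IsOpen {θ | IsUnit (aeval A (poly θ))}
  isOpen_setOf_forall_isUnit : ∀ (n : Type) [Fintype n] [DecidableEq n] (L : Set ℝ), IsClosed L →
    IsOpen {A : Matrix n n D | ∀ θ ∈ L, IsUnit (aeval A (poly θ))}
  /-- index type of the matrices over `D` -/
  idx : ℕ → Type
  [fintype_idx : ∀ s, Fintype (idx s)]
  [decidableEq_idx : ∀ s, DecidableEq (idx s)]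
  card_idx : ∀ s, Fintype.card (idx s) = mult * s
  /-- the embedding of complex matrices -/
  emb : ∀ s, Matrix (Fin s) (Fin s) ℂ →ₐ[ℝ] Matrix (idx s) (idx s) D
  emb_injective : ∀ s, Injective (emb s)
  exists_emb_eq : ∀ s x, Commute x (emb s (imUnit s)) → ∃ b, emb s b = x
  -- Two reasons why matrices anticommuting with the complex structure cause no trouble: for nonzero
  -- frequencies they are commutators (the real and quaternionic models), and in the complex model
  -- there are none besides zero.
  freq_ne_zero_or : (∀ θ ∈ freq, θ ≠ 0) ∨
    ∀ s x, x * emb s (imUnit s) = -(emb s (imUnit s) * x) → x = 0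
  isNilpotent_poly : ∀ s, ∀ θ ∈ freq, ∀ b, IsNilpotent (b - θ • imUnit s) →
    IsNilpotent (aeval (emb s b) (poly θ))
  -- The restriction to `b` near `b₀` matters: `X² + θ²` does not distinguish `iθ` from `-iθ`, but
  -- near `b₀` only one of the two can be an eigenvalue of `b`.
  isNilpotent_of_poly : ∀ s, ∀ θ₀ ∈ freq, ∀ b₀, IsNilpotent (b₀ - θ₀ • imUnit s) →
    ∀ᶠ b in 𝓝 b₀, ∀ θ ∈ freq, IsNilpotent (aeval (emb s b) (poly θ)) →
      IsNilpotent (b - θ • imUnit s)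
  exists_emb_conj : ∀ (α : ℕ) (a : Matrix (Fin α) (Fin α) D), ∀ θ ∈ freq,
    IsNilpotent (aeval a (poly θ)) → ∃ (s : ℕ) (b : Matrix (Fin s) (Fin s) ℂ)
      (g : Matrix (Fin α) (idx s) D) (k : Matrix (idx s) (Fin α) D), g * k = 1 ∧ k * g = 1 ∧
      IsNilpotent (b - θ • imUnit s) ∧ a = g * emb s b * k

attribute [instance] FrequencyModel.fintype_idx FrequencyModel.decidableEq_idx

/-! ### Complex matrices with a single imaginary eigenvalue -/

section Frequency

variable (s : ℕ)

/-- The frequency of a complex matrix with a single eigenvalue. -/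
noncomputable def meanFreq : Matrix (Fin s) (Fin s) ℂ →ₗ[ℝ] ℝ :=
  (s : ℝ)⁻¹ • Complex.imLm ∘ₗ (Matrix.traceLinearMap (Fin s) ℂ ℂ).restrictScalars ℝ

theorem meanFreq_apply (b : Matrix (Fin s) (Fin s) ℂ) :
    meanFreq s b = (s : ℝ)⁻¹ * b.trace.im := rfl

variable {s}

theorem meanFreq_imUnit (hs : s ≠ 0) : meanFreq s (imUnit s) = 1 := by
  rw [meanFreq_apply, imUnit, Matrix.trace_smul, Matrix.trace_one, Fintype.card_fin]
  simp [hs]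

theorem meanFreq_of_isNilpotent {b : Matrix (Fin s) (Fin s) ℂ} (hb : IsNilpotent b) :
    meanFreq s b = 0 := by
  rw [meanFreq_apply, (Matrix.isNilpotent_trace_of_isNilpotent hb).eq_zero]
  simp

theorem ConjRel.meanFreq_eq {b c : Matrix (Fin s) (Fin s) ℂ} (h : ConjRel b c) :
    meanFreq s b = meanFreq s c := by
  obtain ⟨g, k, -, h2, rfl⟩ := h
  rw [meanFreq_apply, meanFreq_apply, mul_assoc, Matrix.trace_mul_comm, mul_assoc, h2, mul_one]

theorem meanFreq_eq_of_isNilpotent (hs : s ≠ 0) {b : Matrix (Fin s) (Fin s) ℂ} {θ : ℝ}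
    (hb : IsNilpotent (b - θ • imUnit s)) : meanFreq s b = θ := by
  have := meanFreq_of_isNilpotent hb
  rw [map_sub, map_smul, meanFreq_imUnit hs, smul_eq_mul, mul_one, sub_eq_zero] at this
  exact this

theorem commute_imUnit (b : Matrix (Fin s) (Fin s) ℂ) : Commute b (imUnit s) :=
  (Commute.one_right b).smul_right _

theorem imUnit_mul_imUnit : imUnit s * imUnit s = -1 := by
  rw [imUnit, smul_mul_smul_comm, Complex.I_mul_I, one_mul, neg_smul, one_smul]

/-- The complex matrices with a single, purely imaginary eigenvalue, whose imaginary part belongs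
to `S`. -/
def imNilpotent (s : ℕ) (S : Set ℝ) : Set (Matrix (Fin s) (Fin s) ℂ) :=
  {b | meanFreq s b ∈ S ∧ IsNilpotent (b - meanFreq s b • imUnit s)}

theorem stableRank_zero_iff {D n : Type*} [NormedDivisionRing D] [NormedAlgebra ℝ D]
    [FiniteDimensional ℝ D] [Fintype n] [DecidableEq n] {A : Matrix n n D} :
    StableRank A 0 ↔ IsNilpotent A := by
  simp only [StableRank, hasRank_zero_iff]
  constructor
  · exact fun h => h.exists
  · rintro ⟨N, hN⟩
    filter_upwards [eventually_ge_atTop N] with M hM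
    exact pow_eq_zero_of_le hM hN

attribute [local instance] Matrix.linftyOpNormedAddCommGroup Matrix.linftyOpNormedSpace
  Matrix.linftyOpNormedRing Matrix.linftyOpNormedAlgebra

/-- The nilpotent matrices, of codimension at least `2s`, lie in the hyperplane `meanFreq = 0`.
Adding the line of real multiples of `i` lowers the codimension by one. -/
theorem hasStrat_imNilpotent (hs : s ≠ 0) {S : Set ℝ} (hS : IsOpen S)
    (hpos : ∀ θ : ℝ, 0 < θ → θ ∈ S) :
    HasStrat ConjRel (fun L => {b | L < meanFreq s b}) (imNilpotent s S) (2 * s - 1) 1 := by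
  have h0 := hasStrat_stableRank (D := ℂ) (Nat.zero_le s)
  rw [Complex.finrank_real_complex, Nat.sub_zero, show 2 * s = 2 * s - 1 + 1 by omega] at h0
  let l : Matrix (Fin s) (Fin s) ℂ →L[ℝ] ℝ := LinearMap.toContinuousLinearMap (meanFreq s)
  have := h0.add_line l (v := imUnit s) (meanFreq_imUnit hs)
    (fun x hx => meanFreq_of_isNilpotent (stableRank_zero_iff.1 hx)) ?_ hS
    (w' := fun L => {b | L < meanFreq s b}) ?_
  · convert this using 1
    ext b
    exact and_congr_right fun _ => (stableRank_zero_iff (D := ℂ)).symm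
  · intro x y hxy
    have e : l x = l y := hxy.meanFreq_eq
    refine ⟨e, ?_⟩
    have e' := hxy.meanFreq_eq
    obtain ⟨g, k, h1, h2, rfl⟩ := hxy
    refine ⟨g, k, h1, h2, ?_⟩
    change g * x * k - meanFreq s (g * x * k) • imUnit s = g * (x - meanFreq s x • imUnit s) * k
    rw [← e', mul_sub, sub_mul, mul_smul_comm, (commute_imUnit g).eq, smul_mul_assoc, mul_assoc _ g,
      h1, mul_one]
  · intro t
    -- Adding `σ • i` to a nilpotent matrix gives mean frequency `σ`; this value exceeds `t` and is
    -- positive, hence admissible.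
    refine ⟨0, fun x hx _ => ⟨max t 0 + 1, hpos _ (by positivity), ?_⟩⟩
    have hx0 := meanFreq_of_isNilpotent (stableRank_zero_iff.1 hx)
    simp only [Set.mem_ofPred_eq]
    rw [map_add, map_smul, hx0, meanFreq_imUnit hs, smul_eq_mul, mul_one, zero_add]
    exact (le_max_left t 0).trans_lt (lt_add_one _)

end Frequency

/-! ### Spectral data of block matrices -/

section Blocks

variable {D : Type*} [NormedDivisionRing D] [NormedAlgebra ℝ D] [FiniteDimensional ℝ D]
  {K : Type*} [Field K] [Algebra K D]
variable {n p q : Type*} [Fintype n] [Fintype p] [Fintype q]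
  [DecidableEq n] [DecidableEq p] [DecidableEq q]
variable {Q : Matrix n p D} {s : Matrix p n D} {Q' : Matrix n q D} {s' : Matrix q n D}

theorem IsSplit.aeval_blockDiag (h : IsSplit Q s Q' s') (a : Matrix p p D) (c : Matrix q q D)
    (f : K[X]) : aeval (h.blockDiag ℝ (a, c)) f = h.blockDiag ℝ (aeval a f, aeval c f) := by
  change aeval (h.blockDiag K (a, c)) f = h.blockDiag K (aeval a f, aeval c f)
  rw [aeval_algHom_apply]
  congr 1
  ext1
  · exact (aeval_algHom_apply (AlgHom.fst K _ _) (a, c) f).symm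
  · exact (aeval_algHom_apply (AlgHom.snd K _ _) (a, c) f).symm

theorem ConjRel.aeval {A B : Matrix n n D} (h : ConjRel A B) (f : K[X]) :
    ConjRel (aeval A f) (aeval B f) := by
  obtain ⟨g, k, h1, h2, rfl⟩ := h
  refine ⟨g, k, h1, h2, ?_⟩
  have := aeval_mul_eq_of_intertwine (a := g * A * k) (c := A) (X := g)
    (by rw [mul_assoc _ k, h2, mul_one]) f
  rw [← this, mul_assoc (Polynomial.aeval _ f), h1, mul_one]

theorem ConjRel.isUnit {R : Type*} [Monoid R] {A B : R} (h : ConjRel A B) (hA : IsUnit A) :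
    IsUnit B := by
  obtain ⟨g, k, h1, h2, rfl⟩ := h
  exact ((IsUnit.mul ⟨⟨g, k, h1, h2⟩, rfl⟩ hA).mul ⟨⟨k, g, h2, h1⟩, rfl⟩)

theorem conj_mem_singleton_zero : ∀ z ∈ ({0} : Set ℂ), conj z ∈ ({0} : Set ℂ) := by simp

theorem spectrumFree_zero_iff {A : Matrix n n D} : SpectrumFree {0} A ↔ IsUnit A := by
  simp [SpectrumFree, aeval_conjQuad]

theorem spectralRank_zero_card_iff {A : Matrix n n D} :
    SpectralRank {0} A (Fintype.card n) ↔ IsNilpotent A := by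
  constructor
  · rintro ⟨e, he, hr⟩
    obtain ⟨Q, s, Q', s', h, rfl⟩ := exists_isSplit_of_idem (k := 0) he.1 hr (by simp)
    have h1 : Q * s = 1 := by
      rw [← h.add_eq, show Q' * s' = 0 by ext i j; simp [Matrix.mul_apply], add_zero]
    obtain ⟨-, -, ⟨u, hu, hue⟩, -⟩ := he
    obtain ⟨c, N, hc, rfl⟩ := exists_eq_C_mul_X_pow hu
    rw [h1, mul_one, map_mul, aeval_C, map_pow, aeval_X, ← Algebra.smul_def] at hue
    exact ⟨N, (smul_eq_zero.1 hue).resolve_left hc⟩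
  · rintro ⟨N, hN⟩
    exact spectralRank_card (f := X ^ N) (fun z hz => by simp at hz; simpa using hz.1)
      (by simpa using hN)

theorem IsSplit.isSpectralIdem (h : IsSplit Q s Q' s') {a : Matrix p p D} {c : Matrix q q D}
    (ha : IsNilpotent a) (hc : IsUnit c) : IsSpectralIdem {0} (h.blockDiag ℝ (a, c)) (Q * s) := by
  have h1 : IsSpectralIdem {0} a (1 : Matrix p p D) := by
    obtain ⟨N, hN⟩ := ha
    exact ⟨one_mul 1, Commute.one_right a,
      ⟨X ^ N, fun z hz => by simp at hz; simpa using hz.1, by simpa using hN⟩,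
      ⟨1, fun z _ => by simp, by simp⟩⟩
  have h2 : IsSpectralIdem {0} c (0 : Matrix q q D) :=
    (isSpectralIdem_zero_iff conj_mem_singleton_zero).2 (spectrumFree_zero_iff.2 hc)
  have := (h1.prod h2).map (h.blockDiag ℝ)
  rw [h.blockDiag_apply (K := ℝ) ((1 : Matrix p p D), (0 : Matrix q q D))] at this
  simpa using this

theorem IsSplit.blockDiag_swap (h : IsSplit Q s Q' s') (x : Matrix p p D × Matrix q q D) :
    h.swap.blockDiag K x.swap = h.blockDiag K x := by
  simp only [blockDiag_apply, Prod.fst_swap, Prod.snd_swap]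
  rw [add_comm]

end Blocks

/-! ### Peeling off the largest frequency -/

namespace FrequencyModel

variable {D K : Type*} [NormedDivisionRing D] [NormedAlgebra ℝ D]
    [FiniteDimensional ℝ D] [Field K] [Algebra K D] (F : FrequencyModel D K)

theorem emb_imUnit_mul_self (s : ℕ) : F.emb s (imUnit s) * F.emb s (imUnit s) = -1 := by
  rw [← map_mul, imUnit_mul_imUnit, map_neg, map_one]

variable {F} {s : ℕ} {θ : ℝ} {b : Matrix (Fin s) (Fin s) ℂ}

theorem emb_eq (F : FrequencyModel D K) (b : Matrix (Fin s) (Fin s) ℂ) (θ : ℝ) :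
    F.emb s b = θ • F.emb s (imUnit s) + F.emb s (b - θ • imUnit s) := by
  rw [← map_smul, ← map_add, add_sub_cancel]

theorem commute_emb_imUnit (F : FrequencyModel D K) (b : Matrix (Fin s) (Fin s) ℂ) :
    Commute (F.emb s b) (F.emb s (imUnit s)) := (commute_imUnit b).map (F.emb s)

theorem exists_commutator_add_emb (hθ : θ ∈ F.freq) (hb : IsNilpotent (b - θ • imUnit s))
    (x : Matrix (F.idx s) (F.idx s) D) :
    ∃ κ y, x = κ * F.emb s b - F.emb s b * κ + F.emb s y := by
  obtain ⟨h1, h2, h3⟩ := commute_add_anticommute (F.emb_imUnit_mul_self s) x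
  obtain ⟨y, hy⟩ := F.exists_emb_eq s _ h1
  have : ∃ κ, κ * F.emb s b - F.emb s b * κ =
      (1 / 2 : ℝ) • (x + F.emb s (imUnit s) * x * F.emb s (imUnit s)) := by
    rcases F.freq_ne_zero_or with h | h
    · rw [F.emb_eq b θ]
      exact exists_commutator_of_anticommute (h θ hθ) (F.emb_imUnit_mul_self s)
        (hb.map (F.emb s)) (F.commute_emb_imUnit _) h2
    · exact ⟨0, by rw [h s _ h2]; simp⟩
  obtain ⟨κ, hκ⟩ := this
  exact ⟨κ, y, by rw [hκ, hy, add_comm]; exact h3⟩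

theorem commute_imUnit_of_intertwine {b' : Matrix (Fin s) (Fin s) ℂ} (hθ : θ ∈ F.freq)
    (hb : IsNilpotent (b - θ • imUnit s)) (hb' : IsNilpotent (b' - θ • imUnit s))
    {g : Matrix (F.idx s) (F.idx s) D} (hg : g * F.emb s b = F.emb s b' * g) :
    Commute g (F.emb s (imUnit s)) := by
  obtain ⟨h1, h2, h3⟩ := commute_add_anticommute (F.emb_imUnit_mul_self s) g
  have h0 : (1 / 2 : ℝ) • (g + F.emb s (imUnit s) * g * F.emb s (imUnit s)) = 0 := by
    rcases F.freq_ne_zero_or with h | h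
    · refine eq_zero_of_anticommute (h θ hθ) (F.emb_imUnit_mul_self s)
        (hb.map (F.emb s)) (hb'.map (F.emb s)) (F.commute_emb_imUnit _) h2 ?_
      rw [← F.emb_eq, ← F.emb_eq, smul_mul_assoc, mul_smul_comm, add_mul, mul_add, hg, mul_assoc,
        ← (F.commute_emb_imUnit b).eq, mul_assoc, ← mul_assoc g, hg, ← mul_assoc, ← mul_assoc,
        ← mul_assoc, ← mul_assoc, (F.commute_emb_imUnit b').eq]
    · exact h s _ h2
  rw [h0, add_zero] at h3
  rw [h3]; exact h1

/-- A conjugating matrix over `D` has no part anticommuting with the complex structure, by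
`commute_imUnit_of_intertwine`. It commutes with the embedded `i` and is therefore itself an
embedded complex matrix. -/
theorem conjRel_of_emb {b' : Matrix (Fin s) (Fin s) ℂ} (hθ : θ ∈ F.freq)
    (hb : IsNilpotent (b - θ • imUnit s)) (hb' : IsNilpotent (b' - θ • imUnit s))
    (h : ConjRel (F.emb s b) (F.emb s b')) : ConjRel b b' := by
  obtain ⟨g, k, h1, h2, h3⟩ := h
  have hg : g * F.emb s b = F.emb s b' * g := by rw [h3, mul_assoc _ k, h2, mul_one]
  have hk : k * F.emb s b' = F.emb s b * k := by
    rw [h3, ← mul_assoc, ← mul_assoc, h2, one_mul]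
  obtain ⟨x, rfl⟩ := F.exists_emb_eq s g (commute_imUnit_of_intertwine hθ hb hb' hg)
  obtain ⟨y, rfl⟩ := F.exists_emb_eq s k (commute_imUnit_of_intertwine hθ hb' hb hk)
  refine ⟨x, y, F.emb_injective s ?_, F.emb_injective s ?_, F.emb_injective s ?_⟩
  · rw [map_mul, map_one, h1]
  · rw [map_mul, map_one, h2]
  · rw [map_mul, map_mul, h3]

theorem spectralRank_emb (hθ : θ ∈ F.freq) (hb : IsNilpotent (b - θ • imUnit s)) :
    SpectralRank imAxis (F.emb s b) (F.mult * s) := by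
  obtain ⟨N, hN⟩ := F.isNilpotent_poly s θ hθ b hb
  obtain ⟨B, hB, hBe⟩ := F.exists_poly_mul _ (F.emb s b) θ
  rw [← F.card_idx s]
  refine spectralRank_card (f := conjQuad (θ * Complex.I) ^ N) (fun z hz => ?_) ?_
  · rw [map_pow] at hz
    have := eq_zero_of_pow_eq_zero hz
    rw [aeval_conjQuad_complex, mul_eq_zero, sub_eq_zero, sub_eq_zero] at this
    rcases this with h | h <;> simp [h, imAxis]
  · rw [map_pow, hBe, hB.mul_pow, hN, mul_zero]

theorem isUnit_aeval_emb (hθ : θ ∈ F.freq) (hb : IsNilpotent (b - θ • imUnit s)) {θ' : ℝ}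
    (hθ' : θ' ∈ F.closedFreq) (hne : θ' ≠ θ) : IsUnit (aeval (F.emb s b) (F.poly θ')) :=
  isUnit_aeval_of_isCoprime (F.isCoprime_poly _ hθ' _ (F.freq_subset hθ) hne)
    (F.isNilpotent_poly s θ hθ b hb)

/-- `A` is the direct sum of the matrix of `x.1` and of `x.2`. -/
def Decomp (F : FrequencyModel D K) {m s k : ℕ} (A : Matrix (Fin m) (Fin m) D)
    (x : Matrix (Fin s) (Fin s) ℂ × Matrix (Fin k) (Fin k) D) : Prop :=
  ∃ (Q : Matrix (Fin m) (F.idx s) D) (S : Matrix (F.idx s) (Fin m) D)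
    (Q' : Matrix (Fin m) (Fin k) D) (S' : Matrix (Fin k) (Fin m) D) (h : IsSplit Q S Q' S'),
    A = h.blockDiag ℝ (F.emb s x.1, x.2)

/-- Pairs consisting of a part with a single frequency and of a part all of whose frequencies are
smaller. -/
def topPairs (F : FrequencyModel D K) (s k r : ℕ) :
    Set (Matrix (Fin s) (Fin s) ℂ × Matrix (Fin k) (Fin k) D) :=
  (imNilpotent s F.freq ×ˢ {c | SpectralRank imAxis c r}) ∩
    {x | ∀ θ, meanFreq s x.1 ≤ θ → IsUnit (aeval x.2 (F.poly θ))}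

variable {m k r : ℕ} {A : Matrix (Fin m) (Fin m) D}
  {x : Matrix (Fin s) (Fin s) ℂ × Matrix (Fin k) (Fin k) D}

theorem Decomp.spectralRank (hx : x ∈ F.topPairs s k r) (h : F.Decomp A x) :
    SpectralRank imAxis A (F.mult * s + r) := by
  obtain ⟨Q, S, Q', S', h, rfl⟩ := h
  exact (spectralRank_emb hx.1.1.1 hx.1.1.2).blockDiag h hx.1.2

theorem Decomp.isUnit (hx : x ∈ F.topPairs s k r) (h : F.Decomp A x) {θ : ℝ}
    (hθ : meanFreq s x.1 < θ) : IsUnit (aeval A (F.poly θ)) := by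
  obtain ⟨Q, S, Q', S', h, rfl⟩ := h
  rw [h.aeval_blockDiag, h.isUnit_blockDiag_iff]
  exact ⟨isUnit_aeval_emb hx.1.1.1 hx.1.1.2
    (F.freq_subset (F.mem_freq_of_le _ hx.1.1.1 _ hθ.le)) hθ.ne', hx.2 θ hθ.le⟩

theorem Decomp.not_isUnit (hs : s ≠ 0) (hx : x ∈ F.topPairs s k r) (h : F.Decomp A x) :
    ¬ IsUnit (aeval A (F.poly (meanFreq s x.1))) := by
  obtain ⟨Q, S, Q', S', h, rfl⟩ := h
  rw [h.aeval_blockDiag, h.isUnit_blockDiag_iff]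
  rintro ⟨h1, -⟩
  have : Nonempty (F.idx s) := Fintype.card_pos_iff.1 (by
    rw [F.card_idx]; exact Nat.mul_pos F.mult_pos (Nat.pos_of_ne_zero hs))
  exact (F.isNilpotent_poly s _ hx.1.1.1 _ hx.1.1.2).not_isUnit h1

theorem Decomp.isSpectralIdem (hx : x ∈ F.topPairs s k r)
    {Q : Matrix (Fin m) (F.idx s) D} {S : Matrix (F.idx s) (Fin m) D}
    {Q' : Matrix (Fin m) (Fin k) D} {S' : Matrix (Fin k) (Fin m) D} (h : IsSplit Q S Q' S') :
    IsSpectralIdem {0} (aeval (h.blockDiag ℝ (F.emb s x.1, x.2)) (F.poly (meanFreq s x.1)))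
      (Q * S) := by
  rw [h.aeval_blockDiag]
  exact h.isSpectralIdem (F.isNilpotent_poly s _ hx.1.1.1 _ hx.1.1.2) (hx.2 _ le_rfl)

theorem Decomp.spectralRank_aeval (hx : x ∈ F.topPairs s k r) (h : F.Decomp A x) :
    SpectralRank {0} (aeval A (F.poly (meanFreq s x.1))) (F.mult * s) := by
  obtain ⟨Q, S, Q', S', h, rfl⟩ := h
  exact ⟨_, Decomp.isSpectralIdem hx h,
    IsRankFactorization.hasRank ⟨⟨S, h.s_mul_Q⟩, ⟨Q, h.s_mul_Q⟩, rfl⟩ (F.card_idx s)⟩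

/-- The top frequency is intrinsic: it is the largest `θ` at which `F.poly θ` fails to be invertible
on `A`. -/
theorem Decomp.meanFreq_eq {s' k' r' : ℕ} (hs : s ≠ 0) (hs' : s' ≠ 0)
    {y : Matrix (Fin s') (Fin s') ℂ × Matrix (Fin k') (Fin k') D}
    (hx : x ∈ F.topPairs s k r) (hy : y ∈ F.topPairs s' k' r') (h : F.Decomp A x)
    (h' : F.Decomp A y) : meanFreq s x.1 = meanFreq s' y.1 := by
  rcases lt_trichotomy (meanFreq s x.1) (meanFreq s' y.1) with hlt | he | hlt
  · exact absurd (h.isUnit hx hlt) (h'.not_isUnit hs' hy)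
  · exact he
  · exact absurd (h'.isUnit hy hlt) (h.not_isUnit hs hx)

theorem Decomp.eq {s' k' r' : ℕ} (hs : s ≠ 0) (hs' : s' ≠ 0)
    {y : Matrix (Fin s') (Fin s') ℂ × Matrix (Fin k') (Fin k') D}
    (hx : x ∈ F.topPairs s k r) (hy : y ∈ F.topPairs s' k' r') (h : F.Decomp A x)
    (h' : F.Decomp A y) : s = s' := by
  have h1 := h.spectralRank_aeval hx
  have h2 := h'.spectralRank_aeval hy
  rw [← Decomp.meanFreq_eq hs hs' hx hy h h'] at h2
  exact Nat.eq_of_mul_eq_mul_left F.mult_pos (h1.unique h2)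

theorem Decomp.conjRel (hs : s ≠ 0) {y : Matrix (Fin s) (Fin s) ℂ × Matrix (Fin k) (Fin k) D}
    (hx : x ∈ F.topPairs s k r) (hy : y ∈ F.topPairs s k r) (h : F.Decomp A x)
    (h' : F.Decomp A y) : ConjRel x.1 y.1 ∧ ConjRel x.2 y.2 := by
  have hθ := Decomp.meanFreq_eq hs hs hx hy h h'
  obtain ⟨Q, S, Q', S', h, hA⟩ := h
  obtain ⟨Q₁, S₁, Q₁', S₁', h₁, hA₁⟩ := h'
  have e1 := Decomp.isSpectralIdem hx h
  have e2 := Decomp.isSpectralIdem hy h₁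
  rw [← hA] at e1
  rw [← hA₁, ← hθ] at e2
  have e := e1.unique e2
  have hxy := hA.symm.trans hA₁
  refine ⟨conjRel_of_emb hx.1.1.1 hx.1.1.2 (by rw [hθ]; exact hy.1.1.2)
    (h.conj_of_eq h₁ e hxy), ?_⟩
  refine h.swap.conj_of_eq (K := ℝ) h₁.swap (x := (x.2, F.emb s x.1)) (y := (y.2, F.emb s y.1))
    ?_ ?_
  · have e1 := h.add_eq
    rw [← h₁.add_eq, e] at e1
    exact add_left_cancel e1
  · exact (h.blockDiag_swap (F.emb s x.1, x.2)).trans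
      (hxy.trans (h₁.blockDiag_swap (F.emb s y.1, y.2)).symm)

theorem Decomp.of_conjRel {B : Matrix (Fin m) (Fin m) D} (h : F.Decomp A x) (hAB : ConjRel A B) :
    F.Decomp B x := by
  obtain ⟨Q, S, Q', S', h, rfl⟩ := h
  obtain ⟨g, l, h1, h2, rfl⟩ := hAB
  exact ⟨_, _, _, _, h.conj h1 h2, (h.blockDiag_conj h1 h2 _).symm⟩

theorem exists_decomp (F : FrequencyModel D K) {m s k : ℕ} (hm : m = F.mult * s + k)
    (x : Matrix (Fin s) (Fin s) ℂ × Matrix (Fin k) (Fin k) D) :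
    ∃ A : Matrix (Fin m) (Fin m) D, F.Decomp A x := by
  have e : F.idx s ⊕ Fin k ≃ Fin m := Fintype.equivFinOfCardEq (by simp [F.card_idx, hm])
  exact ⟨_, _, _, _, _, isSplit_of_equiv e, rfl⟩

/-- Only finitely many frequencies occur, so there is a largest one. The Fitting decomposition for
its polynomial isolates that part, which `exists_emb_conj` identifies with a complex matrix. -/
theorem exists_decomp_of_spectralRank (hA : SpectralRank imAxis A r)
    (h : ¬ ∀ θ ∈ F.freq, IsUnit (aeval A (F.poly θ))) :
    ∃ s, s ≠ 0 ∧ F.mult * s ≤ r ∧ ∃ x ∈ F.topPairs s (m - F.mult * s) (r - F.mult * s),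
      F.Decomp A x := by
  have hfin : {θ ∈ F.freq | ¬ IsUnit (aeval A (F.poly θ))}.Finite := by
    refine Set.Finite.of_injOn (f := fun θ : ℝ => (θ * Complex.I : ℂ)) ?_ ?_
      (finite_setOf_not_isUnit_conjQuad A)
    · rintro θ ⟨-, hθ⟩ hu
      apply hθ
      obtain ⟨B, hB, hBe⟩ := F.exists_poly_mul _ A θ
      rw [hBe] at hu
      exact (hB.isUnit_mul_iff.1 hu).2
    · intro θ _ θ' _ he
      simpa using he
  push Not at h
  obtain ⟨θ, ⟨hθ, hθu⟩, hmax⟩ := hfin.exists_maximal (by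
    obtain ⟨θ, h1, h2⟩ := h
    exact ⟨θ, h1, h2⟩)
  have hmax' : ∀ θ', θ < θ' → IsUnit (aeval A (F.poly θ')) := by
    intro θ' hlt
    by_contra hn
    exact absurd (hmax ⟨F.mem_freq_of_le θ hθ θ' hlt.le, hn⟩ hlt.le) (not_le.2 hlt)
  obtain ⟨α, k, Q, S, Q', S', h, a, c, hm, hA', ha, hc⟩ := exists_fitting A (F.poly θ)
  obtain ⟨s, b, g, l, hgl, hlg, hb, rfl⟩ := F.exists_emb_conj α a θ hθ ha
  have hα : α = F.mult * s := by
    rw [← F.card_idx s]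
    let e := Fintype.equivFin (F.idx s)
    apply le_antisymm
    · refine le_of_mul_eq_one (D := D) (l.submatrix e.symm id) (g.submatrix id e.symm) ?_
      rw [mul_submatrix_equiv, hgl]
    · refine le_of_mul_eq_one (D := D) (g.submatrix id e.symm) (l.submatrix e.symm id) ?_
      rw [← Matrix.submatrix_mul _ _ e.symm id e.symm bijective_id, hlg,
        Matrix.submatrix_one _ e.symm.injective]
  subst hα
  obtain rfl : k = m - F.mult * s := by omega
  have hs : s ≠ 0 := by
    rintro rfl
    apply hθu
    rw [hA', ← h.blockDiag_apply (K := ℝ) (_, _), h.aeval_blockDiag, h.isUnit_blockDiag_iff]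
    exact ⟨⟨⟨1, 1, mul_one _, mul_one _⟩, by ext i; exact absurd i.2 (by simp)⟩, hc⟩
  have h' : IsSplit (Q * g) (l * S) Q' S' := by
    refine ⟨?_, h.s'_mul_Q', ?_, ?_, ?_⟩
    · rw [Matrix.mul_assoc, ← Matrix.mul_assoc S, h.s_mul_Q, Matrix.one_mul, hlg]
    · rw [Matrix.mul_assoc, h.s_mul_Q', Matrix.mul_zero]
    · rw [← Matrix.mul_assoc, h.s'_mul_Q, Matrix.zero_mul]
    · rw [Matrix.mul_assoc, ← Matrix.mul_assoc g, hgl, Matrix.one_mul, h.add_eq]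
  have hA'' : A = h'.blockDiag ℝ (F.emb s b, c) := by
    rw [hA', h'.blockDiag_apply]
    simp only [Matrix.mul_assoc]
  have hmean := meanFreq_eq_of_isNilpotent hs hb
  obtain ⟨hle, hcr⟩ := SpectralRank.of_blockDiag conj_mem_imAxis h' (hA'' ▸ hA)
    (spectralRank_emb hθ hb)
  refine ⟨s, hs, hle, (b, c), ⟨⟨⟨?_, ?_⟩, hcr⟩, ?_⟩, _, _, _, _, h', hA''⟩
  · rw [hmean]; exact hθ
  · rw [hmean]; exact hb
  · intro θ' hθ'
    dsimp only at hθ' ⊢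
    rw [hmean] at hθ'
    rcases hθ'.eq_or_lt with rfl | hlt
    · exact hc
    · have := hmax' θ' hlt
      rw [hA'', h'.aeval_blockDiag, h'.isUnit_blockDiag_iff] at this
      exact this.2

attribute [local instance] Matrix.linftyOpNormedAddCommGroup Matrix.linftyOpNormedSpace
  Matrix.linftyOpNormedRing Matrix.linftyOpNormedAlgebra

/-- Leaves a gap `[δ, θ₀]` below the top frequency which the second block avoids, uniformly near
`c`. -/
theorem exists_forall_isUnit_of_le (F : FrequencyModel D K) {θ₀ : ℝ} {c : Matrix (Fin k) (Fin k) D}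
    (h : ∀ θ, θ₀ ≤ θ → IsUnit (aeval c (F.poly θ))) :
    ∃ δ < θ₀, ∀ᶠ c' in 𝓝 c, ∀ θ, δ ≤ θ → IsUnit (aeval c' (F.poly θ)) := by
  obtain ⟨ε, hε, hball⟩ := Metric.isOpen_iff.1 (F.isOpen_setOf_isUnit _ c) θ₀ (h θ₀ le_rfl)
  refine ⟨θ₀ - ε / 2, by linarith, ?_⟩
  have := (F.isOpen_setOf_forall_isUnit (Fin k) (Set.Ici (θ₀ - ε / 2)) isClosed_Ici).mem_nhds
    (x := c) ?_
  · exact this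
  · intro θ hθ
    rw [Set.mem_Ici] at hθ
    rcases le_or_gt θ₀ θ with h1 | h1
    · exact h θ h1
    · apply hball
      rw [Metric.mem_ball, Real.dist_eq, abs_lt]
      constructor <;> linarith

theorem isOpen_setOf_forall_meanFreq_le (F : FrequencyModel D K) (s k : ℕ) :
    IsOpen {x : Matrix (Fin s) (Fin s) ℂ × Matrix (Fin k) (Fin k) D |
      ∀ θ, meanFreq s x.1 ≤ θ → IsUnit (aeval x.2 (F.poly θ))} := by
  rw [isOpen_iff_eventually]
  rintro ⟨b, c⟩ hbc
  obtain ⟨δ, hδ, hev⟩ := F.exists_forall_isUnit_of_le hbc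
  have h1 : ∀ᶠ x : Matrix (Fin s) (Fin s) ℂ × Matrix (Fin k) (Fin k) D in 𝓝 (b, c),
      δ < meanFreq s x.1 := by
    have hc : Continuous (meanFreq s) := LinearMap.continuous_of_finiteDimensional _
    exact (hc.comp continuous_fst).continuousAt.eventually (lt_mem_nhds hδ)
  have h2 : ∀ᶠ x : Matrix (Fin s) (Fin s) ℂ × Matrix (Fin k) (Fin k) D in 𝓝 (b, c),
      ∀ θ, δ ≤ θ → IsUnit (aeval x.2 (F.poly θ)) :=
    continuous_snd.continuousAt.eventually hev
  filter_upwards [h1, h2] with x hx1 hx2 θ hθ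
  exact hx2 θ (hx1.le.trans hθ)

/-- The retraction comes from block conjugation. The point is that any decomposition `y` of a nearby
`B` agrees with the block form given by `f B`: its top frequency cannot come from the second block,
so the whole first block must sit at that single frequency. -/
theorem exists_local_decomp (F : FrequencyModel D K) (hs : s ≠ 0) (hx : x ∈ F.topPairs s k r)
    (h : F.Decomp A x) :
    ∃ f : Matrix (Fin m) (Fin m) D → Matrix (Fin s) (Fin s) ℂ × Matrix (Fin k) (Fin k) D,
      ContDiffAt ℝ ω f A ∧ f A = x ∧ Surjective (fderiv ℝ f A) ∧
      ∀ᶠ B in 𝓝 A, ((∃ y ∈ F.topPairs s k r, F.Decomp B y) → f B ∈ F.topPairs s k r) ∧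
        F.Decomp B (f B) := by
  obtain ⟨b₀, c₀⟩ := x
  obtain ⟨Q, S, Q', S', h, rfl⟩ := h
  obtain ⟨⟨⟨hb1, hb2⟩, hc⟩, hO⟩ := hx
  dsimp only at hb1 hb2 hc hO ⊢
  set θ₀ := meanFreq s b₀ with hθ₀
  have hnil := F.isNilpotent_poly s _ hb1 _ hb2
  have hunit := hO θ₀ le_rfl
  dsimp only at hunit
  obtain ⟨f, hf, hf0, hfs, hconj⟩ := h.exists_local_retraction (F.emb s).toLinearMap
    (F.emb_injective s) b₀ c₀ (fun y => exists_commutator_add_emb hb1 hb2 y)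
    (fun X hX => eq_zero_of_intertwine hnil hunit hX)
    (fun X hX => eq_zero_of_intertwine' hnil hunit hX)
  simp only [AlgHom.toLinearMap_apply] at hf hf0 hfs hconj
  refine ⟨f, hf, hf0, hfs, ?_⟩
  obtain ⟨δ, hδ, hev⟩ := F.exists_forall_isUnit_of_le hO
  have t1 : Tendsto (fun B => (f B).1) (𝓝 (h.blockDiag ℝ (F.emb s b₀, c₀))) (𝓝 b₀) := by
    have := hf.continuousAt.fst.tendsto
    rwa [hf0] at this
  have t2 : Tendsto (fun B => (f B).2) (𝓝 (h.blockDiag ℝ (F.emb s b₀, c₀))) (𝓝 c₀) := by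
    have := hf.continuousAt.snd.tendsto
    rwa [hf0] at this
  have E3 := t2.eventually hev
  have E2 := t2.eventually ((isOpen_spectralRank_le (n := Fin k) (D := D) conj_mem_imAxis
    isClosed_imAxis r).mem_nhds ⟨r, le_rfl, hc⟩)
  have E5 := t1.eventually (F.isNilpotent_of_poly s _ hb1 _ hb2)
  have E4 : ∀ᶠ B in 𝓝 (h.blockDiag ℝ (F.emb s b₀, c₀)), ∀ θ ∈ F.closedFreq ∩ Set.Iic δ,
      IsUnit (aeval (F.emb s (f B).1) (F.poly θ)) := by
    have hce : Continuous (F.emb s).toLinearMap := LinearMap.continuous_of_finiteDimensional _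
    refine ((hce.tendsto b₀).comp t1).eventually
      ((F.isOpen_setOf_forall_isUnit (F.idx s) _ (F.isClosed_closedFreq.inter
        isClosed_Iic)).mem_nhds ?_)
    rintro θ ⟨hθ1, hθ2⟩
    exact isUnit_aeval_emb hb1 hb2 hθ1 (lt_of_le_of_lt hθ2 hδ).ne
  filter_upwards [hconj, E2, E3, E4, E5] with B g1 g2 g3 g4 g5
  refine ⟨?_, Decomp.of_conjRel ⟨_, _, _, _, h, rfl⟩ g1⟩
  rintro ⟨y, hy, hBy⟩
  obtain ⟨r₂, hr₂, hcr⟩ := g2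
  obtain ⟨r₁, hr₁⟩ := exists_spectralRank conj_mem_imAxis (F.emb s (f B).1)
  have hle := hr₁.le_card
  rw [F.card_idx] at hle
  have hsum := ((hr₁.blockDiag h hcr).conjRel g1).unique (hBy.spectralRank hy)
  -- Both block ranks are bounded above, by `r` and by the size of the first block, and their sum
  -- equals the sum of the bounds.
  obtain rfl : r₂ = r := by omega
  obtain rfl : r₁ = F.mult * s := by omega
  -- Otherwise the first block would have no frequency at all: none up to `δ` because it is near
  -- `b₀`, and none above because the top frequency of `B` lies below `δ`.
  have hθ : δ ≤ meanFreq s y.1 := by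
    by_contra! hlt
    have hfree : SpectrumFree imAxis (F.emb s (f B).1) := by
      refine F.spectrumFree_of_isUnit _ _ fun θ hθ => ?_
      rcases le_or_gt θ δ with h1 | h1
      · exact g4 θ ⟨hθ, h1⟩
      · have := (g1.symm.aeval (F.poly θ)).isUnit (hBy.isUnit hy (hlt.trans h1))
        rw [h.aeval_blockDiag, h.isUnit_blockDiag_iff] at this
        exact this.1
    have := hr₁.unique ((spectralRank_zero_iff conj_mem_imAxis).2 hfree)
    exact (Nat.mul_pos F.mult_pos (Nat.pos_of_ne_zero hs)).ne' this
  have hnilB : IsNilpotent (aeval (F.emb s (f B).1) (F.poly (meanFreq s y.1))) := by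
    have h1 := (hBy.spectralRank_aeval hy).conjRel (g1.symm.aeval (F.poly (meanFreq s y.1)))
    rw [h.aeval_blockDiag] at h1
    have h2 : SpectralRank {0} (aeval (f B).2 (F.poly (meanFreq s y.1))) 0 :=
      (spectralRank_zero_iff conj_mem_singleton_zero).2 (spectrumFree_zero_iff.2 (g3 _ hθ))
    rw [← h.blockDiag_swap] at h1
    have h3 := (SpectralRank.of_blockDiag conj_mem_singleton_zero h.swap h1 h2).2
    rw [Nat.sub_zero, ← F.card_idx] at h3
    exact spectralRank_zero_card_iff.1 h3
  have hbn := g5 _ hy.1.1.1 hnilB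
  have hmean := meanFreq_eq_of_isNilpotent hs hbn
  refine ⟨⟨⟨?_, ?_⟩, hcr⟩, ?_⟩
  · rw [hmean]; exact hy.1.1.1
  · rw [hmean]; exact hbn
  · intro θ hθ'
    rw [hmean] at hθ'
    exact g3 θ (hθ.trans hθ')

/-- A product, cut by the open condition that the frequency of the first factor exceeds those of the
second. The minimal stratum survives because its first factor contains matrices of arbitrarily large
mean frequency. -/
theorem hasStrat_topPairs (hs : s ≠ 0) {e : ℕ}
    (h : HasStrat ConjRel (fun _ => Set.univ)
      {c : Matrix (Fin k) (Fin k) D | SpectralRank imAxis c r} e 1) :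
    HasStrat (fun x y => ConjRel x.1 y.1 ∧ ConjRel x.2 y.2) (fun _ => Set.univ)
      (F.topPairs s k r) (2 * s - 1 + e) 1 := by
  have h1 := (hasStrat_imNilpotent hs F.isOpen_freq F.mem_freq_of_pos).prod h
    (w₁ := fun _ => {x | ∀ θ, meanFreq s x.1 ≤ θ → IsUnit (aeval x.2 (F.poly θ))}) ?_
  · refine h1.inter_open (F.isOpen_setOf_forall_meanFreq_le s k) ?_
      (fun t => ⟨t, fun x _ hx => ⟨hx, trivial⟩⟩)
    rintro x y ⟨hx1, hx2⟩ hx θ hθ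
    exact (hx2.aeval (F.poly θ)).isUnit (hx θ (hx1.meanFreq_eq ▸ hθ))
  · intro t
    refine ⟨0, fun c _ => ?_⟩
    have hfin := (finite_setOf_not_isUnit_conjQuad c).image Complex.im
    obtain ⟨M, hM⟩ := hfin.bddAbove
    refine ⟨M, fun b hb θ hθ => ?_⟩
    by_contra hu
    have : θ ≤ M := by
      refine hM ⟨θ * Complex.I, ?_, by simp⟩
      intro hu'
      obtain ⟨B, hB, hBe⟩ := F.exists_poly_mul _ c θ
      rw [hBe] at hu'
      exact hu (hB.isUnit_mul_iff.1 hu').2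
    exact absurd (hb.trans_le hθ) (not_lt.2 this)

/-- Induction over the size. A top part of complex size `s` adds `2s - 1` and lowers `⌈r / mult⌉` by
`s`, for a total of `⌈r / mult⌉ + s - 1`, minimal only for `s = 1`. The matrices without frequencies
in `freq` supply the minimal stratum in the remaining range `r < mult`. -/
theorem hasStrat_spectralRank (F : FrequencyModel D K)
    (hnil : ∀ m r, r ≤ m → HasStrat ConjRel (fun _ => Set.univ)
      {A : Matrix (Fin m) (Fin m) D | SpectralRank imAxis A r ∧
        ∀ θ ∈ F.freq, IsUnit (aeval A (F.poly θ))}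
      ((r + F.mult - 1) / F.mult) (if r < F.mult then 1 else 0)) (m r : ℕ) (hr : r ≤ m) :
    HasStrat ConjRel (fun _ => Set.univ)
      {A : Matrix (Fin m) (Fin m) D | SpectralRank imAxis A r} ((r + F.mult - 1) / F.mult) 1 := by
  induction m using Nat.strong_induction_on generalizing r with
  | _ m ih =>
  have ht := F.mult_pos
  let T : Fin (r / F.mult) → Set (Matrix (Fin m) (Fin m) D) := fun j =>
    {A | ∃ x ∈ F.topPairs (j + 1) (m - F.mult * (j + 1)) (r - F.mult * (j + 1)), F.Decomp A x}
  have hj : ∀ j : Fin (r / F.mult), F.mult * (j + 1) ≤ r := fun j =>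
    (Nat.mul_le_mul_left _ j.2).trans (Nat.mul_div_le r F.mult)
  have hT : {A : Matrix (Fin m) (Fin m) D | SpectralRank imAxis A r} =
      {A | SpectralRank imAxis A r ∧ ∀ θ ∈ F.freq, IsUnit (aeval A (F.poly θ))} ∪ ⋃ j, T j := by
    ext A
    rw [Set.mem_union, Set.mem_iUnion]
    constructor
    · intro hA
      by_cases hu : ∀ θ ∈ F.freq, IsUnit (aeval A (F.poly θ))
      · exact Or.inl ⟨hA, hu⟩
      · obtain ⟨s, hs, hsr, x, hx⟩ := exists_decomp_of_spectralRank hA hu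
        obtain ⟨j, rfl⟩ := Nat.exists_eq_succ_of_ne_zero hs
        exact Or.inr ⟨⟨j, (Nat.le_div_iff_mul_le ht).2 (by rwa [mul_comm])⟩, x, hx⟩
    · rintro (h | ⟨j, x, hx, h⟩)
      · exact h.1
      · have := h.spectralRank hx
        rwa [Nat.add_sub_cancel' (hj j)] at this
  have hdisj : Pairwise fun i j => Disjoint (T i) (T j) := by
    intro i j hij
    rw [Set.disjoint_left]
    rintro A ⟨x, hx, hAx⟩ ⟨y, hy, hAy⟩
    have := Decomp.eq (by simp) (by simp) hx hy hAx hAy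
    exact hij (Fin.ext (by omega))
  have main : ∀ j, HasStrat ConjRel (fun _ => Set.univ) (T j) ((r + F.mult - 1) / F.mult)
      (if (j : ℕ) = 0 then 1 else 0) := by
    intro j
    have hjr := hj j
    have hpos := Nat.mul_pos ht (Nat.succ_pos j)
    have h0 := hasStrat_topPairs (F := F) (s := j + 1) (by simp)
      (ih (m - F.mult * (j + 1)) (by simp only [Nat.succ_eq_add_one] at hpos; omega)
        (r - F.mult * (j + 1)) (by omega))
    have h1 := h0.transfer_retraction (rel := ConjRel) (w := fun _ => Set.univ) (F.Decomp (m := m))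
      (fun x y z hy hz h h' => Decomp.conjRel (by simp) hy hz h h') (fun x y z h h' =>
        h'.of_conjRel h) (fun p q hq hpq => F.exists_local_decomp (by simp) hq hpq)
      (fun _ t => ⟨0, fun y _ _ => ?_⟩)
    · have hcod : (r + F.mult - 1) / F.mult =
          (j + 1) + (r - F.mult * (j + 1) + F.mult - 1) / F.mult := by
        rw [add_comm ((j : ℕ) + 1), ← Nat.add_mul_div_left _ _ ht]
        congr 1
        omega
      split_ifs with h00
      · convert h1 using 1
        rw [hcod, h00]
      · refine h1.of_lt ?_ _
        rw [hcod]
        omega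
    · obtain ⟨A, hA⟩ := F.exists_decomp (m := m) (by omega) y
      exact ⟨A, trivial, hA⟩
  rw [hT]
  have hun := (hnil m r hr).union (HasStrat.iUnion hdisj main) ?_
  · convert hun using 1
    split_ifs with hrt
    · have : r / F.mult = 0 := Nat.div_eq_of_lt hrt
      rw [Finset.sum_eq_zero fun j _ => absurd j.2 (by omega), add_zero]
    · have h0 : 0 < r / F.mult := Nat.div_pos (not_lt.1 hrt) ht
      rw [Finset.sum_eq_single ⟨0, h0⟩]
      · simp
      · intro j _ hj
        rw [if_neg fun h => hj (Fin.ext h)]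
      · simp
  · rw [Set.disjoint_left]
    rintro A ⟨-, hA⟩ hA'
    obtain ⟨j, x, hx, h⟩ := Set.mem_iUnion.1 hA'
    exact h.not_isUnit (by simp) hx (hA _ hx.1.1.1)

end FrequencyModel

/-! ### Complex structures from eigenvalue pairs -/

/-- An element which is almost a root of `X ^ 2 + θ ^ 2` is the sum of a multiple of a complex
structure and a nilpotent element. -/
theorem exists_complexStructure {R : Type*} [Ring R] [Algebra ℝ R] {a : R} {θ : ℝ} (hθ : θ ≠ 0)
    (h : IsNilpotent (a ^ 2 + (θ ^ 2) • (1 : R))) :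
    ∃ J : R, J * J = -1 ∧ Commute J a ∧ IsNilpotent (a - θ • J) := by
  let S := Algebra.adjoin ℝ {a}
  have hS : IsMulCommutative S := Algebra.isMulCommutative_adjoin ℝ (by
    rintro x rfl y rfl; rfl)
  let x : S := ⟨a, Algebra.self_mem_adjoin_singleton ℝ a⟩
  let P : ℝ[X] := X ^ 2 + C (θ ^ 2)
  have hP : aeval x P = x ^ 2 + (θ ^ 2) • (1 : S) := by
    simp [P, Algebra.smul_def]
  have hn : IsNilpotent (aeval x P) := by
    rw [hP]
    obtain ⟨N, hN⟩ := h
    exact ⟨N, Subtype.ext hN⟩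
  have hu : IsUnit (aeval x (derivative P)) := by
    have h1 : aeval x (derivative P) = (2 : ℝ) • x := by
      rw [derivative_add, derivative_C, derivative_X_pow, add_zero, map_mul, aeval_C]
      simp [Algebra.smul_def]
    have h2 : IsUnit (x ^ 2) := by
      have h3 : x ^ 2 = aeval x P + -((θ ^ 2) • (1 : S)) := by rw [hP]; ring
      rw [h3]
      refine hn.isUnit_add_right_of_commute ?_ (Commute.all _ _)
      rw [IsUnit.neg_iff]
      exact isUnit_one.smul (Units.mk0 (θ ^ 2) (by positivity))
    rw [h1]
    exact (isUnit_pow_iff two_ne_zero |>.1 h2).smul (Units.mk0 (2 : ℝ) two_ne_zero)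
  -- Newton iteration in the commutative algebra generated by `a`: the derivative `2a` is a unit
  -- because `a²` is `-θ²` up to a nilpotent. The exact root, divided by `θ`, is the complex
  -- structure.
  obtain ⟨r, ⟨hr1, hr2⟩, -⟩ := existsUnique_nilpotent_sub_and_aeval_eq_zero hn hu
  have hr3 : (r : R) ^ 2 + (θ ^ 2) • (1 : R) = 0 := by
    have : r ^ 2 + (θ ^ 2) • (1 : S) = 0 := by
      rw [← hr2]; simp [P, Algebra.smul_def]
    exact congrArg Subtype.val this
  refine ⟨θ⁻¹ • (r : R), ?_, ?_, ?_⟩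
  · rw [smul_mul_smul_comm, ← pow_two (r : R), eq_neg_of_add_eq_zero_left hr3, smul_neg, smul_smul,
      show θ⁻¹ * θ⁻¹ * θ ^ 2 = 1 by field_simp, one_smul]
  · have : Commute r x := Commute.all _ _
    exact (congrArg Subtype.val this : (r : R) * a = a * r) |> fun h => Commute.smul_left h _
  · rw [smul_smul, mul_inv_cancel₀ hθ, one_smul]
    obtain ⟨N, hN⟩ := hr1
    exact ⟨N, congrArg Subtype.val hN⟩

theorem conjQuad_mul_I (θ : ℝ) : conjQuad (θ * Complex.I) = X ^ 2 + C (θ ^ 2) := by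
  simp [conjQuad, Complex.normSq_apply, pow_two]

theorem aeval_conjQuad_mul_I {R : Type*} [Ring R] [Algebra ℝ R] (θ : ℝ) (A : R) :
    aeval A (conjQuad (θ * Complex.I)) = A ^ 2 + (θ ^ 2) • (1 : R) := by
  rw [conjQuad_mul_I, map_add, aeval_C, map_pow, aeval_X, Algebra.smul_def, mul_one]

theorem isCoprime_conjQuad_mul_I {θ θ' : ℝ} (h : θ ^ 2 ≠ θ' ^ 2) :
    IsCoprime (conjQuad (θ * Complex.I)) (conjQuad (θ' * Complex.I)) := by
  have h' : θ ^ 2 - θ' ^ 2 ≠ 0 := sub_ne_zero.2 h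
  refine ⟨C (θ ^ 2 - θ' ^ 2)⁻¹, -C (θ ^ 2 - θ' ^ 2)⁻¹, ?_⟩
  rw [conjQuad_mul_I, conjQuad_mul_I]
  calc C (θ ^ 2 - θ' ^ 2)⁻¹ * (X ^ 2 + C (θ ^ 2)) + -C (θ ^ 2 - θ' ^ 2)⁻¹ * (X ^ 2 + C (θ' ^ 2)) =
      C (θ ^ 2 - θ' ^ 2)⁻¹ * (C (θ ^ 2) - C (θ' ^ 2)) := by ring
    _ = 1 := by rw [← C_sub, ← C_mul, inv_mul_cancel₀ h', C_1]

theorem eq_im_mul_I {z : ℂ} (hz : z ∈ imAxis) : z = z.im * Complex.I := by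
  rw [← Complex.re_add_im z, show z.re = 0 from hz]
  simp

section

variable {s : ℕ} {b : Matrix (Fin s) (Fin s) ℂ} {θ : ℝ}

theorem sub_mul_add_imUnit (b : Matrix (Fin s) (Fin s) ℂ) (θ : ℝ) :
    (b - θ • imUnit s) * (b + θ • imUnit s) = b ^ 2 + (θ ^ 2) • 1 := by
  have h := (commute_imUnit b).eq
  rw [sub_mul, mul_add, mul_add, mul_smul_comm, smul_mul_assoc, smul_mul_smul_comm,
    imUnit_mul_imUnit, h, pow_two, pow_two, smul_neg]
  abel

theorem commute_sub_add_imUnit (b : Matrix (Fin s) (Fin s) ℂ) (θ : ℝ) :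
    Commute (b - θ • imUnit s) (b + θ • imUnit s) :=
  have h := (commute_imUnit b).smul_right θ
  ((Commute.refl b).add_right h).sub_left (h.symm.add_right (Commute.refl _))

theorem isUnit_smul_imUnit (hθ : θ ≠ 0) : IsUnit (θ • imUnit s) := by
  refine ⟨⟨θ • imUnit s, -(θ⁻¹ • imUnit s), ?_, ?_⟩, rfl⟩
  · rw [mul_neg, smul_mul_smul_comm, imUnit_mul_imUnit, mul_inv_cancel₀ hθ]; simp
  · rw [neg_mul, smul_mul_smul_comm, imUnit_mul_imUnit, inv_mul_cancel₀ hθ]; simp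

attribute [local instance] Matrix.linftyOpNormedAddCommGroup Matrix.linftyOpNormedSpace
  Matrix.linftyOpNormedRing Matrix.linftyOpNormedAlgebra

theorem isUnit_sub_of_norm_lt {n : Type*} [Fintype n] [DecidableEq n] {A : Matrix n n ℂ}
    (h : ‖A‖ < |θ|) : IsUnit (A - θ • (Complex.I • 1 : Matrix n n ℂ)) := by
  have hθ : θ ≠ 0 := by
    rintro rfl
    rw [abs_zero] at h
    exact absurd h (not_lt.2 (norm_nonneg A))
  have hμ : (θ * Complex.I : ℂ) ≠ 0 := by simp [hθ]
  have h1 : A - θ • (Complex.I • 1 : Matrix n n ℂ) =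
      (-(θ * Complex.I : ℂ)) • (1 - (θ * Complex.I : ℂ)⁻¹ • A) := by
    rw [smul_sub, smul_smul, neg_mul, mul_inv_cancel₀ hμ, neg_smul, neg_smul, one_smul,
      ← smul_assoc, Complex.real_smul]
    abel
  rw [h1]
  refine (isUnit_one_sub_of_norm_lt_one ?_).smul (Units.mk0 _ (neg_ne_zero.2 hμ))
  rw [norm_smul, norm_inv, norm_mul, Complex.norm_I, mul_one, Complex.norm_real,
    Real.norm_eq_abs, inv_mul_lt_iff₀ (abs_pos.2 hθ), mul_one]
  exact h

theorem isOpen_setOf_forall_isUnit_sub {n : Type*} [Fintype n] [DecidableEq n] {L : Set ℝ}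
    (hL : IsClosed L) :
    IsOpen {A : Matrix n n ℂ | ∀ θ ∈ L, IsUnit (A - θ • (Complex.I • 1 : Matrix n n ℂ))} := by
  refine isOpen_setOf_forall_isUnit
    (g := fun (θ : ℝ) A => A - θ • (Complex.I • 1 : Matrix n n ℂ)) (by fun_prop) (fun r => ?_) hL
  refine ⟨|r| + 1, fun θ A hA hθ => ?_⟩
  have h : ‖A‖ < |θ| := by
    rw [Real.norm_eq_abs] at hθ
    linarith [le_abs_self r]
  exact isUnit_sub_of_norm_lt h

end

/-! ### The real, quaternionic and complex models -/

section Models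

variable (D : Type*) [NormedDivisionRing D] [NormedAlgebra ℝ D] [FiniteDimensional ℝ D]

attribute [local instance] Matrix.linftyOpNormedAddCommGroup Matrix.linftyOpNormedSpace
  Matrix.linftyOpNormedRing Matrix.linftyOpNormedAlgebra

/-- The only eigenvalue of `b₀` is `iθ₀`, so `b₀`, and hence every nearby matrix, has no eigenvalue
on the closed lower half of the imaginary axis. -/
theorem eventually_isUnit_add_imUnit {s : ℕ} {b₀ : Matrix (Fin s) (Fin s) ℂ} {θ₀ : ℝ}
    (h₀ : 0 < θ₀) (hb : IsNilpotent (b₀ - θ₀ • imUnit s)) :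
    ∀ᶠ b in 𝓝 b₀, ∀ θ : ℝ, 0 < θ → IsUnit (b + θ • imUnit s) := by
  have := (isOpen_setOf_forall_isUnit_sub (n := Fin s) (isClosed_Iic (a := (0 : ℝ)))).mem_nhds
    (x := b₀) ?_
  · filter_upwards [this] with b hb θ hθ
    have := hb (-θ) (by simpa using hθ.le)
    rwa [neg_smul, sub_neg_eq_add] at this
  · intro θ hθ
    have e : b₀ - θ • imUnit s = (b₀ - θ₀ • imUnit s) + (θ₀ - θ) • imUnit s := by
      rw [sub_smul]; abel
    change IsUnit (b₀ - θ • imUnit s)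
    rw [e]
    have hc : Commute (b₀ - θ₀ • imUnit s) (imUnit s) := commute_imUnit _
    exact hb.isUnit_add_right_of_commute
      (isUnit_smul_imUnit (sub_pos.2 (lt_of_le_of_lt hθ h₀)).ne') (hc.smul_right _)

/-- The frequency model determined by complex structures over a real division algebra in which
`-1` has no central square root. -/
noncomputable def FrequencyModel.ofReal (mult : ℕ) (mult_pos : 0 < mult) (idx : ℕ → Type)
    [∀ s, Fintype (idx s)] [∀ s, DecidableEq (idx s)]
    (card_idx : ∀ s, Fintype.card (idx s) = mult * s)
    (emb : ∀ s, Matrix (Fin s) (Fin s) ℂ →ₐ[ℝ] Matrix (idx s) (idx s) D)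
    (emb_injective : ∀ s, Injective (emb s))
    (exists_emb_eq : ∀ s x, Commute x (emb s (imUnit s)) → ∃ b, emb s b = x)
    (exists_conj : ∀ (α : ℕ) (J : Matrix (Fin α) (Fin α) D), J * J = -1 →
      ∃ (s : ℕ) (g : Matrix (Fin α) (idx s) D) (k : Matrix (idx s) (Fin α) D),
        g * k = 1 ∧ k * g = 1 ∧ J = g * emb s (imUnit s) * k) :
    FrequencyModel D ℝ where
  mult := mult
  mult_pos := mult_pos
  closedFreq := Set.Ici 0
  freq := Set.Ioi 0
  isClosed_closedFreq := isClosed_Ici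
  isOpen_freq := isOpen_Ioi
  freq_subset := Set.Ioi_subset_Ici_self
  mem_freq_of_pos := fun _ h => h
  mem_freq_of_le := fun _ h _ h' => lt_of_lt_of_le h h'
  poly := fun θ => conjQuad (θ * Complex.I)
  isCoprime_poly := fun θ hθ θ' hθ' hne => isCoprime_conjQuad_mul_I fun h =>
    hne ((sq_eq_sq₀ hθ hθ').1 h)
  exists_poly_mul := fun _ _ _ _ _ => ⟨1, Commute.one_left _, (one_mul _).symm⟩
  spectrumFree_of_isUnit := fun n _ _ A h z hz => by
    have h1 := h |z.im| (Set.mem_Ici.2 (abs_nonneg _))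
    rw [conjQuad_mul_I, sq_abs, ← conjQuad_mul_I, ← eq_im_mul_I hz] at h1
    exact h1
  isOpen_setOf_isUnit := fun n _ _ A => by
    have : Continuous fun θ : ℝ => aeval A (conjQuad (θ * Complex.I)) := by
      simp only [aeval_conjQuad_mul_I]
      fun_prop
    exact Units.isOpen.preimage this
  isOpen_setOf_forall_isUnit := fun n _ _ L hL => by
    have := isOpen_spectrumFree (R := Matrix n n D) (Z := (fun θ : ℝ => (θ * Complex.I : ℂ)) '' L)
      ?_
    · refine (congrArg IsOpen ?_).mpr this
      ext A
      simp [SpectrumFree]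
    · have e : (fun θ : ℝ => (θ * Complex.I : ℂ)) '' L = imAxis ∩ Complex.im ⁻¹' L := by
        ext z
        constructor
        · rintro ⟨θ, hθ, rfl⟩
          exact ⟨by simp [imAxis], by simpa using hθ⟩
        · rintro ⟨h1, h2⟩
          exact ⟨z.im, h2, (eq_im_mul_I h1).symm⟩
      rw [e]
      exact isClosed_imAxis.inter (hL.preimage Complex.continuous_im)
  idx := idx
  card_idx := card_idx
  emb := emb
  emb_injective := emb_injective
  exists_emb_eq := exists_emb_eq
  freq_ne_zero_or := Or.inl fun _ h => ne_of_gt h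
  isNilpotent_poly := fun s θ hθ b hb => by
    rw [aeval_algHom_apply]
    refine IsNilpotent.map ?_ (emb s)
    rw [aeval_conjQuad_mul_I, ← sub_mul_add_imUnit]
    exact (commute_sub_add_imUnit b θ).isNilpotent_mul_right hb
  isNilpotent_of_poly := fun s θ₀ hθ₀ b₀ hb₀ => by
    filter_upwards [eventually_isUnit_add_imUnit hθ₀ hb₀] with b hb θ hθ hn
    rw [aeval_algHom_apply, IsNilpotent.map_iff (emb_injective s), aeval_conjQuad_mul_I,
      ← sub_mul_add_imUnit] at hn
    obtain ⟨N, hN⟩ := hn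
    rw [(commute_sub_add_imUnit b θ).mul_pow] at hN
    exact ⟨N, ((hb θ hθ).pow N).mul_left_eq_zero.1 hN⟩
  exists_emb_conj := fun α a θ hθ ha => by
    rw [aeval_conjQuad_mul_I] at ha
    obtain ⟨J, hJ, hc, hn⟩ := exists_complexStructure (ne_of_gt hθ) ha
    obtain ⟨s, g, k, hgk, hkg, rfl⟩ := exists_conj α J hJ
    have e1 : ∀ Y : Matrix (idx s) (Fin α) D, k * (g * Y) = Y := fun Y => by
      rw [← Matrix.mul_assoc, hkg, Matrix.one_mul]
    have e3 : ∀ Y : Matrix (Fin α) (Fin α) D, g * (k * Y) = Y := fun Y => by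
      rw [← Matrix.mul_assoc, hgk, Matrix.one_mul]
    have e2 : ∀ Y : Matrix (idx s) (idx s) D, k * (g * Y) = Y := fun Y => by
      rw [← Matrix.mul_assoc, hkg, Matrix.one_mul]
    have e4 : ∀ Y : Matrix (Fin α) (idx s) D, g * (k * Y) = Y := fun Y => by
      rw [← Matrix.mul_assoc, hgk, Matrix.one_mul]
    obtain ⟨b, hb⟩ := exists_emb_eq s (k * a * g) (by
      have h := congrArg (fun Y => k * Y * g) hc.eq
      simp only [Matrix.mul_assoc, e1, hkg, Matrix.mul_one] at h
      rw [commute_iff_eq]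
      simp only [Matrix.mul_assoc]
      exact h.symm)
    have ha' : a = g * emb s b * k := by
      rw [hb]
      simp only [Matrix.mul_assoc, hgk, Matrix.mul_one, e3]
    refine ⟨s, b, g, k, hgk, hkg, ?_, ha'⟩
    rw [← IsNilpotent.map_iff (emb_injective s)]
    obtain ⟨N, hN⟩ := hn
    have e5 : a - θ • (g * emb s (imUnit s) * k) = g * emb s (b - θ • imUnit s) * k := by
      rw [ha', map_sub, map_smul, Matrix.mul_sub, Matrix.sub_mul, Matrix.mul_smul, Matrix.smul_mul]
    have e6 : ∀ M : ℕ, (g * emb s (b - θ • imUnit s) * k) ^ M =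
        g * emb s (b - θ • imUnit s) ^ M * k := by
      intro M
      induction M with
      | zero => simp [hgk]
      | succ M ih =>
        rw [pow_succ, ih, pow_succ]
        simp only [Matrix.mul_assoc, e1]
    refine ⟨N, ?_⟩
    rw [e5, e6] at hN
    have := congrArg (fun Y => k * Y * g) hN
    simpa only [Matrix.mul_assoc, e2, hkg, Matrix.mul_one, Matrix.mul_zero, Matrix.zero_mul]
      using this

/-- The embedding of complex matrices of size `s` into real matrices of size `2 * s`. -/
noncomputable def realEmb (s : ℕ) :
    Matrix (Fin s) (Fin s) ℂ →ₐ[ℝ] Matrix (Fin s × Fin 2) (Fin s × Fin 2) ℝ :=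
  (Matrix.compAlgEquiv (Fin s) (Fin 2) ℝ ℝ).toAlgHom.comp
    (Algebra.leftMulMatrix Complex.basisOneI).mapMatrix

theorem realEmb_apply (s : ℕ) (b : Matrix (Fin s) (Fin s) ℂ) (x y : Fin s × Fin 2) :
    realEmb s b x y = Algebra.leftMulMatrix Complex.basisOneI (b x.1 y.1) x.2 y.2 := rfl

theorem exists_leftMulMatrix_eq {X : Matrix (Fin 2) (Fin 2) ℝ}
    (h : X * Algebra.leftMulMatrix Complex.basisOneI Complex.I =
      Algebra.leftMulMatrix Complex.basisOneI Complex.I * X) :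
    Algebra.leftMulMatrix Complex.basisOneI ⟨X 0 0, X 1 0⟩ = X := by
  rw [Algebra.leftMulMatrix_complex] at h ⊢
  have h0 := congrFun (congrFun h 0) 0
  have h1 := congrFun (congrFun h 0) 1
  simp [Matrix.mul_apply, Fin.sum_univ_two] at h0 h1
  ext i j
  fin_cases i <;> fin_cases j <;> simp [h0, h1]

/-- `J` turns `ℝ^α` into a complex vector space; a complex basis, expanded by `1, i`, is the
required real basis. -/
theorem exists_conj_realEmb (α : ℕ) (J : Matrix (Fin α) (Fin α) ℝ) (hJ : J * J = -1) :
    ∃ (s : ℕ) (g : Matrix (Fin α) (Fin s × Fin 2) ℝ) (k : Matrix (Fin s × Fin 2) (Fin α) ℝ),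
      g * k = 1 ∧ k * g = 1 ∧ J = g * realEmb s (imUnit s) * k := by
  let f := Complex.lift ⟨(Matrix.toLin' J : Module.End ℝ (Fin α → ℝ)), by
    change Matrix.toLin' J ∘ₗ Matrix.toLin' J = -1
    rw [← Matrix.toLin'_mul, hJ, map_neg, Matrix.toLin'_one]; rfl⟩
  let _ : Module ℂ (Fin α → ℝ) := Module.compHom _ f.toRingHom
  have hsm : ∀ (z : ℂ) (v : Fin α → ℝ), z • v = f z v := fun _ _ => rfl
  have : IsScalarTower ℝ ℂ (Fin α → ℝ) := ⟨fun r z v => by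
    rw [hsm, hsm, map_smul]; rfl⟩
  have : Module.Finite ℂ (Fin α → ℝ) := Module.Finite.of_restrictScalars_finite ℝ ℂ _
  let c := Module.finBasis ℂ (Fin α → ℝ)
  let B := Complex.basisOneI.smulTower' c
  let L : (Fin α → ℝ) →ₗ[ℂ] (Fin α → ℝ) := Complex.I • LinearMap.id
  have hL : L.restrictScalars ℝ = Matrix.toLin' J := by
    refine LinearMap.ext fun v => ?_
    change Complex.I • v = _
    rw [hsm]
    simp [f]
  have hLc : L.toMatrix c c = imUnit _ := by
    change LinearMap.toMatrix c c (Complex.I • LinearMap.id) = _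
    rw [map_smul, LinearMap.toMatrix_id, imUnit]
  have h1 := L.restrictScalars_toMatrix Complex.basisOneI c
  rw [hL, hLc] at h1
  refine ⟨_, (Pi.basisFun ℝ (Fin α)).toMatrix B, B.toMatrix (Pi.basisFun ℝ (Fin α)),
    Module.Basis.toMatrix_mul_toMatrix_flip _ _, Module.Basis.toMatrix_mul_toMatrix_flip _ _, ?_⟩
  have h2 : realEmb _ (imUnit _) = LinearMap.toMatrix B B (Matrix.toLin' J) := h1.symm
  rw [h2, basis_toMatrix_mul_linearMap_toMatrix_mul_basis_toMatrix]
  exact (LinearMap.toMatrix'_toLin' J).symm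

/-- The frequency model for real matrices. -/
noncomputable def realModel : FrequencyModel ℝ ℝ :=
  .ofReal ℝ 2 two_pos (fun s => Fin s × Fin 2) (fun s => by simp [mul_comm]) realEmb
    (fun s b c h => by
      ext1 i j
      apply Algebra.leftMulMatrix_injective Complex.basisOneI
      ext k l
      exact congrFun (congrFun h (i, k)) (j, l))
    (fun s x hx => by
      have key : ∀ i j, (Matrix.of fun k l => x (i, k) (j, l)) *
          Algebra.leftMulMatrix Complex.basisOneI Complex.I =
          Algebra.leftMulMatrix Complex.basisOneI Complex.I *
            (Matrix.of fun k l => x (i, k) (j, l)) := by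
        intro i j
        ext k l
        have := congrFun (congrFun hx.eq (i, k)) (j, l)
        rw [Matrix.mul_apply, Matrix.mul_apply, Fintype.sum_prod_type, Fintype.sum_prod_type,
          Finset.sum_eq_single j, Finset.sum_eq_single i] at this
        · simpa [realEmb_apply, imUnit, Matrix.mul_apply] using this
        · intro a _ ha
          simp [realEmb_apply, imUnit, ha.symm]
        · simp
        · intro a _ ha
          simp [realEmb_apply, imUnit, ha]
        · simp
      refine ⟨.of fun i j => ⟨x (i, 0) (j, 0), x (i, 1) (j, 0)⟩, ?_⟩
      ext ⟨i, k⟩ ⟨j, l⟩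
      exact congrFun (congrFun (exists_leftMulMatrix_eq (key i j)) k) l)
    exists_conj_realEmb

open Quaternion in
theorem commute_I_iff {q : ℍ[ℝ]} (h : q * Quaternion.ofComplex Complex.I =
    Quaternion.ofComplex Complex.I * q) : Quaternion.ofComplex ⟨q.re, q.imI⟩ = q := by
  have h1 := congrArg QuaternionAlgebra.imJ h
  have h2 := congrArg QuaternionAlgebra.imK h
  simp at h1 h2
  ext <;> simp <;> linarith

open Quaternion in
theorem exists_conj_ofComplex (α : ℕ) (J : Matrix (Fin α) (Fin α) ℍ[ℝ]) (hJ : J * J = -1) :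
    ∃ (s : ℕ) (g : Matrix (Fin α) (Fin s) ℍ[ℝ]) (k : Matrix (Fin s) (Fin α) ℍ[ℝ]),
      g * k = 1 ∧ k * g = 1 ∧ J = g * Quaternion.ofComplex.mapMatrix (imUnit s) * k := by
  set i : ℍ[ℝ] := Quaternion.ofComplex Complex.I with hi
  have hii : i * i = -1 := by
    rw [hi, ← map_mul, Complex.I_mul_I, map_neg, map_one]
  obtain ⟨j, hj0, hj1, hj2, hj3⟩ : ∃ j : ℍ[ℝ], j.re = 0 ∧ j.imI = 0 ∧ j.imJ = 1 ∧ j.imK = 0 :=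
    ⟨⟨0, 0, 1, 0⟩, rfl, rfl, rfl, rfl⟩
  have hjj : j * j = -1 := by ext <;> simp [hj0, hj1, hj2, hj3]
  have hij : i * j = -(j * i) := by ext <;> simp [hi, hj0, hj1, hj2, hj3]
  have h20 : (2 : ℍ[ℝ]) ≠ 0 := fun h => by
    have h1 : ((2 : ℝ) : ℍ[ℝ]) = ((0 : ℝ) : ℍ[ℝ]) := by exact_mod_cast h
    exact two_ne_zero (Quaternion.coe_injective h1)
  let E : Set (Fin α → ℍ[ℝ]) := {u | Matrix.vecMul u J = i • u}
  have hvJ : ∀ u : Fin α → ℍ[ℝ], Matrix.vecMul (Matrix.vecMul u J) J = -u := fun u => by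
    rw [Matrix.vecMul_vecMul, hJ, Matrix.vecMul_neg, Matrix.vecMul_one]
  have hspan : ⊤ ≤ Submodule.span ℍ[ℝ] E := by
    intro u _
    -- The two combinations `u ∓ i • uJ` are eigenvectors of right multiplication by `J` for `i` and
    -- `-i`; multiplying the second by `j` turns it into one for `i`. So the `i`-eigenvectors span
    -- over the quaternions and contain a basis.
    have h1 : u - i • Matrix.vecMul u J ∈ E := by
      change Matrix.vecMul (u - i • Matrix.vecMul u J) J = i • (u - i • Matrix.vecMul u J)
      rw [Matrix.sub_vecMul, Matrix.smul_vecMul, hvJ, smul_sub, smul_smul, hii, smul_neg, neg_smul,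
        one_smul]
      abel
    have h2 : j • (u + i • Matrix.vecMul u J) ∈ E := by
      change Matrix.vecMul (j • (u + i • Matrix.vecMul u J)) J =
        i • j • (u + i • Matrix.vecMul u J)
      rw [Matrix.smul_vecMul, Matrix.add_vecMul, Matrix.smul_vecMul, hvJ, smul_smul i j, hij,
        neg_smul, mul_smul, smul_add i, smul_smul i i, hii, ← smul_neg, smul_neg, neg_smul, one_smul]
      congr 1
      abel
    have h3 : u = (2⁻¹ : ℍ[ℝ]) • ((u - i • Matrix.vecMul u J) +
        (-j) • j • (u + i • Matrix.vecMul u J)) := by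
      rw [smul_smul (-j), neg_mul, hjj, neg_neg, one_smul,
        show u - i • Matrix.vecMul u J + (u + i • Matrix.vecMul u J) = (2 : ℍ[ℝ]) • u by
          rw [two_smul]; abel, smul_smul, inv_mul_cancel₀ h20, one_smul]
    rw [h3]
    exact Submodule.smul_mem _ _ (Submodule.add_mem _ (Submodule.subset_span h1)
      (Submodule.smul_mem _ _ (Submodule.subset_span h2)))
  let B₀ := Module.Basis.ofSpan hspan
  have : Fintype ((linearIndepOn_empty ℍ[ℝ] id).extend (Set.empty_subset E)) :=
    FiniteDimensional.fintypeBasisIndex B₀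
  let B := B₀.reindex (Fintype.equivFinOfCardEq (n := α) (by
    rw [← Module.finrank_eq_card_basis B₀, Module.finrank_fin_fun]))
  have hB : ∀ a, Matrix.vecMul (B a) J = i • B a := fun a => by
    apply Module.Basis.ofSpan_subset hspan
    rw [Module.Basis.reindex_apply]
    exact Set.mem_range_self _
  let k : Matrix (Fin α) (Fin α) ℍ[ℝ] := .of fun a => B a
  let h : Matrix (Fin α) (Fin α) ℍ[ℝ] := .of fun a => B.repr (Pi.single a 1)
  have hhk : h * k = 1 := by
    ext1 a b
    have := congrFun (B.sum_repr (Pi.single a 1)) b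
    simp only [Finset.sum_apply, Pi.smul_apply, smul_eq_mul] at this
    rw [Matrix.mul_apply]
    refine this.trans ?_
    simp only [Matrix.one_apply, Pi.single_apply, eq_comm]
  have hkJ : k * J = Quaternion.ofComplex.mapMatrix (imUnit α) * k := by
    have hd : Quaternion.ofComplex.mapMatrix (imUnit α) = Matrix.diagonal fun _ => i := by
      ext1 a b
      by_cases hab : a = b
      · subst hab; simp [imUnit, hi]
      · simp [imUnit, hab]
    rw [hd]
    ext1 a b
    rw [Matrix.diagonal_mul]
    exact congrFun (hB a) b
  refine ⟨α, h, k, hhk, mul_eq_one_comm.1 hhk, ?_⟩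
  rw [Matrix.mul_assoc, ← hkJ, ← Matrix.mul_assoc, hhk, Matrix.one_mul]

/-- The frequency model for quaternionic matrices. -/
noncomputable def quaternionModel : FrequencyModel (Quaternion ℝ) ℝ :=
  .ofReal (Quaternion ℝ) 1 one_pos Fin (fun s => by simp)
    (fun _ => Quaternion.ofComplex.mapMatrix)
    (fun s b c h => by
      ext1 i j
      exact Quaternion.ofComplex.toRingHom.injective (congrFun (congrFun h i) j))
    (fun s x hx => by
      have hd : (Quaternion.ofComplex.mapMatrix (imUnit s) : Matrix (Fin s) (Fin s) (Quaternion ℝ)) =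
          Matrix.diagonal fun _ => Quaternion.ofComplex Complex.I := by
        ext1 a b
        by_cases hab : a = b
        · subst hab; simp [imUnit]
        · simp [imUnit, hab]
      rw [hd] at hx
      refine ⟨.of fun i j => ⟨(x i j).re, (x i j).imI⟩, ?_⟩
      ext1 i j
      have := congrFun (congrFun hx.eq i) j
      rw [Matrix.mul_diagonal, Matrix.diagonal_mul] at this
      exact commute_I_iff this)
    exists_conj_ofComplex

theorem aeval_X_sub_C_mul_I {n : Type*} [Fintype n] [DecidableEq n] (θ : ℝ) (A : Matrix n n ℂ) :
    aeval A (X - C (θ * Complex.I)) = A - θ • (Complex.I • 1 : Matrix n n ℂ) := by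
  rw [map_sub, aeval_X, aeval_C, Algebra.algebraMap_eq_smul_one, ← smul_assoc, Complex.real_smul]

theorem aeval_conjQuad_eq_mul {n : Type*} [Fintype n] [DecidableEq n] (θ : ℝ) (A : Matrix n n ℂ) :
    aeval A (conjQuad (θ * Complex.I)) =
      (A + θ • (Complex.I • 1 : Matrix n n ℂ)) * (A - θ • (Complex.I • 1 : Matrix n n ℂ)) := by
  rw [aeval_conjQuad_mul_I, ← smul_assoc, add_mul, mul_sub, mul_sub, smul_mul_assoc, one_mul,
    smul_mul_smul_comm, mul_one, mul_smul_comm, mul_one, pow_two, ← sub_eq_zero,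
    Complex.real_smul]
  rw [show (θ * Complex.I * (θ * Complex.I) : ℂ) = ((-θ ^ 2 : ℝ) : ℂ) by
    push_cast; ring_nf; rw [Complex.I_sq]; ring]
  rw [← Complex.coe_smul, Complex.ofReal_neg, neg_smul]
  abel

/-- The frequency model for complex matrices. -/
noncomputable def complexModel : FrequencyModel ℂ ℂ where
  mult := 1
  mult_pos := one_pos
  -- Over `ℂ` the eigenvalues `iθ` and `-iθ` are independent, and zero is not exceptional. All real
  -- frequencies are treated alike, with linear polynomials.
  closedFreq := Set.univ
  freq := Set.univ
  isClosed_closedFreq := isClosed_univ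
  isOpen_freq := isOpen_univ
  freq_subset := subset_rfl
  mem_freq_of_pos := fun _ _ => trivial
  mem_freq_of_le := fun _ _ _ _ => trivial
  poly := fun θ => X - C (θ * Complex.I)
  isCoprime_poly := fun θ _ θ' _ hne => isCoprime_X_sub_C_of_isUnit_sub (by
    rw [isUnit_iff_ne_zero, sub_ne_zero]
    intro h
    exact hne (by simpa using h))
  exists_poly_mul := fun n _ _ A θ => by
    rw [aeval_X_sub_C_mul_I]
    refine ⟨_, ?_, aeval_conjQuad_eq_mul θ A⟩
    have h : Commute A (θ • (Complex.I • 1 : Matrix n n ℂ)) :=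
      ((Commute.one_right A).smul_right _).smul_right _
    exact (((Commute.refl A).add_left h.symm).sub_right (h.add_left (Commute.refl _)))
  spectrumFree_of_isUnit := fun n _ _ A h z hz => by
    have h1 := h z.im trivial
    have h2 := h (-z.im) trivial
    rw [aeval_X_sub_C_mul_I] at h1 h2
    rw [neg_smul, sub_neg_eq_add] at h2
    rw [eq_im_mul_I hz, aeval_conjQuad_eq_mul]
    exact h2.mul h1
  isOpen_setOf_isUnit := fun n _ _ A => by
    have : Continuous fun θ : ℝ => aeval A (X - C (θ * Complex.I : ℂ)) := by
      simp only [aeval_X_sub_C_mul_I]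
      fun_prop
    exact Units.isOpen.preimage this
  isOpen_setOf_forall_isUnit := fun n _ _ L hL => by
    simp only [aeval_X_sub_C_mul_I]
    exact isOpen_setOf_forall_isUnit_sub hL
  idx := Fin
  card_idx := fun s => by simp
  emb := fun s => AlgHom.id ℝ _
  emb_injective := fun s => injective_id
  exists_emb_eq := fun s x _ => ⟨x, rfl⟩
  freq_ne_zero_or := Or.inr fun s x hx => by
    have hc : x * imUnit s = imUnit s * x := (commute_imUnit x).eq
    change x * imUnit s = -(imUnit s * x) at hx
    rw [hc, eq_neg_iff_add_eq_zero, ← two_smul ℝ, smul_eq_zero] at hx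
    have h := hx.resolve_left two_ne_zero
    rw [imUnit, smul_mul_assoc, one_mul, smul_eq_zero] at h
    exact h.resolve_left Complex.I_ne_zero
  isNilpotent_poly := fun s θ _ b hb => by
    rw [aeval_X_sub_C_mul_I]
    exact hb
  isNilpotent_of_poly := fun s θ _ b _ => Eventually.of_forall fun b θ _ hb => by
    rw [aeval_X_sub_C_mul_I] at hb
    exact hb
  exists_emb_conj := fun α a θ _ ha => by
    rw [aeval_X_sub_C_mul_I] at ha
    exact ⟨α, a, 1, 1, mul_one 1, mul_one 1, ha, by simp⟩

end Models

/-! ### Strata for the imaginary axis over the three algebras -/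

section CenterStrata

variable {D : Type*} [NormedDivisionRing D] [NormedAlgebra ℝ D] [FiniteDimensional ℝ D]

attribute [local instance] Matrix.linftyOpNormedAddCommGroup Matrix.linftyOpNormedSpace
  Matrix.linftyOpNormedRing Matrix.linftyOpNormedAlgebra

theorem spectralRank_of_isNilpotent {n : Type*} [Fintype n] [DecidableEq n] {a : Matrix n n D}
    {Z : Set ℂ} (hZ : 0 ∈ Z) (ha : IsNilpotent a) : SpectralRank Z a (Fintype.card n) := by
  obtain ⟨N, hN⟩ := ha
  exact spectralRank_card (f := X ^ N) (fun z hz => by simp at hz; rw [hz.1]; exact hZ)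
    (by simpa using hN)

theorem spectrumFree_imAxis_iff {n : Type*} [Fintype n] [DecidableEq n] {c : Matrix n n D}
    (hc : IsUnit c) : SpectrumFree imAxis c ↔
      ∀ θ : ℝ, 0 < θ → IsUnit (aeval c (conjQuad (θ * Complex.I))) := by
  constructor
  · exact fun h θ _ => h _ (by simp [imAxis])
  · intro h z hz
    rw [eq_im_mul_I hz]
    rcases eq_or_ne z.im 0 with h0 | h0
    · rw [h0, aeval_conjQuad_mul_I]
      simpa using hc
    · have := h |z.im| (abs_pos.2 h0)
      rwa [conjQuad_mul_I, sq_abs, ← conjQuad_mul_I] at this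

/-- If the only eigenvalue on the axis is zero, the spectral rank is counted by powers of `A`. Given
that count, the absence of other imaginary eigenvalues is the open condition that the spectral rank
does not exceed `r`. -/
theorem spectralRank_imAxis_and_iff {m r : ℕ} (hr : r ≤ m) {A : Matrix (Fin m) (Fin m) D} :
    (SpectralRank imAxis A r ∧ ∀ θ : ℝ, 0 < θ → IsUnit (aeval A (conjQuad (θ * Complex.I)))) ↔
      StableRank A (m - r) ∧ ∃ r' ≤ r, SpectralRank imAxis A r' := by
  rw [StableRank, stableRank_iff_spectralRank hr]
  obtain ⟨α, k, Q, s, Q', s', h, a, c, rfl, hA, ha, hc⟩ := exists_fitting A (X : ℝ[X])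
  rw [aeval_X] at ha hc
  have hA : A = h.blockDiag ℝ (a, c) := hA
  subst hA
  have h1 := spectralRank_of_isNilpotent (Z := imAxis) (by simp [imAxis]) ha
  have h2 := spectralRank_of_isNilpotent (Z := {0}) rfl ha
  rw [Fintype.card_fin] at h1 h2
  have h3 := h2.blockDiag h ((spectralRank_zero_iff conj_mem_singleton_zero).2
    (spectrumFree_zero_iff.2 hc))
  rw [add_zero] at h3
  have hu : (∀ θ : ℝ, 0 < θ → IsUnit (aeval (h.blockDiag ℝ (a, c)) (conjQuad (θ * Complex.I)))) ↔
      SpectrumFree imAxis c := by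
    rw [spectrumFree_imAxis_iff hc]
    refine forall₂_congr fun θ hθ => ?_
    rw [h.aeval_blockDiag, h.isUnit_blockDiag_iff, and_iff_right]
    refine isUnit_aeval_of_isCoprime (q := conjQuad ((0 : ℝ) * Complex.I))
      (isCoprime_conjQuad_mul_I (by simpa using hθ.ne')) ?_
    rw [aeval_conjQuad_mul_I]
    simpa using ha
  rw [hu]
  constructor
  · rintro ⟨h4, h5⟩
    have h6 := h1.blockDiag h ((spectralRank_zero_iff conj_mem_imAxis).2 h5)
    obtain rfl := h4.unique h6
    exact ⟨h3, _, le_rfl, h4⟩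
  · rintro ⟨h4, r', hr', h5⟩
    obtain rfl := h4.unique h3
    obtain ⟨h6, h7⟩ := SpectralRank.of_blockDiag conj_mem_imAxis h h5 h1
    obtain rfl : r' = r := le_antisymm hr' h6
    rw [Nat.sub_self] at h7
    exact ⟨h5, (spectralRank_zero_iff conj_mem_imAxis).1 h7⟩

/-- The only possible eigenvalues are zero and one, and one is not on the axis. Applied to
`shiftMatrix`, it keeps the minimal stratum of `hasStrat_noFrequency` nonempty. -/
theorem spectralRank_imAxis_of_pow_succ_eq {m r : ℕ} (hr : r ≤ m) {A : Matrix (Fin m) (Fin m) D}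
    (hA : StableRank A (m - r)) {k : ℕ} (hk : A ^ (k + 1) = A ^ k) : SpectralRank imAxis A r := by
  rw [StableRank, stableRank_iff_spectralRank hr] at hA
  obtain ⟨e, he, her⟩ := hA
  obtain ⟨h1, h2, ⟨p, hp, hpe⟩, ⟨q, hq, hqe⟩⟩ := he
  refine ⟨e, ⟨h1, h2, ⟨p, fun z hz => ?_, hpe⟩, ⟨X - 1, fun z hz => ?_, ?_⟩⟩, her⟩
  · rw [hp z hz]; simp [imAxis]
  · intro h
    have : z = 1 := by simpa [sub_eq_zero] using h
    rw [this] at hz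
    simp [imAxis] at hz
  · have hcop : IsCoprime (X ^ k) q :=
      isCoprime_of_roots (Z := {0}) (fun z hz => by simp at hz; simpa using hz.1) hq
    obtain ⟨u, v, huv⟩ := hcop
    have h3 := congrArg (aeval A) huv
    rw [map_add, map_mul, map_mul, map_pow, aeval_X, map_one] at h3
    have h4 : (A - 1) * A ^ k = 0 := by rw [sub_mul, ← pow_succ', hk, one_mul, sub_self]
    rw [map_sub, aeval_X, map_one]
    have hcu : Commute (A - 1) (aeval A u) :=
      (commute_aeval (((Commute.refl A).sub_right (Commute.one_right A))) u).symm
    calc (A - 1) * (1 - e) = (A - 1) * ((aeval A u * A ^ k + aeval A v * aeval A q) * (1 - e)) := by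
          rw [h3, one_mul]
      _ = aeval A u * ((A - 1) * A ^ k) * (1 - e) +
          (A - 1) * (aeval A v * (aeval A q * (1 - e))) := by
          rw [← mul_assoc, mul_add, add_mul, ← mul_assoc, hcu.eq]
          simp only [mul_assoc]
      _ = 0 := by rw [h4, hqe]; simp

theorem hasStrat_spectralRank_zero {m r : ℕ} (hr : r ≤ m) :
    HasStrat ConjRel (fun _ => Set.univ) {A : Matrix (Fin m) (Fin m) D | SpectralRank {0} A r}
      (Module.finrank ℝ D * r) 1 := by
  have := (hasStrat_stableRank (D := D) (Nat.sub_le m r)).inter_open isOpen_univ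
    (fun _ _ _ _ => trivial) (w' := fun _ => Set.univ) (fun t => ⟨t, fun _ _ _ => by simp⟩)
  rw [Set.inter_univ, Nat.sub_sub_self hr] at this
  simpa only [StableRank, stableRank_iff_spectralRank hr] using this

theorem hasStrat_noFrequency {m r : ℕ} (hr : r ≤ m) :
    HasStrat ConjRel (fun _ => Set.univ) {A : Matrix (Fin m) (Fin m) D | SpectralRank imAxis A r ∧
      ∀ θ : ℝ, 0 < θ → IsUnit (aeval A (conjQuad (θ * Complex.I)))} (Module.finrank ℝ D * r) 1 := by
  have := (hasStrat_stableRank (D := D) (Nat.sub_le m r)).inter_open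
    (isOpen_spectralRank_le (n := Fin m) (D := D) conj_mem_imAxis isClosed_imAxis r)
    (fun x y hxy ⟨r', hr', h⟩ => ⟨r', hr', h.conjRel hxy⟩) (w' := fun _ => Set.univ)
    (fun t => ⟨t, ?_⟩)
  · rw [Nat.sub_sub_self hr] at this
    simp only [spectralRank_imAxis_and_iff hr]
    exact this
  · rintro x hx rfl
    obtain ⟨k, hk⟩ := exists_shiftMatrix_pow_succ_eq (D := D) (Nat.sub_le m r)
    exact ⟨⟨r, le_rfl, spectralRank_imAxis_of_pow_succ_eq hr hx hk⟩, trivial⟩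

/-- Without nonzero frequencies the codimension is at least `r`, which equals `⌈r/2⌉` only for `r ≤
1`. -/
theorem hasStrat_real {m r : ℕ} (hr : r ≤ m) : HasStrat ConjRel (fun _ => Set.univ)
    {A : Matrix (Fin m) (Fin m) ℝ | SpectralRank imAxis A r} ((r + 1) / 2) 1 := by
  refine realModel.hasStrat_spectralRank (fun m r hr => ?_) m r hr
  have h := hasStrat_noFrequency (D := ℝ) hr
  rw [Module.finrank_self, one_mul] at h
  change HasStrat _ _ _ ((r + 1) / 2) (if r < 2 then 1 else 0)
  split_ifs with h2
  · rw [show (r + 1) / 2 = r by omega]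
    exact h
  · exact h.of_lt (by omega) _

/-- Here an eigenvalue zero of multiplicity `r` costs `4r`, so it never occurs in the minimal
stratum. -/
theorem hasStrat_quaternion {m r : ℕ} (hr : r ≤ m) : HasStrat ConjRel (fun _ => Set.univ)
    {A : Matrix (Fin m) (Fin m) (Quaternion ℝ) | SpectralRank imAxis A r} r 1 := by
  have key := quaternionModel.hasStrat_spectralRank (fun m r hr => by
    have h := hasStrat_noFrequency (D := Quaternion ℝ) hr
    rw [Quaternion.finrank_eq_four] at h
    change HasStrat _ _ _ (r / 1) (if r < 1 then 1 else 0)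
    rw [Nat.div_one]
    split_ifs with h2
    · obtain rfl : r = 0 := by omega
      exact h
    · exact h.of_lt (by omega) _) m r hr
  change HasStrat _ _ _ (r / 1) 1 at key
  rwa [Nat.div_one] at key

theorem hasStrat_complex {m r : ℕ} (hr : r ≤ m) : HasStrat ConjRel (fun _ => Set.univ)
    {A : Matrix (Fin m) (Fin m) ℂ | SpectralRank imAxis A r} r 1 := by
  suffices hnil : ∀ m r, r ≤ m → HasStrat ConjRel (fun _ => Set.univ)
      {A : Matrix (Fin m) (Fin m) ℂ | SpectralRank imAxis A r ∧
        ∀ θ ∈ complexModel.freq, IsUnit (aeval A (complexModel.poly θ))}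
      (r / 1) (if r < 1 then 1 else 0) by
    have key := complexModel.hasStrat_spectralRank hnil m r hr
    change HasStrat _ _ _ (r / 1) 1 at key
    rwa [Nat.div_one] at key
  clear hr m r
  intro m r hr
  rw [Nat.div_one]
  have key : ∀ A : Matrix (Fin m) (Fin m) ℂ,
      (∀ θ ∈ complexModel.freq, IsUnit (aeval A (complexModel.poly θ))) → SpectralRank imAxis A 0 :=
    fun A hA => (spectralRank_zero_iff conj_mem_imAxis).2
      (complexModel.spectrumFree_of_isUnit _ A hA)
  split_ifs with h2
  · obtain rfl : r = 0 := by omega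
    refine hasStrat_of_isOpen ?_ ?_ fun t => ⟨1, ⟨?_, ?_⟩, trivial⟩
    · refine (congrArg IsOpen ?_).mpr
        (complexModel.isOpen_setOf_forall_isUnit (Fin m) Set.univ isClosed_univ)
      ext A
      exact ⟨fun h => h.2, fun h => ⟨key A h, h⟩⟩
    · rintro x y hxy ⟨h1, h2⟩
      exact ⟨h1.conjRel hxy, fun θ hθ => (hxy.aeval _).isUnit (h2 θ hθ)⟩
    · refine spectralRank_imAxis_of_pow_succ_eq (k := 0) hr ?_ (by simp)
      exact stableRank_fin_self_iff.2 isUnit_one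
    · intro θ _
      change IsUnit (aeval 1 (X - C (θ * Complex.I : ℂ)))
      rw [map_sub, aeval_X, aeval_C, Algebra.algebraMap_eq_smul_one]
      have : (1 : Matrix (Fin m) (Fin m) ℂ) - (θ * Complex.I : ℂ) • 1 =
          (1 - θ * Complex.I : ℂ) • 1 := by rw [sub_smul, one_smul]
      rw [this]
      have h1 : (1 - θ * Complex.I : ℂ) ≠ 0 := fun h => by
        have := congrArg Complex.re h
        simp at this
      exact isUnit_one.smul (Units.mk0 _ h1)
  · convert HasStrat.of_isEmpty _ _ using 1
    rw [Set.eq_empty_iff_forall_notMem]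
    rintro A ⟨h1, h3⟩
    have := h1.unique (key A h3)
    omega

end CenterStrata

open Representation

/-! ### Endomorphism rings with nilpotent radical -/

section EndomorphismRing

variable {G V : Type*} [Monoid G] [AddCommGroup V] [Module ℝ V] (ρ : Representation ℝ G V)

noncomputable instance instRingIntertwiningMap : Ring (IntertwiningMap ρ ρ) where
  __ := IntertwiningMap.instSemiring ρ
  neg := Neg.neg
  sub := Sub.sub
  sub_eq_add_neg := sub_eq_add_neg
  zsmul := fun n A => n • A
  zsmul_zero' := zero_zsmul
  zsmul_succ' := fun n a => by
    have h := SubNegMonoid.zsmul_succ' n a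
    exact h
  zsmul_neg' := fun n a => by
    have h := SubNegMonoid.zsmul_neg' n a
    exact h
  neg_add_cancel := neg_add_cancel

theorem isUnit_of_map_ne_zero {R D : Type*} [Ring R] [Algebra ℝ R] [DivisionRing D] [Algebra ℝ D]
    {f : R →ₐ[ℝ] D} (hf : Surjective f) (hn : ∀ A, f A = 0 ↔ IsNilpotent A) {A : R}
    (hA : f A ≠ 0) : IsUnit A := by
  obtain ⟨B, hB⟩ := hf (f A)⁻¹
  have h : ∀ C, f C = 1 → IsUnit C := fun C hC => by
    have : IsNilpotent (1 - C) := (hn _).1 (by rw [map_sub, map_one, hC, sub_self])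
    simpa using this.isUnit_one_sub
  have h1 := h (A * B) (by rw [map_mul, hB, mul_inv_cancel₀ hA])
  have h2 := h (B * A) (by rw [map_mul, hB, inv_mul_cancel₀ hA])
  obtain ⟨u, hu⟩ := h1
  obtain ⟨v, hv⟩ := h2
  rw [isUnit_iff_exists_and_exists]
  exact ⟨⟨B * ↑u⁻¹, by rw [← mul_assoc, ← hu, Units.mul_inv]⟩,
    ⟨↑v⁻¹ * B, by rw [mul_assoc, ← hv, Units.inv_mul]⟩⟩

theorem eq_zero_of_isNilpotent_of_idem {R : Type*} [Ring R] {e : R} (he : e * e = e)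
    (hn : IsNilpotent e) : e = 0 := by
  obtain ⟨n, hn⟩ := hn
  rcases n with _ | n
  · rw [← mul_one e, ← pow_zero e, hn, mul_zero]
  · rwa [IsIdempotentElem.pow_succ_eq n he] at hn

end EndomorphismRing

/-! ### Splitting off copies of the indecomposables -/

section Systems

variable {G W : Type*} [Monoid G] [AddCommGroup W] [Module ℝ W] {ρ : Representation ℝ G W}
  {ι : Type*} {X : ι → Type*} [∀ i, AddCommGroup (X i)] [∀ i, Module ℝ (X i)]
  {τ : ∀ i, Representation ℝ G (X i)}
  {D : ι → Type*} [∀ i, DivisionRing (D i)] [∀ i, Algebra ℝ (D i)]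
  {f : ∀ i, IntertwiningMap (τ i) (τ i) →ₐ[ℝ] D i}

/-- The Krull–Schmidt argument: if `b ∘ a` were invertible, `a v b` would be an idempotent in the
local ring `End(τ j)`, hence zero or one. Zero contradicts invertibility, and one makes `a` an
isomorphism. -/
theorem map_comp_eq_zero (hf : ∀ i, Surjective (f i)) (hn : ∀ i A, f i A = 0 ↔ IsNilpotent A)
    {i j : ι} (hij : IsEmpty ((τ i).Equiv (τ j))) (a : IntertwiningMap (τ i) (τ j))
    (b : IntertwiningMap (τ j) (τ i)) : f i (b.comp a) = 0 := by
  by_contra h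
  obtain ⟨u, hu⟩ := isUnit_of_map_ne_zero (hf i) (hn i) h
  set v : IntertwiningMap (τ i) (τ i) := ↑u⁻¹ with hv
  have h1 : ∀ x, v (b (a x)) = x := fun x =>
    congrArg (fun A : IntertwiningMap (τ i) (τ i) => A x) (show v * b.comp a = 1 by simp [hv, ← hu])
  let e : IntertwiningMap (τ j) (τ j) := a.comp (v.comp b)
  have he : e * e = e := by
    ext x
    exact congrArg a (h1 _)
  have hfe : f j e * f j e = f j e := by rw [← map_mul, he]
  rcases eq_or_ne (f j e) 0 with h0 | h0
  · have := eq_zero_of_isNilpotent_of_idem he ((hn j e).1 h0)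
    refine h ?_
    have h2 : b.comp a = 0 := by
      ext x
      have h3 := congrArg (fun A : IntertwiningMap (τ j) (τ j) => b (A (a x))) this
      change b (a (v (b (a x)))) = b 0 at h3
      rw [h1, map_zero] at h3
      exact h3
    rw [h2, map_zero]
  · have h2 : f j e = 1 := mul_left_cancel₀ h0 (by rw [hfe, mul_one])
    have he' : (1 - e) * (1 - e) = 1 - e := by simp [sub_mul, mul_sub, he]
    have h3 := eq_zero_of_isNilpotent_of_idem he' ((hn j _).1 (by rw [map_sub, map_one, h2, sub_self]))
    have h4 : ∀ y, a (v (b y)) = y := fun y =>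
      congrArg (fun A : IntertwiningMap (τ j) (τ j) => A y) (sub_eq_zero.1 h3).symm
    exact hij.false (a.ofBijective ⟨LeftInverse.injective (g := fun y => v (b y)) h1,
      fun y => ⟨_, h4 y⟩⟩)

/-- The maps `q` and `p` identify the direct sum of the representations `τ i`, with multiplicities
given by the index types `K i`, with a direct summand of `ρ`. -/
structure IsSystem {K : ι → Type} (q : ∀ i, K i → IntertwiningMap (τ i) ρ)
    (p : ∀ i, K i → IntertwiningMap ρ (τ i)) : Prop where
  self : ∀ i x v, p i x (q i x v) = v
  ne : ∀ i x y, x ≠ y → ∀ v, p i x (q i y v) = 0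
  ne' : ∀ i j, i ≠ j → ∀ x y v, p i x (q j y v) = 0

/-- Sandwiched between maps to and from any of the `τ i`, the endomorphism `A` lands in the
kernel of `f i`. -/
def IsRadical (f : ∀ i, IntertwiningMap (τ i) (τ i) →ₐ[ℝ] D i) (A : IntertwiningMap ρ ρ) : Prop :=
  ∀ i (a : IntertwiningMap (τ i) ρ) (b : IntertwiningMap ρ (τ i)), f i (b.comp (A.comp a)) = 0

variable [Fintype ι] {K : ι → Type} [∀ i, Fintype (K i)]
  {q : ∀ i, K i → IntertwiningMap (τ i) ρ} {p : ∀ i, K i → IntertwiningMap ρ (τ i)}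

/-- The projection to the direct summand given by a system. -/
noncomputable def systemIdem (q : ∀ i, K i → IntertwiningMap (τ i) ρ)
    (p : ∀ i, K i → IntertwiningMap ρ (τ i)) : IntertwiningMap ρ ρ :=
  ∑ i, ∑ x, (q i x).comp (p i x)

theorem systemIdem_apply (w : W) : systemIdem q p w = ∑ i, ∑ x, q i x (p i x w) := by
  simp [systemIdem, IntertwiningMap.sum_apply]

theorem IsSystem.sum_apply [DecidableEq ι] (h : IsSystem q p) {i : ι} (x : K i)
    (v : ∀ i, K i → X i) :
    p i x (∑ j, ∑ y, q j y (v j y)) = v i x := by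
  rw [map_sum, Finset.sum_eq_single i, map_sum, Finset.sum_eq_single x, h.self]
  · exact fun y _ hy => h.ne _ _ _ hy.symm _
  · simp
  · intro j _ hj
    rw [map_sum]
    exact Finset.sum_eq_zero fun y _ => h.ne' _ _ hj.symm _ _ _
  · simp

theorem IsSystem.p_systemIdem (h : IsSystem q p) {i : ι} (x : K i) (w : W) :
    p i x (systemIdem q p w) = p i x w := by
  classical
  rw [systemIdem_apply, h.sum_apply x fun i x => p i x w]

theorem IsSystem.idem (h : IsSystem q p) : systemIdem q p * systemIdem q p = systemIdem q p := by
  ext w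
  change systemIdem q p (systemIdem q p w) = systemIdem q p w
  conv_lhs => rw [systemIdem_apply]
  simp only [h.p_systemIdem]
  rw [← systemIdem_apply]

theorem isSystem_reindex {K' : ι → Type} [∀ i, Fintype (K' i)] (σ : ∀ i, K' i ≃ K i)
    (h : IsSystem q p) : IsSystem (fun i x => q i (σ i x)) (fun i x => p i (σ i x)) :=
  ⟨fun i _ => h.self i _, fun i _ _ hxy => h.ne i _ _ ((σ i).injective.ne hxy),
    fun i j hij _ _ => h.ne' i j hij _ _⟩

theorem systemIdem_reindex {K' : ι → Type} [∀ i, Fintype (K' i)] (σ : ∀ i, K' i ≃ K i) :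
    systemIdem (fun i x => q i (σ i x)) (fun i x => p i (σ i x)) = systemIdem q p :=
  Finset.sum_congr rfl fun i _ => (σ i).sum_comp fun x => (q i x).comp (p i x)

/-- Every idempotent contains the projection to a direct summand which exhausts it up to the
radical. -/
theorem exists_isSystem [FiniteDimensional ℝ W] (hf : ∀ i, Surjective (f i))
    (hn : ∀ i A, f i A = 0 ↔ IsNilpotent A) (e : IntertwiningMap ρ ρ) (he : e * e = e) :
    ∃ (K : ι → Type) (_ : ∀ i, Fintype (K i)) (q : ∀ i, K i → IntertwiningMap (τ i) ρ)
      (p : ∀ i, K i → IntertwiningMap ρ (τ i)), IsSystem q p ∧ (∀ i x v, e (q i x v) = q i x v) ∧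
        (∀ i x w, p i x (e w) = p i x w) ∧ IsRadical f (e - systemIdem q p) := by
  classical
  induction h : Module.finrank ℝ (LinearMap.range e.toLinearMap) using
    Nat.strong_induction_on generalizing e with
  | _ n ih =>
  have heq : ∀ w, e (e w) = e w := fun w =>
    congrArg (fun A : IntertwiningMap ρ ρ => A w) he
  by_cases hr : IsRadical f e
  · refine ⟨fun _ => Empty, inferInstance, fun i x => x.elim, fun i x => x.elim,
      ⟨fun i x => x.elim, fun i x => x.elim, fun i j _ x => x.elim⟩, fun i x => x.elim,
      fun i x => x.elim, ?_⟩
    have : systemIdem (ρ := ρ) (τ := τ) (K := fun _ => Empty) (fun i x => x.elim)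
        (fun i x => x.elim) = 0 := by simp [systemIdem]
    rw [this, sub_zero]
    exact hr
  · unfold IsRadical at hr
    push Not at hr
    obtain ⟨i, a, b, hab⟩ := hr
    obtain ⟨u, hu⟩ := isUnit_of_map_ne_zero (hf i) (hn i) hab
    set v : IntertwiningMap (τ i) (τ i) := ↑u⁻¹ with hv
    have hvu : ∀ x, v (b (e (a x))) = x := fun x =>
      congrArg (fun A : IntertwiningMap (τ i) (τ i) => A x)
        (show v * b.comp (e.comp a) = 1 by simp [hv, ← hu])
    let a₀ : IntertwiningMap (τ i) ρ := e.comp a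
    let b₀ : IntertwiningMap ρ (τ i) := v.comp (b.comp e)
    have hba : ∀ x, b₀ (a₀ x) = x := fun x => by
      change v (b (e (e (a x)))) = x
      rw [heq, hvu]
    have hea : ∀ x, e (a₀ x) = a₀ x := fun x => heq _
    have hbe : ∀ w, b₀ (e w) = b₀ w := fun w => congrArg (fun z => v (b z)) (heq w)
    -- `a₀ ∘ b₀` projects onto a copy of `τ i` inside the range of `e`. Removing it leaves an
    -- idempotent of smaller rank, since `X i` is nonzero.
    let e' := e - a₀.comp b₀
    have he'a : ∀ w, e' w = e w - a₀ (b₀ w) := fun w => rfl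
    have he' : e' * e' = e' := by
      ext w
      change e' (e' w) = e' w
      simp only [he'a, map_sub, heq, hea, hbe, hba]
      abel
    have hba' : ∀ w, b₀ (e' w) = 0 := fun w => by
      rw [he'a, map_sub, hbe, hba, sub_self]
    have hea' : ∀ x, e' (a₀ x) = 0 := fun x => by
      rw [he'a, hea, hba, sub_self]
    have hee' : ∀ w, e (e' w) = e' w := fun w => by
      rw [he'a, map_sub, heq, hea]
    have he'e : ∀ w, e' (e w) = e' w := fun w => by
      rw [he'a, he'a, hbe, heq]
    have hlt : LinearMap.range e'.toLinearMap < LinearMap.range e.toLinearMap := by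
      refine lt_of_le_of_ne ?_ fun heq' => ?_
      · rintro _ ⟨w, rfl⟩
        exact ⟨e' w, hee' w⟩
      · have hX : ∀ x : X i, x = 0 := fun x => by
          have h1 : a₀ x ∈ LinearMap.range e'.toLinearMap := by
            rw [heq']
            exact ⟨a₀ x, hea x⟩
          obtain ⟨w, hw⟩ := h1
          rw [← hba x, ← hw]
          exact hba' w
        refine hab ?_
        have : b.comp (e.comp a) = 0 := by
          ext x
          exact hX _
        rw [this, map_zero]
    obtain ⟨K, hK, q, p, hs, hq, hp, hr⟩ := ih _ (h ▸ Submodule.finrank_lt_finrank_of_lt hlt) e' he' rfl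
    let q' : ∀ j, K j ⊕ {_u : Unit // j = i} → IntertwiningMap (τ j) ρ := fun j x =>
      Sum.elim (q j) (fun h : {_u : Unit // j = i} => h.2.symm ▸ a₀) x
    let p' : ∀ j, K j ⊕ {_u : Unit // j = i} → IntertwiningMap ρ (τ j) := fun j x =>
      Sum.elim (p j) (fun h : {_u : Unit // j = i} => h.2.symm ▸ b₀) x
    have hpa : ∀ j x z, p j x (a₀ z) = 0 := fun j x z => by
      rw [← hp, hea', map_zero]
    have hbq : ∀ j x z, b₀ (q j x z) = 0 := fun j x z => by
      rw [← hq, hba']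
    refine ⟨fun j => K j ⊕ {_u : Unit // j = i}, fun j => inferInstance, q', p', ⟨?_, ?_, ?_⟩, ?_, ?_, ?_⟩
    · rintro j (x | ⟨_, rfl⟩) z
      · exact hs.self j x z
      · exact hba z
    · rintro j (x | ⟨_, rfl⟩) (y | ⟨_, hj⟩) hxy z
      · exact hs.ne j x y (fun h => hxy (congrArg _ h)) z
      · subst hj
        exact hpa _ x z
      · exact hbq _ y z
      · exact absurd rfl hxy
    · rintro j k hjk (x | ⟨_, rfl⟩) (y | ⟨_, rfl⟩) z
      · exact hs.ne' j k hjk x y z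
      · exact hpa _ x z
      · exact hbq _ y z
      · exact absurd rfl hjk
    · rintro j (x | ⟨_, rfl⟩) z
      · change e (q j x z) = q j x z
        rw [← hq, hee']
      · exact hea z
    · rintro j (x | ⟨_, rfl⟩) w
      · change p j x (e w) = p j x w
        rw [← hp, he'e, hp]
      · exact hbe w
    · have : e - systemIdem q' p' = e' - systemIdem q p := by
        have h1 : systemIdem q' p' = systemIdem q p + a₀.comp b₀ := by
          simp only [systemIdem, Fintype.sum_sum_type, Finset.sum_add_distrib]
          congr 1
          rw [Finset.sum_eq_single i]
          · exact (Fintype.sum_subsingleton _ ⟨(), rfl⟩).trans rfl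
          · intro j _ hj
            have : IsEmpty ({_u : Unit // j = i}) := ⟨fun h => hj h.2⟩
            simp
          · simp
        rw [h1]
        change e - _ = e - _ - _
        abel
      rw [this]
      exact hr

theorem exists_isSystem_fin [FiniteDimensional ℝ W] (hf : ∀ i, Surjective (f i))
    (hn : ∀ i A, f i A = 0 ↔ IsNilpotent A) (e : IntertwiningMap ρ ρ) (he : e * e = e) :
    ∃ (n : ι → ℕ) (q : ∀ i, Fin (n i) → IntertwiningMap (τ i) ρ)
      (p : ∀ i, Fin (n i) → IntertwiningMap ρ (τ i)), IsSystem q p ∧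
        (∀ i x v, e (q i x v) = q i x v) ∧
        (∀ i x w, p i x (e w) = p i x w) ∧ IsRadical f (e - systemIdem q p) := by
  obtain ⟨K, hK, q, p, hs, hq, hp, hr⟩ := exists_isSystem hf hn e he
  refine ⟨fun i => Fintype.card (K i), _, _,
    isSystem_reindex (fun i => (Fintype.equivFin (K i)).symm) hs, fun i _ => hq i _,
    fun i _ => hp i _, ?_⟩
  rwa [systemIdem_reindex]

end Systems

/-! ### The morphism from `End(W)` to matrices over the residue algebras -/

section SystemHom

variable {G W : Type*} [Monoid G] [AddCommGroup W] [Module ℝ W] {ρ : Representation ℝ G W}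
  {ι : Type*} {X : ι → Type*} [∀ i, AddCommGroup (X i)] [∀ i, Module ℝ (X i)]
  {τ : ∀ i, Representation ℝ G (X i)}
  {D : ι → Type*} [∀ i, DivisionRing (D i)] [∀ i, Algebra ℝ (D i)]
  {f : ∀ i, IntertwiningMap (τ i) (τ i) →ₐ[ℝ] D i}
  [Fintype ι] {K : ι → Type} [∀ i, Fintype (K i)]
  {q : ∀ i, K i → IntertwiningMap (τ i) ρ} {p : ∀ i, K i → IntertwiningMap ρ (τ i)}

theorem IsRadical.map_comp_systemIdem {A : IntertwiningMap ρ ρ}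
    (h : IsRadical f (A - systemIdem q p)) {i : ι} (a : IntertwiningMap (τ i) ρ)
    (b : IntertwiningMap ρ (τ i)) :
    f i (b.comp ((systemIdem q p).comp a)) = f i (b.comp (A.comp a)) := by
  have h1 : b.comp ((A - systemIdem q p).comp a) =
      b.comp (A.comp a) - b.comp ((systemIdem q p).comp a) := by
    ext v
    exact map_sub b _ _
  have h2 := h i a b
  rw [h1, map_sub, sub_eq_zero] at h2
  exact h2.symm

/-- Passing through copies of `τ j` with `j ≠ i` is invisible to `f i`, by `map_comp_eq_zero`.
Together with the radical hypothesis this makes `systemHom` multiplicative. -/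
theorem map_comp_systemIdem_eq_sum (hf : ∀ i, Surjective (f i))
    (hn : ∀ i A, f i A = 0 ↔ IsNilpotent A)
    (hne : Pairwise fun i j => IsEmpty ((τ i).Equiv (τ j))) {i : ι} (a : IntertwiningMap (τ i) ρ)
    (b : IntertwiningMap ρ (τ i)) : f i (b.comp ((systemIdem q p).comp a)) =
      ∑ x, f i (b.comp (q i x)) * f i ((p i x).comp a) := by
  classical
  have h : b.comp ((systemIdem q p).comp a) =
      ∑ j, ∑ x, (b.comp (q j x)).comp ((p j x).comp a) := by
    ext v
    simp [systemIdem_apply, IntertwiningMap.sum_apply]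
  rw [h, map_sum, Finset.sum_eq_single i]
  · rw [map_sum]
    exact Finset.sum_congr rfl fun x _ => map_mul (f i) _ _
  · intro j _ hj
    rw [map_sum]
    exact Finset.sum_eq_zero fun x _ => map_comp_eq_zero hf hn (hne hj.symm) _ _
  · simp

variable [∀ i, DecidableEq (K i)]

/-- The endomorphism algebra acts on the multiplicity spaces of the `τ i` in `ρ`. -/
noncomputable def systemHom (hs : IsSystem q p) (hf : ∀ i, Surjective (f i))
    (hn : ∀ i A, f i A = 0 ↔ IsNilpotent A)
    (hne : Pairwise fun i j => IsEmpty ((τ i).Equiv (τ j)))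
    (hr : IsRadical f (1 - systemIdem q p)) (i : ι) :
    IntertwiningMap ρ ρ →ₐ[ℝ] Matrix (K i) (K i) (D i) :=
  AlgHom.ofLinearMap
    { toFun := fun A => .of fun x y => f i ((p i x).comp (A.comp (q i y)))
      map_add' := fun A B => by
        ext x y
        rw [Matrix.add_apply, Matrix.of_apply, Matrix.of_apply, Matrix.of_apply, ← map_add]
        congr 1
        ext v
        simp
      map_smul' := fun c A => by
        ext x y
        rw [Matrix.smul_apply, Matrix.of_apply, Matrix.of_apply, RingHom.id_apply, ← map_smul]
        congr 1
        ext v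
        simp }
    (by
      ext x y
      change f i ((p i x).comp ((1 : IntertwiningMap ρ ρ).comp (q i y))) = _
      rcases eq_or_ne x y with rfl | h
      · rw [Matrix.one_apply_eq, ← map_one (f i)]
        congr 1
        ext v
        exact hs.self i x v
      · rw [Matrix.one_apply_ne h, ← map_zero (f i)]
        congr 1
        ext v
        exact hs.ne i x y h v)
    (fun A B => by
      ext x y
      rw [Matrix.mul_apply]
      change f i ((p i x).comp ((A * B).comp (q i y))) =
        ∑ z, f i ((p i x).comp (A.comp (q i z))) * f i ((p i z).comp (B.comp (q i y)))
      have h1 := map_comp_systemIdem_eq_sum (q := q) (p := p) hf hn hne (B.comp (q i y))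
        ((p i x).comp A)
      have h2 := hr.map_comp_systemIdem (B.comp (q i y)) ((p i x).comp A)
      exact (h1.symm.trans h2).symm)

variable (hs : IsSystem q p) (hf : ∀ i, Surjective (f i))
    (hn : ∀ i A, f i A = 0 ↔ IsNilpotent A)
    (hne : Pairwise fun i j => IsEmpty ((τ i).Equiv (τ j)))
    (hr : IsRadical f (1 - systemIdem q p))

theorem systemHom_apply (i : ι) (A : IntertwiningMap ρ ρ) (x y : K i) :
    systemHom hs hf hn hne hr i A x y = f i ((p i x).comp (A.comp (q i y))) := rfl

theorem exists_systemHom_eq (M : ∀ i, Matrix (K i) (K i) (D i)) :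
    ∃ A, ∀ i, systemHom hs hf hn hne hr i A = M i := by
  classical
  choose l hl using fun i x y => hf i (M i x y)
  refine ⟨∑ i, ∑ x, (q i x).comp (∑ y, (l i x y).comp (p i y)), fun i => ?_⟩
  ext x y
  rw [systemHom_apply, ← hl]
  congr 1
  ext v
  have h1 : ∀ j x', (∑ y', (l j x' y').comp (p j y')) (q i y v) =
      ∑ y', l j x' y' (p j y' (q i y v)) := fun j x' => by
    simp [IntertwiningMap.sum_apply]
  have h2 : (∑ j, ∑ x, (q j x).comp (∑ y, (l j x y).comp (p j y))) (q i y v) =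
      ∑ j, ∑ x', q j x' (∑ y', l j x' y' (p j y' (q i y v))) := by
    simp [IntertwiningMap.sum_apply]
  change p i x ((∑ j, ∑ x, (q j x).comp (∑ y, (l j x y).comp (p j y))) (q i y v)) = l i x y v
  rw [h2, hs.sum_apply x fun j x' => ∑ y', l j x' y' (p j y' (q i y v)),
    Finset.sum_eq_single y, hs.self]
  · intro y' _ hy
    rw [hs.ne _ _ _ hy, map_zero]
  · simp

theorem systemHom_eq_zero {A : IntertwiningMap ρ ρ} (hA : IsRadical f A) (i : ι) :
    systemHom hs hf hn hne hr i A = 0 := by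
  ext x y
  exact hA i _ _

theorem hasRank_systemHom_systemIdem {K' : ι → Type} [∀ i, Fintype (K' i)]
    [∀ i, DecidableEq (K' i)]
    {q' : ∀ i, K' i → IntertwiningMap (τ i) ρ} {p' : ∀ i, K' i → IntertwiningMap ρ (τ i)}
    (hs' : IsSystem q' p') (i : ι) :
    HasRank (systemHom hs hf hn hne hr i (systemIdem q' p')) (Fintype.card (K' i)) := by
  let Q : Matrix (K i) (K' i) (D i) := .of fun x y => f i ((p i x).comp (q' i y))
  let s : Matrix (K' i) (K i) (D i) := .of fun x y => f i ((p' i x).comp (q i y))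
  have hsQ : s * Q = 1 := by
    ext x y
    rw [Matrix.mul_apply]
    change ∑ z, f i ((p' i x).comp (q i z)) * f i ((p i z).comp (q' i y)) = _
    rw [← map_comp_systemIdem_eq_sum hf hn hne, hr.map_comp_systemIdem]
    change f i ((p' i x).comp (q' i y)) = _
    rcases eq_or_ne x y with rfl | h
    · rw [Matrix.one_apply_eq, ← map_one (f i)]
      congr 1
      ext v
      exact hs'.self i x v
    · rw [Matrix.one_apply_ne h, ← map_zero (f i)]
      congr 1
      ext v
      exact hs'.ne i x y h v
  refine IsRankFactorization.hasRank (Q := Q) (s := s) ⟨⟨s, hsQ⟩, ⟨Q, hsQ⟩, ?_⟩ rfl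
  ext x y
  rw [Matrix.mul_apply, systemHom_apply, map_comp_systemIdem_eq_sum hf hn hne]
  rfl

end SystemHom

/-! ### Direct summands and systems -/

section Summands

variable {G W : Type*} [Monoid G] [AddCommGroup W] [Module ℝ W] {ρ : Representation ℝ G W}
  {ι : Type*} {X : ι → Type*} [∀ i, AddCommGroup (X i)] [∀ i, Module ℝ (X i)]
  {τ : ∀ i, Representation ℝ G (X i)} [Fintype ι] {K : ι → Type} [∀ i, Fintype (K i)]
  {q : ∀ i, K i → IntertwiningMap (τ i) ρ} {p : ∀ i, K i → IntertwiningMap ρ (τ i)}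

/-- Any summand given by a system is a direct sum of copies of the `τ i`. -/
theorem IsSystem.nonempty_equiv (hs : IsSystem q p) {S : Subrepresentation ρ}
    (hS : S.toSubmodule = LinearMap.range (systemIdem q p).toLinearMap) :
    Nonempty (S.toRepresentation.Equiv
      (Representation.directSum fun k : (i : ι) × K i => τ k.1)) := by
  classical
  have hmem : ∀ v : S.toSubmodule, systemIdem q p v = v := by
    rintro ⟨v, hv⟩
    rw [hS] at hv
    obtain ⟨w, rfl⟩ := hv
    exact congrArg (fun A : IntertwiningMap ρ ρ => A w) hs.idem
  let φ : S.toSubmodule →ₗ[ℝ] DirectSum ((i : ι) × K i) fun k => X k.1 :=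
    ∑ k : (i : ι) × K i, DirectSum.lof ℝ _ (fun k : (i : ι) × K i => X k.1) k ∘ₗ
      (p k.1 k.2).toLinearMap ∘ₗ S.toSubmodule.subtype
  have hφ : ∀ v k, φ v k = p k.1 k.2 v := by
    intro v k
    simp only [φ, LinearMap.sum_apply, LinearMap.comp_apply, DirectSum.sum_apply]
    rw [Finset.sum_eq_single k]
    · exact DirectSum.lof_apply ..
    · intro l _ hl
      exact DirectSum.of_eq_of_ne _ _ _ hl.symm
    · simp
  let Φ : IntertwiningMap S.toRepresentation
      (Representation.directSum fun k : (i : ι) × K i => τ k.1) :=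
    ⟨φ, fun g => by
      ext v k
      change φ (S.toRepresentation g v) k = _
      rw [hφ]
      change p k.1 k.2 (ρ g v) = τ k.1 g (φ v k)
      rw [hφ, IntertwiningMap.isIntertwining]⟩
  refine ⟨Φ.ofBijective ⟨?_, fun y => ?_⟩⟩
  · refine (injective_iff_map_eq_zero φ).2 fun v hv => Subtype.ext ?_
    rw [← hmem v, systemIdem_apply]
    refine Finset.sum_eq_zero fun i _ => Finset.sum_eq_zero fun x _ => ?_
    have := hφ v ⟨i, x⟩
    rw [hv] at this
    rw [← this]
    exact map_zero _
  · have h0 : systemIdem q p (∑ i, ∑ x, q i x (y ⟨i, x⟩)) = ∑ i, ∑ x, q i x (y ⟨i, x⟩) := by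
      rw [systemIdem_apply]
      simp only [hs.sum_apply _ fun i x => y ⟨i, x⟩]
    refine ⟨⟨∑ i, ∑ x, q i x (y ⟨i, x⟩), by rw [hS]; exact ⟨_, h0⟩⟩, ?_⟩
    refine DFinsupp.ext fun k => ?_
    exact (hφ _ k).trans (hs.sum_apply k.2 fun i x => y ⟨i, x⟩)

theorem exists_isSystem_of_equiv {S : Subrepresentation ρ} {e : IntertwiningMap ρ ρ}
    (he : e * e = e) (hS : S.toSubmodule = LinearMap.range e.toLinearMap)
    (φ : S.toRepresentation.Equiv (Representation.directSum fun k : (i : ι) × K i => τ k.1)) :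
    ∃ (q : ∀ i, K i → IntertwiningMap (τ i) ρ) (p : ∀ i, K i → IntertwiningMap ρ (τ i)),
      IsSystem q p ∧ systemIdem q p = e := by
  classical
  have hmem : ∀ v : S.toSubmodule, e v = v := by
    rintro ⟨v, hv⟩
    rw [hS] at hv
    obtain ⟨w, rfl⟩ := hv
    exact congrArg (fun A : IntertwiningMap ρ ρ => A w) he
  let r : W →ₗ[ℝ] S.toSubmodule := e.toLinearMap.codRestrict _ fun w => by
    rw [hS]
    exact ⟨w, rfl⟩
  have hr : ∀ v : S.toSubmodule, r v = v := fun v => Subtype.ext (hmem v)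
  have hrg : ∀ g w, r (ρ g w) = S.toRepresentation g (r w) := fun g w =>
    Subtype.ext (IntertwiningMap.isIntertwining ρ ρ e g w)
  let q : ∀ i, K i → IntertwiningMap (τ i) ρ := fun i x =>
    ⟨S.toSubmodule.subtype ∘ₗ φ.symm.toLinearMap ∘ₗ
      DirectSum.lof ℝ _ (fun k : (i : ι) × K i => X k.1) ⟨i, x⟩, fun g => by
        ext v
        have h1 : DirectSum.lof ℝ _ (fun k : (i : ι) × K i => X k.1) ⟨i, x⟩ (τ i g v) =
            Representation.directSum (fun k : (i : ι) × K i => τ k.1) g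
              (DirectSum.lof ℝ _ (fun k : (i : ι) × K i => X k.1) ⟨i, x⟩ v) :=
          (DirectSum.lmap_lof (fun k : (i : ι) × K i => τ k.1 g) ⟨i, x⟩ v).symm
        change (φ.symm (DirectSum.lof ℝ _ (fun k : (i : ι) × K i => X k.1) ⟨i, x⟩ (τ i g v))).1 = _
        rw [h1]
        exact congrArg Subtype.val (IntertwiningMap.isIntertwining _ _ φ.symm.toIntertwiningMap g _)⟩
  let p : ∀ i, K i → IntertwiningMap ρ (τ i) := fun i x =>
    ⟨DirectSum.component ℝ _ (fun k : (i : ι) × K i => X k.1) ⟨i, x⟩ ∘ₗ φ.toLinearMap ∘ₗ r,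
      fun g => by
        ext w
        change φ (r (ρ g w)) ⟨i, x⟩ = τ i g (φ (r w) ⟨i, x⟩)
        rw [hrg]
        have := IntertwiningMap.isIntertwining _ _ φ.toIntertwiningMap g (r w)
        exact congrArg (fun y : DirectSum _ _ => y ⟨i, x⟩) this⟩
  have hpq : ∀ i x j y v, p i x (q j y v) =
      DirectSum.lof ℝ _ (fun k : (i : ι) × K i => X k.1) ⟨j, y⟩ v ⟨i, x⟩ := by
    intro i x j y v
    change φ (r (φ.symm _).1) ⟨i, x⟩ = _
    rw [hr, φ.apply_symm_apply]
  refine ⟨q, p, ⟨?_, ?_, ?_⟩, ?_⟩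
  · intro i x v
    rw [hpq]
    exact DirectSum.lof_apply (R := ℝ) (M := fun k : (i : ι) × K i => X k.1) ⟨i, x⟩ v
  · intro i x y hxy v
    rw [hpq]
    exact DirectSum.of_eq_of_ne _ _ _ fun h => hxy (by simpa using h)
  · intro i j hij x y v
    rw [hpq]
    exact DirectSum.of_eq_of_ne _ _ _ fun h => hij (congrArg Sigma.fst h)
  · ext w
    change systemIdem q p w = e w
    rw [systemIdem_apply]
    have h1 : ∀ i x, q i x (p i x w) =
        (φ.symm (DirectSum.of (fun k : (i : ι) × K i => X k.1) ⟨i, x⟩ (φ (r w) ⟨i, x⟩))).1 :=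
      fun i x => rfl
    simp only [h1]
    rw [← Fintype.sum_sigma' (fun i x => (φ.symm (DirectSum.of
        (fun k : (i : ι) × K i => X k.1) ⟨i, x⟩ (φ (r w) ⟨i, x⟩))).1)]
    have h2 := DirectSum.sum_univ_of (φ (r w))
    have h3 : φ.symm (φ (r w)) = r w := φ.symm_apply_apply _
    rw [← h2, map_sum] at h3
    have h4 := congrArg Subtype.val h3
    rw [AddSubmonoidClass.coe_finsetSum] at h4
    exact h4

theorem exists_idem_of_isCompl {U U' : Subrepresentation ρ}
    (h : IsCompl U.toSubmodule U'.toSubmodule) :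
    ∃ e : IntertwiningMap ρ ρ, e * e = e ∧ U.toSubmodule = LinearMap.range e.toLinearMap := by
  refine ⟨⟨U.toSubmodule.projection U'.toSubmodule h, fun g => ?_⟩, ?_, ?_⟩
  · ext w
    change U.toSubmodule.projection _ h (ρ g w) = ρ g (U.toSubmodule.projection _ h w)
    have h1 := Submodule.projection_add_projection_eq_self h w
    conv_lhs => rw [← h1]
    rw [map_add, map_add]
    have h2 := U.apply_mem_toSubmodule g (Submodule.projection_apply_mem h w)
    have h3 := U'.apply_mem_toSubmodule g (Submodule.projection_apply_mem h.symm w)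
    rw [Submodule.projection_apply_left h ⟨_, h2⟩, Submodule.projection_apply_right h ⟨_, h3⟩,
      add_zero]
  · exact IntertwiningMap.ext (Submodule.isIdempotentElem_projection h)
  · exact (Submodule.range_projection h).symm

end Summands

/-! ### Spectral idempotents project onto the generalized kernel and the center subspace -/

section GeneralizedEigenspaces

theorem eq_zero_of_mem_maxGenEigenspace {F V : Type*} [Field F] [AddCommGroup V] [Module F V]
    {T : Module.End F V} {μ : F} {v : V} (hv : v ∈ T.maxGenEigenspace μ) {g : F[X]}
    (hg : eval μ g ≠ 0) (h : aeval T g v = 0) : v = 0 := by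
  rw [Module.End.mem_maxGenEigenspace] at hv
  obtain ⟨k, hk⟩ := hv
  have hc : IsCoprime ((X - C μ) ^ k) g := by
    refine IsCoprime.pow_left ((irreducible_X_sub_C μ).coprime_iff_not_dvd.2 ?_)
    rwa [dvd_iff_isRoot]
  obtain ⟨a, b, hab⟩ := hc
  have h1 := congrArg (fun P => aeval T P v) hab
  simp only [map_add, map_mul, map_one, LinearMap.add_apply, Module.End.mul_apply, h, map_zero,
    map_pow, map_sub, aeval_X, aeval_C, add_zero, Module.End.one_apply,
    Module.algebraMap_end_eq_smul_id] at h1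
  have h2 : (T - μ • LinearMap.id) ^ k = (T - μ • 1) ^ k := rfl
  rw [h2, hk, map_zero] at h1
  exact h1.symm

variable {V : Type*} [AddCommGroup V] [Module ℝ V]

theorem IsSpectralIdem.range_eq_maxGenEigenspace {T e : Module.End ℝ V}
    (h : IsSpectralIdem {0} T e) : LinearMap.range e = T.maxGenEigenspace 0 := by
  obtain ⟨h1, h2, ⟨p, hp, hpe⟩, ⟨q, hq, hqe⟩⟩ := h
  apply le_antisymm
  · rintro _ ⟨v, rfl⟩
    obtain ⟨c, k, hc, rfl⟩ := exists_eq_C_mul_X_pow hp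
    rw [Module.End.mem_maxGenEigenspace]
    refine ⟨k, ?_⟩
    have := congrArg (fun A : Module.End ℝ V => A v) hpe
    simp only [map_mul, aeval_C, map_pow, aeval_X, Module.algebraMap_end_eq_smul_id,
      Module.End.mul_apply, LinearMap.smul_apply, LinearMap.id_apply, LinearMap.zero_apply,
      smul_eq_zero] at this
    rw [zero_smul, sub_zero]
    exact this.resolve_left hc
  · intro v hv
    have h3 : (1 - e) v = 0 := by
      refine eq_zero_of_mem_maxGenEigenspace (T := T) (μ := 0) (g := q) ?_ ?_ ?_
      · exact Module.End.mapsTo_maxGenEigenspace_of_comm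
          ((Commute.one_right T).sub_right h2) 0 hv
      · intro h0
        refine hq 0 rfl ?_
        rw [← map_zero (algebraMap ℝ ℂ), aeval_algebraMap_apply, coe_aeval_eq_eval, h0, map_zero]
      · exact congrArg (fun A : Module.End ℝ V => A v) hqe
    exact ⟨v, (sub_eq_zero.1 h3).symm⟩

variable [FiniteDimensional ℝ V]

theorem aeval_baseChange (T : Module.End ℝ V) (g : ℝ[X]) :
    aeval (LinearMap.baseChange ℂ T : Module.End ℂ (ℂ ⊗[ℝ] V)) (g.map (algebraMap ℝ ℂ)) =
      LinearMap.baseChange ℂ (aeval T g) := by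
  rw [aeval_map_algebraMap]
  exact aeval_algHom_apply (Module.End.baseChangeHom ℝ ℂ V) T g

/-- The complexification is spanned by generalized eigenspaces. The complexified `e` is the identity
on those with imaginary eigenvalue and zero on the others. -/
theorem IsSpectralIdem.mem_complexCenter_iff {T e : Module.End ℝ V}
    (h : IsSpectralIdem imAxis T e) {x : ℂ ⊗[ℝ] V} :
    x ∈ complexCenter T ↔ LinearMap.baseChange ℂ e x = x := by
  obtain ⟨h1, h2, ⟨p, hp, hpe⟩, ⟨q, hq, hqe⟩⟩ := h
  have hc : Commute (LinearMap.baseChange ℂ T : Module.End ℂ (ℂ ⊗[ℝ] V))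
      (LinearMap.baseChange ℂ e) := h2.map (Module.End.baseChangeHom ℝ ℂ V)
  have hin : ∀ (μ : ℂ), μ.re = 0 → ∀ y ∈ Module.End.maxGenEigenspace (LinearMap.baseChange ℂ T) μ,
      LinearMap.baseChange ℂ e y = y := by
    intro μ hμ y hy
    have h3 : (1 - LinearMap.baseChange ℂ e : Module.End ℂ (ℂ ⊗[ℝ] V)) y = 0 := by
      refine eq_zero_of_mem_maxGenEigenspace (T := LinearMap.baseChange ℂ T) (μ := μ)
        (g := q.map (algebraMap ℝ ℂ)) ?_ ?_ ?_
      · exact Module.End.mapsTo_maxGenEigenspace_of_comm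
          ((Commute.one_right _).sub_right hc) μ hy
      · rw [eval_map_algebraMap]
        exact hq μ hμ
      · rw [aeval_baseChange]
        have := congrArg (Module.End.baseChangeHom ℝ ℂ V) hqe
        rw [map_mul, map_sub, map_one, map_zero] at this
        exact congrArg (fun A : Module.End ℂ (ℂ ⊗[ℝ] V) => A y) this
    exact (sub_eq_zero.1 h3).symm
  have hout : ∀ (μ : ℂ), μ.re ≠ 0 → ∀ y ∈ Module.End.maxGenEigenspace (LinearMap.baseChange ℂ T) μ,
      LinearMap.baseChange ℂ e y = 0 := by
    intro μ hμ y hy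
    refine eq_zero_of_mem_maxGenEigenspace (T := LinearMap.baseChange ℂ T) (μ := μ)
        (g := p.map (algebraMap ℝ ℂ)) ?_ ?_ ?_
    · exact Module.End.mapsTo_maxGenEigenspace_of_comm hc μ hy
    · rw [eval_map_algebraMap]
      exact fun h => hμ (hp μ h)
    · rw [aeval_baseChange]
      have := congrArg (Module.End.baseChangeHom ℝ ℂ V) hpe
      rw [map_mul, map_zero] at this
      exact congrArg (fun A : Module.End ℂ (ℂ ⊗[ℝ] V) => A y) this
  constructor
  · intro hx
    have hle : complexCenter T ≤
        LinearMap.ker (LinearMap.baseChange ℂ e - 1 : Module.End ℂ (ℂ ⊗[ℝ] V)) :=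
      iSup_le fun μ y hy => by
        rw [LinearMap.mem_ker, LinearMap.sub_apply, hin μ μ.2 y hy]
        exact sub_self y
    have := hle hx
    rw [LinearMap.mem_ker, LinearMap.sub_apply, sub_eq_zero] at this
    exact this
  · intro hx
    have hle : (⊤ : Submodule ℂ (ℂ ⊗[ℝ] V)) ≤ (complexCenter T).comap (LinearMap.baseChange ℂ e) := by
      rw [← Module.End.iSup_maxGenEigenspace_eq_top (LinearMap.baseChange ℂ T)]
      refine iSup_le fun μ y hy => ?_
      rw [Submodule.mem_comap]
      by_cases hμ : μ.re = 0
      · rw [hin μ hμ y hy]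
        exact (le_iSup (fun μ : {z : ℂ // z.re = 0} =>
          Module.End.maxGenEigenspace (LinearMap.baseChange ℂ T) (μ : ℂ)) ⟨μ, hμ⟩) hy
      · rw [hout μ hμ y hy]
        exact Submodule.zero_mem _
    rw [← hx]
    exact hle (Submodule.mem_top (x := x))

variable {G : Type*} [Monoid G] {ρ : Representation ℝ G V}

/-- The algebra morphism forgetting equivariance. -/
def toEndAlgHom (ρ : Representation ℝ G V) : IntertwiningMap ρ ρ →ₐ[ℝ] Module.End ℝ V :=
  AlgHom.ofLinearMap (IntertwiningMap.toLinearMapl ρ ρ) rfl fun _ _ => rfl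

theorem IsSpectralIdem.genKer_eq {A e : IntertwiningMap ρ ρ} (h : IsSpectralIdem {0} A e) :
    (genKer A).toSubmodule = LinearMap.range e.toLinearMap :=
  (h.map (toEndAlgHom ρ)).range_eq_maxGenEigenspace.symm

theorem IsSpectralIdem.centerSubspace_eq {A e : IntertwiningMap ρ ρ}
    (h : IsSpectralIdem imAxis A e) :
    (centerSubspace A).toSubmodule = LinearMap.range e.toLinearMap := by
  ext v
  have h1 := (h.map (toEndAlgHom ρ)).mem_complexCenter_iff (x := (1 : ℂ) ⊗ₜ[ℝ] v)
  rw [LinearMap.baseChange_tmul] at h1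
  have h2 := (Module.FaithfullyFlat.tensorProduct_mk_injective (A := ℝ) (B := ℂ) V).eq_iff
    (a := e v) (b := v)
  refine (h1.trans h2).trans ⟨fun hv => ⟨v, hv⟩, ?_⟩
  rintro ⟨w, rfl⟩
  exact congrArg (fun A : IntertwiningMap ρ ρ => A w) h.1

end GeneralizedEigenspaces

/-! ### Modifying a spectral idempotent -/

section SpectralIdempotentLemmas

variable {R : Type*} [Ring R] [Algebra ℝ R]

theorem aeval_mul_eq_of_mul_eq {A B c : R} (h : A * c = B * c) (hc : Commute B c) (g : ℝ[X]) :
    aeval A g * c = aeval B g * c := by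
  induction g using Polynomial.induction_on' with
  | add p q hp hq => rw [map_add, map_add, add_mul, add_mul, hp, hq]
  | monomial n a =>
    rw [aeval_monomial, aeval_monomial, mul_assoc, mul_assoc]
    congr 1
    induction n with
    | zero => simp
    | succ n ih => rw [pow_succ, mul_assoc, h, hc.eq, ← mul_assoc, ih, mul_assoc, ← hc.eq,
        ← mul_assoc, ← pow_succ]

theorem IsSpectralIdem.mul_eq_zero {Z : Set ℂ} {A e c : R} (h : IsSpectralIdem Z A e)
    {g : ℝ[X]} (hg : ∀ z ∈ Z, aeval z g ≠ 0) (hc : aeval A g * c = 0) : e * c = 0 := by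
  obtain ⟨-, h2, ⟨p, hp, hpe⟩, -⟩ := h
  obtain ⟨u, v, huv⟩ := isCoprime_of_roots hp hg
  have h3 := congrArg (aeval A) huv
  rw [map_add, map_mul, map_mul, map_one] at h3
  calc e * c = (aeval A u * aeval A p + aeval A v * aeval A g) * e * c := by rw [h3, one_mul]
    _ = aeval A u * (aeval A p * e) * c + aeval A v * (aeval A g * e) * c := by
      rw [add_mul, add_mul]
      simp only [mul_assoc]
    _ = aeval A v * e * (aeval A g * c) := by
      rw [hpe, (commute_aeval h2 g).eq, mul_zero, zero_mul, zero_add]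
      simp only [mul_assoc]
    _ = 0 := by rw [hc, mul_zero]

/-- On `e₁ - e₀` the modified element acts as the identity, and on `1 - e₁` as `B`. Neither part has
eigenvalues in `Z`, so the new spectral idempotent `g` kills `1 - e₀`. -/
theorem IsSpectralIdem.mul_one_sub_eq_zero {Z : Set ℂ} (hZ : (1 : ℂ) ∉ Z) {B e₁ e₀ g : R}
    (h₁ : IsSpectralIdem Z B e₁) (h10 : e₁ * e₀ = e₀) (h01 : e₀ * e₁ = e₀) (h00 : e₀ * e₀ = e₀)
    (hg : IsSpectralIdem Z (e₀ * B * e₀ + B * (1 - e₁) + (e₁ - e₀)) g) : g * (1 - e₀) = 0 := by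
  obtain ⟨h11, hB, -, ⟨q, hq, hqe⟩⟩ := h₁
  set A := e₀ * B * e₀ + B * (1 - e₁) + (e₁ - e₀) with hA
  have hA1 : A * (1 - e₁) = B * (1 - e₁) := by
    simp only [hA, add_mul, sub_mul, mul_sub, mul_one, mul_assoc, h11, h01]
    abel
  have hA2 : A * (e₁ - e₀) = e₁ - e₀ := by
    simp only [hA, add_mul, sub_mul, mul_sub, mul_one, mul_assoc, h11, h01, h10, h00]
    abel
  have h1 : aeval A q * (1 - e₁) = 0 := by
    rw [aeval_mul_eq_of_mul_eq hA1 ((Commute.one_right B).sub_right hB), hqe]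
  have h2 : aeval A ((X - 1 : ℝ[X]) * q) * (1 - e₁) = 0 := by rw [map_mul, mul_assoc, h1, mul_zero]
  have h3 : aeval A (q * (X - 1 : ℝ[X])) * (e₁ - e₀) = 0 := by
    rw [map_mul, mul_assoc, map_sub, aeval_X, map_one, sub_mul, hA2, one_mul, sub_self, mul_zero]
  refine hg.mul_eq_zero (g := (X - 1 : ℝ[X]) * q) (fun z hz h0 => ?_) ?_
  · rw [map_mul, _root_.mul_eq_zero] at h0
    refine hq z hz (h0.resolve_left fun h => hZ ?_)
    rw [map_sub, aeval_X, map_one, sub_eq_zero] at h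
    rwa [← h]
  · rw [show 1 - e₀ = (1 - e₁) + (e₁ - e₀) by abel, mul_add, h2, mul_comm (X - 1 : ℝ[X]), h3,
      add_zero]

theorem hasRank_iff_rank {n : Type*} [Fintype n] [DecidableEq n] {A : Matrix n n ℝ} {r : ℕ} :
    HasRank A r ↔ A.rank = r := by
  suffices h : ∀ r, HasRank A r → A.rank = r by
    refine ⟨h r, fun hr => ?_⟩
    obtain ⟨r', hr'⟩ := exists_hasRank A
    rwa [← hr, h r' hr']
  rintro r ⟨Q, s, ⟨L, hL⟩, ⟨R, hR⟩, rfl⟩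
  apply le_antisymm
  · exact (Matrix.rank_mul_le_left Q s).trans ((Matrix.rank_le_card_width Q).trans_eq (by simp))
  · have h1 : (L * (Q * s * R)).rank = r := by
      rw [Matrix.mul_assoc, hR, Matrix.mul_one, hL, Matrix.rank_one, Fintype.card_fin]
    exact h1.symm.trans_le ((Matrix.rank_mul_le_right _ _).trans (Matrix.rank_mul_le_left _ _))

end SpectralIdempotentLemmas

/-! ### Recognizing the spectral subspace by ranks and dimension -/

section Summands

variable {G W : Type*} [Monoid G] [AddCommGroup W] [Module ℝ W] [FiniteDimensional ℝ W]
  {ρ : Representation ℝ G W}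
  {ι : Type*} {X : ι → Type*} [∀ i, AddCommGroup (X i)] [∀ i, Module ℝ (X i)]
  [∀ i, FiniteDimensional ℝ (X i)]
  {τ : ∀ i, Representation ℝ G (X i)} [Fintype ι]

/-- The algebra morphism sending an equivariant endomorphism to its matrix. -/
noncomputable def toMatrixAlgHom (ρ : Representation ℝ G W) :
    IntertwiningMap ρ ρ →ₐ[ℝ]
      Matrix (Fin (Module.finrank ℝ W)) (Fin (Module.finrank ℝ W)) ℝ :=
  (LinearMap.toMatrixAlgEquiv (Module.finBasis ℝ W)).toAlgHom.comp (toEndAlgHom ρ)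

theorem hasRank_toMatrixAlgHom (A : IntertwiningMap ρ ρ) :
    HasRank (toMatrixAlgHom ρ A) (Module.finrank ℝ (LinearMap.range A.toLinearMap)) := by
  refine hasRank_iff_rank.2 ?_
  rw [Matrix.rank_eq_finrank_range_toLin _ (Module.finBasis ℝ W)
    (Module.finBasis ℝ W)]
  exact congrArg (fun T : W →ₗ[ℝ] W => Module.finrank ℝ (LinearMap.range T))
    (Matrix.toLin_toMatrix (Module.finBasis ℝ W) (Module.finBasis ℝ W) A.toLinearMap)

theorem spectralRank_toMatrixAlgHom {Z : Set ℂ} {A e : IntertwiningMap ρ ρ}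
    (he : IsSpectralIdem Z A e) {r : ℕ} : SpectralRank Z (toMatrixAlgHom ρ A) r ↔
      Module.finrank ℝ (LinearMap.range e.toLinearMap) = r := by
  have h : SpectralRank Z (toMatrixAlgHom ρ A) (Module.finrank ℝ (LinearMap.range e.toLinearMap)) :=
    ⟨_, he.map (toMatrixAlgHom ρ), hasRank_toMatrixAlgHom e⟩
  exact ⟨fun h' => h.unique h', fun h' => h' ▸ h⟩

theorem IsSystem.finrank_range {K : ι → Type} [∀ i, Fintype (K i)]
    {q : ∀ i, K i → IntertwiningMap (τ i) ρ} {p : ∀ i, K i → IntertwiningMap ρ (τ i)}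
    (hs : IsSystem q p) : Module.finrank ℝ (LinearMap.range (systemIdem q p).toLinearMap) =
      ∑ i, Fintype.card (K i) * Module.finrank ℝ (X i) := by
  obtain ⟨φ⟩ := hs.nonempty_equiv (S := (systemIdem q p).range) rfl
  refine φ.toLinearEquiv.finrank_eq.trans ?_
  rw [Module.finrank_directSum, Fintype.sum_sigma]
  exact Finset.sum_congr rfl fun i _ =>
    (Finset.sum_const (Module.finrank ℝ (X i))).trans (by simp)

variable {D : ι → Type*} [∀ i, DivisionRing (D i)] [∀ i, Algebra ℝ (D i)]
  {f : ∀ i, IntertwiningMap (τ i) (τ i) →ₐ[ℝ] D i} {n : ι → ℕ}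
  {q : ∀ i, Fin (n i) → IntertwiningMap (τ i) ρ} {p : ∀ i, Fin (n i) → IntertwiningMap ρ (τ i)}
  (hs : IsSystem q p) (hf : ∀ i, Surjective (f i))
  (hn : ∀ i A, f i A = 0 ↔ IsNilpotent A)
  (hne : Pairwise fun i j => IsEmpty ((τ i).Equiv (τ j)))
  (hr : IsRadical f (1 - systemIdem q p))

theorem exists_isSystem_of_hasRank {m : ι → ℕ} {e : IntertwiningMap ρ ρ} (he : e * e = e)
    (hm : ∀ i, HasRank (systemHom hs hf hn hne hr i e) (m i)) :
    ∃ (q' : ∀ i, Fin (m i) → IntertwiningMap (τ i) ρ)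
      (p' : ∀ i, Fin (m i) → IntertwiningMap ρ (τ i)), IsSystem q' p' ∧
        e * systemIdem q' p' = systemIdem q' p' ∧ systemIdem q' p' * e = systemIdem q' p' ∧
        ∀ i, systemHom hs hf hn hne hr i e = systemHom hs hf hn hne hr i (systemIdem q' p') := by
  obtain ⟨m', q', p', hs', hq', hp', hr'⟩ := exists_isSystem_fin hf hn e he
  have h1 : ∀ i, systemHom hs hf hn hne hr i e =
      systemHom hs hf hn hne hr i (systemIdem q' p') := fun i => by
    have := systemHom_eq_zero hs hf hn hne hr hr' i
    rwa [map_sub, sub_eq_zero] at this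
  obtain rfl : m' = m := by
    funext i
    have := hasRank_systemHom_systemIdem hs hf hn hne hr hs' i
    rw [← h1, Fintype.card_fin] at this
    exact this.unique (hm i)
  refine ⟨q', p', hs', ?_, ?_, h1⟩
  · ext w
    change e (systemIdem q' p' w) = systemIdem q' p' w
    simp only [systemIdem_apply, map_sum, hq']
  · ext w
    change systemIdem q' p' (e w) = systemIdem q' p' w
    simp only [systemIdem_apply, hp']

/-- The ranks only see the copies of the `τ i`. The dimension bound excludes a further summand on
which all `f i` vanish. -/
theorem exists_systemIdem_eq_iff {m : ι → ℕ} {e : IntertwiningMap ρ ρ} (he : e * e = e) :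
    (∃ (q' : ∀ i, Fin (m i) → IntertwiningMap (τ i) ρ)
      (p' : ∀ i, Fin (m i) → IntertwiningMap ρ (τ i)), IsSystem q' p' ∧ systemIdem q' p' = e) ↔
      (∀ i, HasRank (systemHom hs hf hn hne hr i e) (m i)) ∧
        Module.finrank ℝ (LinearMap.range e.toLinearMap) ≤ ∑ i, m i * Module.finrank ℝ (X i) := by
  constructor
  · rintro ⟨q', p', hs', rfl⟩
    refine ⟨fun i => ?_, ?_⟩
    · simpa using hasRank_systemHom_systemIdem hs hf hn hne hr hs' i
    · rw [hs'.finrank_range]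
      simp
  · rintro ⟨hm, hd⟩
    obtain ⟨q', p', hs', h1, h2, -⟩ := exists_isSystem_of_hasRank hs hf hn hne hr he hm
    refine ⟨q', p', hs', ?_⟩
    have hle : LinearMap.range (systemIdem q' p').toLinearMap ≤ LinearMap.range e.toLinearMap := by
      rintro _ ⟨w, rfl⟩
      exact ⟨systemIdem q' p' w, congrArg (fun A : IntertwiningMap ρ ρ => A w) h1⟩
    have heq := Submodule.eq_of_le_of_finrank_le hle (by
      rw [hs'.finrank_range]
      simpa using hd)
    rw [← h2]
    ext w
    have hw : e w ∈ LinearMap.range (systemIdem q' p').toLinearMap := by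
      rw [heq]
      exact ⟨w, rfl⟩
    obtain ⟨w', hw'⟩ := hw
    change systemIdem q' p' (e w) = e w
    rw [← hw']
    exact congrArg (fun A : IntertwiningMap ρ ρ => A w') hs'.idem

/-- A lift `B` of `M` may have too large a spectral subspace. The excess `e₁ - e₀` has image zero in
the matrices, so there the eigenvalues can be moved to `1 ∉ Z` without changing the image. -/
theorem exists_systemHom_eq_and_finrank_le {Z : Set ℂ} (hZ : ∀ z ∈ Z, conj z ∈ Z)
    (hZ1 : (1 : ℂ) ∉ Z) {m : ι → ℕ} (M : ∀ i, Matrix (Fin (n i)) (Fin (n i)) (D i))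
    (hM : ∀ i, SpectralRank Z (M i) (m i)) :
    ∃ A, (∀ i, systemHom hs hf hn hne hr i A = M i) ∧ ∃ e, IsSpectralIdem Z A e ∧
      Module.finrank ℝ (LinearMap.range e.toLinearMap) ≤ ∑ i, m i * Module.finrank ℝ (X i) := by
  obtain ⟨B, hB⟩ := exists_systemHom_eq hs hf hn hne hr M
  obtain ⟨e₁, he₁⟩ := exists_isSpectralIdem hZ B
  have hmap : ∀ i, IsSpectralIdem Z (M i) (systemHom hs hf hn hne hr i e₁) := fun i => by
    have := he₁.map (systemHom hs hf hn hne hr i)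
    rwa [hB] at this
  have hm : ∀ i, HasRank (systemHom hs hf hn hne hr i e₁) (m i) := fun i => by
    obtain ⟨e, he, her⟩ := hM i
    rwa [(hmap i).unique he]
  obtain ⟨q', p', hs', h10, h01, hπ⟩ := exists_isSystem_of_hasRank hs hf hn hne hr he₁.1 hm
  set e₀ := systemIdem q' p'
  let A := e₀ * B * e₀ + B * (1 - e₁) + (e₁ - e₀)
  obtain ⟨g, hg⟩ := exists_isSpectralIdem hZ A
  refine ⟨A, fun i => ?_, g, hg, ?_⟩
  · obtain ⟨h1, h2, -⟩ := hmap i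
    simp only [A, map_add, map_mul, map_sub, map_one, hB, ← hπ]
    rw [← h2.eq, mul_assoc, h1, mul_sub, mul_one]
    abel
  · have h0 := he₁.mul_one_sub_eq_zero hZ1 h10 h01 hs'.idem hg
    rw [mul_sub, mul_one, sub_eq_zero] at h0
    have h1 : LinearMap.range g.toLinearMap =
        (LinearMap.range e₀.toLinearMap).map g.toLinearMap := by
      rw [← LinearMap.range_comp]
      exact congrArg (fun A : IntertwiningMap ρ ρ => LinearMap.range A.toLinearMap) h0
    rw [h1]
    refine (Submodule.finrank_map_le _ _).trans ?_
    rw [hs'.finrank_range]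
    simp

end Summands

/-! ### From stratified matrices to the endomorphism algebra -/

section Stratifications

variable {G V : Type*} [Monoid G] [AddCommGroup V] [Module ℝ V] [FiniteDimensional ℝ V]
  {ρ : Representation ℝ G V} {F F' : Type*} [NormedAddCommGroup F] [NormedSpace ℝ F]
  [NormedAddCommGroup F'] [NormedSpace ℝ F']

theorem isUnionOfSubmanifolds_of_hasStrat {rel : F → F → Prop} {N : Set F} {c : ℕ}
    (h : HasStrat rel (fun _ => Set.univ) N c 1) (L : IntertwiningMap ρ ρ →ₗ[ℝ] F)
    (hL : Surjective L) (L' : IntertwiningMap ρ ρ →ₗ[ℝ] F') {O : Set F'} (hO : IsOpen O)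
    (hrel : ∀ A (C : (IntertwiningMap ρ ρ)ˣ), rel (L A) (L (C * A * ↑C⁻¹)))
    (hrel' : ∀ A (C : (IntertwiningMap ρ ρ)ˣ), L' A ∈ O → L' (C * A * ↑C⁻¹) ∈ O)
    (hN : ∀ x ∈ N, ∃ A, L A = x ∧ L' A ∈ O) :
    IsUnionOfSubmanifolds {A | L A ∈ N ∧ L' A ∈ O} c := by
  classical
  obtain ⟨I, _, M, d, h1, h2, h3, h4, h5, h6, h7⟩ := h
  have hsub : ∀ i, M i ⊆ N := fun i => by rw [h2]; exact Set.subset_iUnion M i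
  -- `HasStrat` tolerates empty strata, the conclusion does not. The unique minimal stratum survives
  -- because it meets its test sets.
  let J := {i // (M i).Nonempty}
  let σ := (Fintype.equivFin J).symm
  refine ⟨Fintype.card J, fun j => {A | L A ∈ M (σ j) ∧ L' A ∈ O}, fun j => d (σ j), ?_, ?_, ?_, ?_,
    ?_, fun j => h5 _, ?_⟩
  · intro j
    obtain ⟨x, hx⟩ := (σ j).2
    obtain ⟨A, hA, hA'⟩ := hN x (hsub _ hx)
    exact ⟨A, hA ▸ hx, hA'⟩
  · intro i j hij
    refine Set.disjoint_left.2 fun A hA hA' => ?_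
    exact Set.disjoint_left.1 (h1 fun h => hij (σ.injective (Subtype.ext h))) hA.1 hA'.1
  · ext A
    simp only [Set.mem_ofPred_eq, Set.mem_iUnion, h2]
    constructor
    · rintro ⟨⟨i, hi⟩, hA⟩
      exact ⟨σ.symm ⟨i, _, hi⟩, by rwa [Equiv.apply_symm_apply], hA⟩
    · rintro ⟨j, hj, hA⟩
      exact ⟨⟨_, hj⟩, hA⟩
  · rintro j A ⟨hA, hA'⟩ C
    exact ⟨h3 _ _ _ (hrel A C) hA, hrel' A C hA'⟩
  · intro j e
    refine isSubmanifoldNormed_of_submanifoldAt ?_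
    rintro _ ⟨A, ⟨hA, hA'⟩, rfl⟩
    let T : (Fin (Module.finrank ℝ (IntertwiningMap ρ ρ)) → ℝ) →L[ℝ] F :=
      LinearMap.toContinuousLinearMap (L ∘ₗ e.symm.toLinearMap)
    let T' : (Fin (Module.finrank ℝ (IntertwiningMap ρ ρ)) → ℝ) →L[ℝ] F' :=
      LinearMap.toContinuousLinearMap (L' ∘ₗ e.symm.toLinearMap)
    have hT : ∀ A, T (e A) = L A := fun A => congrArg L (e.symm_apply_apply A)
    have hT' : ∀ A, T' (e A) = L' A := fun A => congrArg L' (e.symm_apply_apply A)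
    have hs : SubmanifoldAt (T ⁻¹' M (σ j)) (d (σ j)) (e A) := by
      refine SubmanifoldAt.preimage T (hL.comp e.symm.surjective) (h4 _ _ ?_)
      rwa [hT]
    refine hs.congr ?_
    filter_upwards [(hO.preimage T'.continuous).mem_nhds (x := e A) (by
      rwa [Set.mem_preimage, hT'])] with x hx
    obtain ⟨B, rfl⟩ := e.surjective x
    rw [Set.mem_preimage, hT'] at hx
    rw [e.injective.mem_set_image, Set.mem_preimage, hT]
    exact ⟨fun h => h.1, fun h => ⟨h, hx⟩⟩
  · obtain ⟨hu, ⟨⟨i, hi⟩⟩⟩ := Nat.card_eq_one_iff_unique.1 h6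
    obtain ⟨x, hx, -⟩ := h7 i hi 0
    refine ⟨σ.symm ⟨i, x, hx⟩, ?_, fun j hj => ?_⟩
    · change d (σ (σ.symm ⟨i, x, hx⟩)) = c
      rwa [Equiv.apply_symm_apply]
    · rw [Equiv.eq_symm_apply]
      have h : (⟨σ j, hj⟩ : {i // d i = c}) = ⟨i, hi⟩ := hu.elim _ _
      exact Subtype.ext (Subtype.mk.inj h)

end Stratifications

/-! ### The matrix results for each type -/

section Types

attribute [local instance] Matrix.linftyOpNormedAddCommGroup Matrix.linftyOpNormedSpace
  Matrix.linftyOpNormedRing Matrix.linftyOpNormedAlgebra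

theorem EndType.cenWeight_real (r : ℕ) : EndType.real.cenWeight r = (r + 1) / 2 := by
  change ⌈(r : ℚ) / 2⌉₊ = (r + 1) / 2
  have h1 : (r : ℚ) ≤ 2 * ((r + 1) / 2 : ℕ) := by exact_mod_cast (by omega : r ≤ 2 * ((r + 1) / 2))
  refine le_antisymm (Nat.ceil_le.2 (by linarith)) ?_
  have h2 : (r : ℚ) ≤ 2 * (⌈(r : ℚ) / 2⌉₊ : ℕ) := by linarith [Nat.le_ceil ((r : ℚ) / 2)]
  have h3 : r ≤ 2 * ⌈(r : ℚ) / 2⌉₊ := by exact_mod_cast h2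
  omega

theorem IsOfType.exists_strata {G V : Type*} [Monoid G] [AddCommGroup V] [Module ℝ V]
    {τ : Representation ℝ G V} {t : EndType} (h : IsOfType τ t) :
    ∃ (D : Type) (_ : NormedDivisionRing D) (_ : NormedAlgebra ℝ D) (_ : FiniteDimensional ℝ D)
      (f : IntertwiningMap τ τ →ₐ[ℝ] D), Surjective f ∧ (∀ A, f A = 0 ↔ IsNilpotent A) ∧
      (∀ m r, r ≤ m → HasStrat ConjRel (fun _ => Set.univ)
        {A : Matrix (Fin m) (Fin m) D | SpectralRank {0} A r} (t.nilWeight r) 1) ∧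
      ∀ m r, r ≤ m → HasStrat ConjRel (fun _ => Set.univ)
        {A : Matrix (Fin m) (Fin m) D | SpectralRank imAxis A r} (t.cenWeight r) 1 := by
  cases t with
  | real =>
    obtain ⟨f, hf, hn⟩ := h
    refine ⟨ℝ, inferInstance, inferInstance, inferInstance, f, hf, hn, fun m r hr => ?_,
      fun m r hr => ?_⟩
    · have := hasStrat_spectralRank_zero (D := ℝ) hr
      rwa [Module.finrank_self, one_mul] at this
    · rw [EndType.cenWeight_real]
      exact hasStrat_real hr
  | complex =>
    obtain ⟨f, hf, hn⟩ := h
    refine ⟨ℂ, inferInstance, inferInstance, inferInstance, f, hf, hn, fun m r hr => ?_,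
      fun m r hr => hasStrat_complex hr⟩
    have := hasStrat_spectralRank_zero (D := ℂ) hr
    rwa [Complex.finrank_real_complex] at this
  | quaternionic =>
    obtain ⟨f, hf, hn⟩ := h
    refine ⟨Quaternion ℝ, inferInstance, inferInstance, inferInstance, f, hf, hn, fun m r hr => ?_,
      fun m r hr => hasStrat_quaternion hr⟩
    have := hasStrat_spectralRank_zero (D := Quaternion ℝ) hr
    rwa [Quaternion.finrank_eq_four] at this

end Types

/-! ### The common statement for a set of eigenvalues -/

section Main

attribute [local instance] Matrix.linftyOpNormedAddCommGroup Matrix.linftyOpNormedSpace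
  Matrix.linftyOpNormedRing Matrix.linftyOpNormedAlgebra

variable {G W : Type*} [Monoid G] [AddCommGroup W] [Module ℝ W] [FiniteDimensional ℝ W]
  {ρ : Representation ℝ G W}
  {ι : Type*} {X : ι → Type*} [∀ i, AddCommGroup (X i)] [∀ i, Module ℝ (X i)]
  [∀ i, FiniteDimensional ℝ (X i)]
  {τ : ∀ i, Representation ℝ G (X i)} [Fintype ι]
  {D : ι → Type} [∀ i, NormedDivisionRing (D i)] [∀ i, NormedAlgebra ℝ (D i)]
  [∀ i, FiniteDimensional ℝ (D i)] {f : ∀ i, IntertwiningMap (τ i) (τ i) →ₐ[ℝ] D i}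

theorem conjRel_map {R S : Type*} [Ring R] [Algebra ℝ R] [Ring S] [Algebra ℝ S] (φ : R →ₐ[ℝ] S)
    (A : R) (C : Rˣ) : ConjRel (φ A) (φ (C * A * ↑C⁻¹)) :=
  ⟨φ C, φ ↑C⁻¹, by rw [← map_mul, C.mul_inv, map_one], by rw [← map_mul, C.inv_mul, map_one],
    by rw [map_mul, map_mul]⟩

/-- The endomorphisms whose spectral subspace attached to `Z` is isomorphic to `U` form a finite
union of submanifolds. -/
theorem isUnionOfSubmanifolds_of_spectralRank (hf : ∀ i, Surjective (f i))
    (hn : ∀ i A, f i A = 0 ↔ IsNilpotent A)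
    (hne : Pairwise fun i j => IsEmpty ((τ i).Equiv (τ j)))
    {U U' : Subrepresentation ρ} (hUU' : IsCompl U.toSubmodule U'.toSubmodule) {m : ι → ℕ}
    (φ : U.toRepresentation.Equiv
      (Representation.directSum fun k : (i : ι) × Fin (m i) => τ k.1))
    {Z : Set ℂ} (hZ : ∀ z ∈ Z, conj z ∈ Z) (hZc : IsClosed Z) (hZ1 : (1 : ℂ) ∉ Z) {c : ι → ℕ}
    (hc : ∀ i n, m i ≤ n → HasStrat ConjRel (fun _ => Set.univ)
      {A : Matrix (Fin n) (Fin n) (D i) | SpectralRank Z A (m i)} (c i) 1)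
    {S : IntertwiningMap ρ ρ → Subrepresentation ρ}
    (hS : ∀ A e, IsSpectralIdem Z A e → (S A).toSubmodule = LinearMap.range e.toLinearMap) :
    IsUnionOfSubmanifolds {A | Nonempty ((S A).toRepresentation.Equiv U.toRepresentation)}
      (∑ i, c i) := by
  obtain ⟨n, q, p, hs, -, -, hr⟩ := exists_isSystem_fin (ρ := ρ) hf hn 1 (one_mul 1)
  let Φ := systemHom hs hf hn hne hr
  -- Here the complement `U'` enters: the projection onto `U` maps to an idempotent `n i × n i`
  -- matrix of rank `m i`.
  have hmn : ∀ i, m i ≤ n i := fun i => by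
    obtain ⟨e, he, heU⟩ := exists_idem_of_isCompl hUU'
    obtain ⟨q', p', hs', rfl⟩ := exists_isSystem_of_equiv (K := fun i => Fin (m i)) he heU φ
    have h := hasRank_systemHom_systemIdem hs hf hn hne hr hs' i
    rw [Fintype.card_fin] at h
    have h1 := h.le_card (by rw [← map_mul, he])
    rwa [Fintype.card_fin] at h1
  let L : IntertwiningMap ρ ρ →ₗ[ℝ] ∀ i, Matrix (Fin (n i)) (Fin (n i)) (D i) :=
    LinearMap.pi fun i => (Φ i).toLinearMap
  let N : Set (∀ i, Matrix (Fin (n i)) (Fin (n i)) (D i)) :=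
    Set.univ.pi fun i => {A | SpectralRank Z A (m i)}
  have hN : HasStrat (fun x y : ∀ i, Matrix (Fin (n i)) (Fin (n i)) (D i) =>
      ∀ i, ConjRel (x i) (y i)) (fun _ => Set.univ) N (∑ i, c i) 1 := by
    have := HasStrat.pi fun i => hc i (n i) (hmn i)
    rwa [Finset.prod_const_one] at this
  -- This is the dimension of `U`; not exceeding it is the open part of the condition.
  let d := ∑ i, m i * Module.finrank ℝ (X i)
  have hiff : ∀ A, Nonempty ((S A).toRepresentation.Equiv U.toRepresentation) ↔ L A ∈ N ∧
      toMatrixAlgHom ρ A ∈ {A | ∃ r ≤ d, SpectralRank Z A r} := by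
    intro A
    obtain ⟨e, he⟩ := exists_isSpectralIdem hZ A
    have h1 : L A ∈ N ↔ ∀ i, HasRank (Φ i e) (m i) := by
      refine Set.mem_univ_pi.trans (forall_congr' fun i => ?_)
      constructor
      · rintro ⟨e', he', h⟩
        rwa [(he.map (Φ i)).unique he']
      · exact fun h => ⟨_, he.map (Φ i), h⟩
    have h2 : toMatrixAlgHom ρ A ∈ {A | ∃ r ≤ d, SpectralRank Z A r} ↔
        Module.finrank ℝ (LinearMap.range e.toLinearMap) ≤ d := by
      simp only [Set.mem_ofPred_eq, spectralRank_toMatrixAlgHom he]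
      exact ⟨fun ⟨r, hr, h⟩ => h ▸ hr, fun h => ⟨_, h, rfl⟩⟩
    rw [h1, h2, ← exists_systemIdem_eq_iff hs hf hn hne hr he.1]
    constructor
    · rintro ⟨ψ⟩
      exact exists_isSystem_of_equiv (K := fun i => Fin (m i)) he.1 (hS A e he) (ψ.trans φ)
    · rintro ⟨q', p', hs', rfl⟩
      obtain ⟨ψ⟩ := hs'.nonempty_equiv (hS A _ he)
      exact ⟨ψ.trans φ.symm⟩
  simp only [hiff]
  refine isUnionOfSubmanifolds_of_hasStrat hN L (fun M => ?_) (toMatrixAlgHom ρ).toLinearMap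
    (isOpen_spectralRank_le hZ hZc d) (fun A C i => conjRel_map (Φ i) A C) ?_ ?_
  · obtain ⟨A, hA⟩ := exists_systemHom_eq hs hf hn hne hr M
    exact ⟨A, funext hA⟩
  · rintro A C ⟨r, hr, h⟩
    exact ⟨r, hr, h.conjRel (conjRel_map (toMatrixAlgHom ρ) A C)⟩
  · intro M hM
    obtain ⟨A, hA, e, he, hd⟩ := exists_systemHom_eq_and_finrank_le hs hf hn hne hr hZ hZ1 M
      (Set.mem_univ_pi.1 hM)
    exact ⟨A, funext hA, _, hd, (spectralRank_toMatrixAlgHom he).2 rfl⟩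

end Main

end MonoidBifurcation

/-! ### The theorem -/

open MonoidBifurcation in
theorem theorem3p1 {G : Type*} [Monoid G] {W : Type*} [AddCommGroup W] [Module ℝ W]
    [FiniteDimensional ℝ W] (ρ : Representation ℝ G W)
    (U U' : Subrepresentation ρ) (hUU' : IsCompl U.toSubmodule U'.toSubmodule)
    {ι : Type*} [Fintype ι] (X : ι → Type*) [∀ i, AddCommGroup (X i)] [∀ i, Module ℝ (X i)]
    [∀ i, FiniteDimensional ℝ (X i)] (τ : ∀ i, Representation ℝ G (X i))
    (hind : ∀ i, IsIndecomposable (τ i))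
    (hne : Pairwise fun i j => IsEmpty ((τ i).Equiv (τ j)))
    (κ : ι → EndType) (hκ : ∀ i, IsOfType (τ i) (κ i)) (m : ι → ℕ)
    (hU : Nonempty (U.toRepresentation.Equiv
      (Representation.directSum fun k : (i : ι) × Fin (m i) => τ k.1))) :
    IsUnionOfSubmanifolds (nilSet U) (∑ i, (κ i).nilWeight (m i)) ∧
      IsUnionOfSubmanifolds (cenSet U) (∑ i, (κ i).cenWeight (m i)) := by
  obtain ⟨φ⟩ := hU
  choose D _ _ _ f hf hn hnil hcen using fun i => (hκ i).exists_strata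
  refine ⟨?_, ?_⟩
  · exact isUnionOfSubmanifolds_of_spectralRank hf hn hne hUU' φ conj_mem_singleton_zero
      isClosed_singleton (by simp) (fun i n h => hnil i n (m i) h) fun A e he => he.genKer_eq
  · exact isUnionOfSubmanifolds_of_spectralRank hf hn hne hUU' φ conj_mem_imAxis
      isClosed_imAxis (by simp [imAxis]) (fun i n h => hcen i n (m i) h)
      fun A e he => he.centerSubspace_eq
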